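/- **Wavelets.** For $g:\mathbb R\to\mathbb R$ and $j,k\in\mathbb Z$ put $g_{jk}(x)=2^{j/2}g(2^jx-k)$, and let $V_j$ be the closed linear span of $\{\varphi_{jk}:k\in\mathbb Z\}$ in $L^2(\mathbb R)$. Let $N\ge 0$ be an integer and let $\varphi:\mathbb R\to\mathbb R$ be a father wavelet such that: (i) $\varphi$ generates a multiresolution analysis of $L^2(\mathbb R)$, i.e. $\{\varphi_{0k}\}_k$ is orthonormal, $V_j\subseteq V_{j+1}$ for all $j\in\mathbb Z$, and $\bigcup_jV_j$ is dense in $L^2(\mathbb R)$; (ii) $\varphi$ is $N+1$ times weakly differentiable and $\sum_{k\in\mathbb Z}|\varphi^{(N+1)}(x-k)|$ is essentially bounded in $x$; (iii) there is a bounded non-increasing function $\Phi$ on $[0,\infty)$ with $|\varphi(u)|\le\Phi(|u|)$, $\int\Phi(|u|)\,du<\infty$ and $\int\Phi(|u|)|u|^N\,du<\infty$. Let $\psi:\mathbb R\to\mathbb R$ be an associated mother wavelet: $\{\psi_{0k}\}_k$ is an orthonormal basis of the orthogonal complement of $V_0$ in $V_1$, and $\psi$ satisfies (iii) as well (with its own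 majorant). **Class of densities.** Let $0<s<N+1$, $1\le p,q\le\infty$, $s\ge 1/p$ (with $1/\infty=0$), $1\le r<\infty$ and $L,T>0$. Put $$J_{spq}(f)=\Big\|\Big(\int f\varphi_{0k}\Big)_{k\in\mathbb Z}\Big\|_{\ell^p}+\Big(\sum_{j\ge0}\Big(2^{j(s+1/2-1/p)}\Big\|\Big(\int f\psi_{jk}\Big)_{k\in\mathbb Z}\Big\|_{\ell^p}\Big)^q\Big)^{1/q}$$ (with the usual modification if $q=\infty$), and let $\mathcal D(L,T)$ be the set of probability densities $f$ on $\mathbb R$ that vanish outside $[-T,T]$ and satisfy $J_{spq}(f)\le L$. Assume that $\mathcal D(L',T)\ne\emptyset$ for some $L'<L$. **Private minimax risk.** Let $X_1,\dots,X_n$ be i.i.d. with density $f$. A mechanism with private views in a measurable space $\mathcal Z$ is a sequence $Q=(Q_i)_{i\ge1}$ of Markov kernels from $\mathbb R\times\mathcal Z^{i-1}$ to $\mathcal Z$; the private views are drawn successively as $Z_i\sim Q_i(\cdot\mid X_i,Z_1,\dots,Z_{i-1})$. It is locally $\alpha$-differentially private if $Q_i(A\mid x,z)\le e^\alpha Q_i(A\mid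 x',z)$ for all $i$, all measurable $A\subseteq\mathcal Z$, all $x,x'\in\mathbb R$ and all $z\in\mathcal Z^{i-1}$. Let $$\mathcal R^*_{n,\alpha}=\inf_{Q,\tilde f}\ \sup_{f\in\mathcal D(L,T)}\mathbb E_{f,Q}\int_{\mathbb R}|\tilde f(x)-f(x)|^r\,dx,$$ where the infimum is over all locally $\alpha$-differentially private mechanisms $Q$ with private views in $\mathcal Z$ and all measurable estimators $\tilde f$ based on $Z_1,\dots,Z_n$. **Corollary (combined lower bound).** There are a constant $C>0$ and an integer $n_0$, depending only on $\varphi,\psi,N,s,p,q,r,L,T$ (and not on $\alpha$, $n$ or $\mathcal Z$), such that for every measurable space $\mathcal Z$, every $\alpha>0$ and every $n\ge n_0$ for which $m:=n(e^\alpha-1)^2\ge n_0$, $$\mathcal R^*_{n,\alpha}\ \ge\ C\cdot\begin{cases} n^{-\frac{rs}{2s+1}}\vee m^{-\frac{rs}{2s+2}}, & p>\frac r{s+1},\\[4pt] n^{-\frac{rs}{2s+1}}\vee\big(\frac m{\log m}\big)^{-\frac{r(s-1/p+1/r)}{2(s-1/p)+2}}, & \frac r{2s+1}<p\le\frac r{s+1},\\[4pt]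 \big(\frac n{\log n}\big)^{-\frac{r(s-1/p+1/r)}{2(s-1/p)+1}}\vee\big(\frac m{\log m}\big)^{-\frac{r(s-1/p+1/r)}{2(s-1/p)+2}}, & p\le\frac r{2s+1}.\end{cases}$$ In particular, for each fixed $\alpha>0$ the bound holds for all sufficiently large $n$. -/

import Mathlib

open MeasureTheory ProbabilityTheory Set
open scoped ENNReal ContDiff

universe u

noncomputable section

/-! ### Wavelets -/

/-- The dilated and translated function `g_{jk}(x) = 2^{j/2} g(2^j x - k)`. -/
def dilate (g : ℝ → ℝ) (j k : ℤ) (x : ℝ) : ℝ :=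
  (2 : ℝ) ^ ((j : ℝ) / 2) * g ((2 : ℝ) ^ j * x - k)

/-- The closed linear span `V_j` in `L²(ℝ)` of the functions `g_{jk}`, `k ∈ ℤ`. -/
def scaleSpace (g : ℝ → ℝ) (j : ℤ) : Submodule ℝ (Lp ℝ 2 (volume : Measure ℝ)) :=
  (Submodule.span ℝ
    {h : Lp ℝ 2 (volume : Measure ℝ) | ∃ k : ℤ, h =ᵐ[volume] dilate g j k}).topologicalClosure

/-- `g ∈ L²(ℝ)` and its integer translates form an orthonormal system. -/
def OrthonormalTranslates (g : ℝ → ℝ) : Prop :=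
  MemLp g 2 volume ∧
    ∀ k l : ℤ, ∫ x, dilate g 0 k x * dilate g 0 l x = if k = l then 1 else 0

/-- `φ` generates a multiresolution analysis of `L²(ℝ)`. (That the `V_j` intersect in `{0}`
follows from these properties.) -/
def GeneratesMRA (φ : ℝ → ℝ) : Prop :=
  OrthonormalTranslates φ ∧
  (∀ j : ℤ, scaleSpace φ j ≤ scaleSpace φ (j + 1)) ∧
  Dense (⋃ j : ℤ, (scaleSpace φ j : Set (Lp ℝ 2 (volume : Measure ℝ))))

/-- `v` is the `m`-th weak derivative of `g` on `ℝ`. -/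
def IsWeakDeriv (m : ℕ) (g v : ℝ → ℝ) : Prop :=
  LocallyIntegrable g volume ∧ LocallyIntegrable v volume ∧
  ∀ η : ℝ → ℝ, ContDiff ℝ ∞ η → HasCompactSupport η →
    ∫ x, g x * iteratedDeriv m η x = (-1) ^ m * ∫ x, v x * η x

/-- `g` has a bounded radially non-increasing majorant with finite moments of
orders `0` and `N`. -/
def HasRadialMajorant (N : ℕ) (g : ℝ → ℝ) : Prop :=
  ∃ Φ : ℝ → ℝ, (∃ B : ℝ, ∀ u, 0 ≤ u → Φ u ≤ B) ∧ AntitoneOn Φ (Ici 0) ∧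
    (∀ u : ℝ, |g u| ≤ Φ |u|) ∧
    Integrable (fun u : ℝ => Φ |u|) volume ∧
    Integrable (fun u : ℝ => Φ |u| * |u| ^ N) volume

/-- The standing assumption on the father wavelet. -/
structure IsFatherWavelet (N : ℕ) (φ : ℝ → ℝ) : Prop where
  mra : GeneratesMRA φ
  smooth : ∃ v : ℝ → ℝ, IsWeakDeriv (N + 1) φ v ∧
    ∃ B : ℝ, ∀ᵐ x ∂(volume : Measure ℝ), ∑' k : ℤ, ‖v (x - k)‖ₑ ≤ ENNReal.ofReal B
  decay : HasRadialMajorant N φ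

/-- `ψ` is a mother wavelet associated with `φ`: its integer translates form an orthonormal
basis of the orthogonal complement of `V_0` in `V_1`, and it decays like `φ`. -/
structure IsMotherWavelet (N : ℕ) (φ ψ : ℝ → ℝ) : Prop where
  orthonormal : OrthonormalTranslates ψ
  span_eq : scaleSpace ψ 0 = scaleSpace φ 1 ⊓ (scaleSpace φ 0)ᗮ
  decay : HasRadialMajorant N ψ

/-! ### Besov ellipsoids of densities -/

/-- The wavelet coefficient `∫ f g_{jk}`. -/
def waveletCoeff (g f : ℝ → ℝ) (j k : ℤ) : ℝ := ∫ x, f x * dilate g j k x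

/-- The functional `J_{spq}`. Norms in `ℓ^p` and `ℓ^q`, including `p = ∞` and `q = ∞`, are
`L^p` norms for the counting measure; for `p = ∞` the term `1 / p` is `1 / 0 = 0`. -/
def besovJ (φ ψ : ℝ → ℝ) (s : ℝ) (p q : ℝ≥0∞) (f : ℝ → ℝ) : ℝ≥0∞ :=
  eLpNorm (fun k : ℤ => waveletCoeff φ f 0 k) p Measure.count +
  eLpNorm (fun j : ℕ => ENNReal.ofReal ((2 : ℝ) ^ ((j : ℝ) * (s + 1 / 2 - 1 / p.toReal))) *
    eLpNorm (fun k : ℤ => waveletCoeff ψ f j k) p Measure.count) q Measure.count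

/-- Probability densities on `ℝ` supported in `[-T, T]` with `J_{spq}(f) ≤ L`. -/
def besovDensities (φ ψ : ℝ → ℝ) (s : ℝ) (p q : ℝ≥0∞) (L T : ℝ) : Set (ℝ → ℝ) :=
  {f | Measurable f ∧ (∀ x, 0 ≤ f x) ∧ Integrable f volume ∧ ∫ x, f x = 1 ∧
    Function.support f ⊆ Icc (-T) T ∧ besovJ φ ψ s p q f ≤ ENNReal.ofReal L}

/-! ### Local differential privacy -/

/-- A sequentially interactive mechanism: `Q i` is the kernel from which the data holder with
index `i` (counted from `0`) draws its private view, given its own datum in `ℝ` and the `i`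
earlier private views. -/
abbrev Mechanism (𝒵 : Type u) [MeasurableSpace 𝒵] : Type u :=
  (i : ℕ) → Kernel (ℝ × (Fin i → 𝒵)) 𝒵

/-- The mechanism consists of Markov kernels and provides `α`-differential privacy. -/
def LocallyPrivate {𝒵 : Type u} [MeasurableSpace 𝒵] (α : ℝ) (Q : Mechanism 𝒵) : Prop :=
  (∀ i, IsMarkovKernel (Q i)) ∧
  ∀ (i : ℕ) (x x' : ℝ) (z : Fin i → 𝒵) (A : Set 𝒵), MeasurableSet A →
    Q i (x, z) A ≤ ENNReal.ofReal (Real.exp α) * Q i (x', z) A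

/-- The conditional law `Qⁿ(· | x₁, …, xₙ)` of the private views given the data. -/
def channel {𝒵 : Type u} [MeasurableSpace 𝒵] (Q : Mechanism 𝒵) :
    (n : ℕ) → Kernel (Fin n → ℝ) (Fin n → 𝒵)
  | 0 => Kernel.const _ (Measure.dirac Fin.elim0)
  | n + 1 =>
    (((channel Q n).comap (fun x : Fin (n + 1) → ℝ => fun i => x i.castSucc) (by fun_prop)) ⊗ₖ
      ((Q n).comap (fun y : (Fin (n + 1) → ℝ) × (Fin n → 𝒵) => (y.1 (Fin.last n), y.2))
        (by fun_prop))).map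
      (fun y : (Fin n → 𝒵) × 𝒵 => (Fin.snoc (α := fun _ => 𝒵) y.1 y.2 : Fin (n + 1) → 𝒵))

/-- The law of the private views `(Z₁, …, Zₙ)` when `X₁, …, Xₙ` are i.i.d. with density `f`. -/
def privateLaw {𝒵 : Type u} [MeasurableSpace 𝒵] (Q : Mechanism 𝒵) (n : ℕ) (f : ℝ → ℝ) :
    Measure (Fin n → 𝒵) :=
  (Measure.pi fun _ : Fin n => volume.withDensity fun x => ENNReal.ofReal (f x)).bind
    (channel Q n)

/-- The risk `E_{f,Q} ‖f̃ - f‖_r^r` of an estimator `f̃` computed from the private views. -/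
def privateRisk {𝒵 : Type u} [MeasurableSpace 𝒵] (r : ℝ) (Q : Mechanism 𝒵) (n : ℕ)
    (est : (Fin n → 𝒵) → ℝ → ℝ) (f : ℝ → ℝ) : ℝ≥0∞ :=
  ∫⁻ z, (∫⁻ x : ℝ, ENNReal.ofReal (|est z x - f x| ^ r)) ∂(privateLaw Q n f)

/-- The private minimax risk over the class `F` under `L^r` loss: the infimum, over all
`α`-private mechanisms with private views in `𝒵` and all measurable estimators, of the
maximal risk. -/
def privateMinimaxRisk (𝒵 : Type u) [MeasurableSpace 𝒵] (r α : ℝ) (n : ℕ)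
    (F : Set (ℝ → ℝ)) : ℝ≥0∞ :=
  ⨅ (Q : Mechanism 𝒵) (_ : LocallyPrivate α Q) (est : (Fin n → 𝒵) → ℝ → ℝ)
    (_ : Measurable (Function.uncurry est)), ⨆ f ∈ F, privateRisk r Q n est f

end

/-! The lower bound reduces estimation to testing between local perturbations of one density. A
density `f₀` that is bounded below on `[0, T/2]` and uses only part of the radius `L` is perturbed
by bumps `a * g (2 ^ J * x - k)`, with `g` smooth, of integral zero and supported in the open unit
interval. Because the bumps are compactly supported and not the wavelets themselves, different `k`
live in disjoint dyadic cells and positivity is immediate. The price is that the Besov functional of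
such a sum has to be estimated.

Information. All laws are compared through `(∫ u dP)² ≤ Λ ∫ u² dP'` for every measurable `u ≥ 0`
(`SqDominated`). This says `1 + χ²(P, P') ≤ Λ` without densities, so it suits an arbitrary space of
views, and it multiplies along the successive views (`sqDominated_privateLaw`). For one view,
Cauchy-Schwarz gives at most the `χ²` information of the datum, of order `a² 2^(-J)`
(`sqDominated_viewLaw`). Privacy gives `(e^α - 1)²` times the squared `L¹` distance, of order `(e^α
- 1)² a² 2^(-2J)` (`sqDominated_viewLaw_of_private`). Both cases read `y a² 2^(-Jι)` for `n` views,
with `(y, ι) = (n, 1)` or `(m, 2)` (`InfoScale`).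

Rates. Dense case: bumps in all of about `2^J` cells, amplitude of order `2^(-Js)`, bounded
information, that is `2^(J(2s+ι)) ≍ y`; averaging over the hypercube gives a risk of order `a^r`
(`le_risk_of_cube`, `dense_rate`). Sparse case: one bump in an unknown cell, amplitude of order
`2^(-J(s-1/p))`; the information may now reach a multiple of the logarithm of the number of cells,
whence `y / log y`, and the risk is of order `a^r 2^(-J)` (`le_risk_of_single`, `sparse_rate`). The
two cases and the two values of `ι` give four lower bounds, of which each regime combines two.

Besov functional. What is needed is that smooth functions have coefficients of order `2^(-D(N+1))`
against the wavelets at level `D` (`exists_coeff_decay`). The argument uses no moments of `ψ`. A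
combination `W` of wavelets at level `D` is orthogonal to all translates of `φ` by multiples of
`2^(-D)`, so the correlation `y ↦ ∫ φ(x - y) W(x) dx` vanishes on that lattice. As `φ` has `N + 1`
weak derivatives, the correlation gains a factor `2^(-D(N+1))` (`rel_correlation_waveletSum`). This
controls the pairing of `W` with `h` smoothed by `φ / ∫ φ`, where `∫ φ ≠ 0` by density of the
multiresolution analysis. The remainder of the smoothing is small for slowly varying `h` and is
treated by induction on `D` after a dilation by two (`exists_abs_integral_waveletSum_le_of_slow`).
-/

noncomputable section

open Filter Topology

/-! ### Derivative families and Fubini identities for convolutions. -/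

/-- A sequence of bounded functions on `ℝ`, each the derivative of the preceding one. -/
structure IsDerivFamily (H : ℕ → ℝ → ℝ) : Prop where
  deriv : ∀ i x, HasDerivAt (H i) (H (i + 1) x) x
  bdd : ∀ i, ∃ B, ∀ x, |H i x| ≤ B

lemma IsDerivFamily.continuous {H : ℕ → ℝ → ℝ} (hH : IsDerivFamily H) (i : ℕ) :
    Continuous (H i) :=
  continuous_iff_continuousAt.2 fun x => (hH.deriv i x).continuousAt

lemma integrable_mul_of_bounded {α : Type*} [MeasurableSpace α] {μ : Measure α} {f g : α → ℝ}
    (hf : Integrable f μ) (hg : AEStronglyMeasurable g μ) {B : ℝ} (hB : ∀ x, |g x| ≤ B) :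
    Integrable (fun x => f x * g x) μ :=
  hf.mul_bdd (c := B) hg (Eventually.of_forall hB)

lemma abs_integral_mul_le_of_bounded {α : Type*} [MeasurableSpace α] {μ : Measure α} {f g : α → ℝ}
    (hf : Integrable f μ) {B : ℝ} (hB : ∀ x, |g x| ≤ B) :
    |∫ x, f x * g x ∂μ| ≤ (∫ x, |f x| ∂μ) * B := by
  rw [← integral_mul_const]
  rw [← Real.norm_eq_abs]
  refine norm_integral_le_of_norm_le (hf.abs.mul_const B) ?_
  refine Eventually.of_forall fun x => ?_
  rw [Real.norm_eq_abs, abs_mul]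
  exact mul_le_mul_of_nonneg_left (hB x) (abs_nonneg _)

/-- Differentiation under the integral sign of `y ↦ ∫ W(x) H(y + τ x) dx`. -/
lemma hasDerivAt_integral_mul_comp_add {W H H' : ℝ → ℝ} (hW : Integrable W) (τ : ℝ)
    (hH : ∀ x, HasDerivAt H (H' x) x) (hH'c : Continuous H') {B B' : ℝ} (hB : ∀ x, |H x| ≤ B)
    (hB' : ∀ x, |H' x| ≤ B') (y : ℝ) :
    HasDerivAt (fun y => ∫ x, W x * H (y + τ * x)) (∫ x, W x * H' (y + τ * x)) y := by
  have hHc : Continuous H := continuous_iff_continuousAt.2 fun x => (hH x).continuousAt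
  refine (hasDerivAt_integral_of_dominated_loc_of_deriv_le (𝕜 := ℝ) (s := univ)
    (F := fun y x => W x * H (y + τ * x)) (F' := fun y x => W x * H' (y + τ * x))
    (bound := fun x => |W x| * B') Filter.univ_mem ?_ ?_ ?_ ?_ ?_ ?_).2
  · exact Eventually.of_forall fun y => hW.aestronglyMeasurable.mul
      (by fun_prop : Continuous fun x => H (y + τ * x)).aestronglyMeasurable
  · exact integrable_mul_of_bounded hW
      (by fun_prop : Continuous fun x => H (y + τ * x)).aestronglyMeasurable (fun x => hB _)
  · exact hW.aestronglyMeasurable.mul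
      (by fun_prop : Continuous fun x => H' (y + τ * x)).aestronglyMeasurable
  · refine Eventually.of_forall fun x z _ => ?_
    rw [Real.norm_eq_abs, abs_mul]
    exact mul_le_mul_of_nonneg_left (hB' _) (abs_nonneg _)
  · exact hW.abs.mul_const _
  · refine Eventually.of_forall fun x z _ => ?_
    have h1 : HasDerivAt (fun n => H (n + τ * x)) (H' (z + τ * x)) z := by
      exact (hH (z + τ * x)).comp_add_const z (τ * x)
    exact h1.const_mul (W x)

lemma integrable_prod_mul_comp_sub {f g H : ℝ → ℝ} (hf : Integrable f) (hg : Integrable g)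
    (hH : Continuous H) {B : ℝ} (hB : ∀ x, |H x| ≤ B) :
    Integrable (fun p : ℝ × ℝ => f p.1 * g p.2 * H (p.1 - p.2)) (volume.prod volume) :=
  integrable_mul_of_bounded (hf.mul_prod hg)
    (by fun_prop : Continuous fun p : ℝ × ℝ => H (p.1 - p.2)).aestronglyMeasurable (fun p => hB _)

lemma integral_convolution_mul {f W H : ℝ → ℝ} (hf : Integrable f) (hW : Integrable W)
    (hH : Continuous H) {B : ℝ} (hB : ∀ x, |H x| ≤ B) :
    ∫ x, (∫ u, f u * H (x - u)) * W x = ∫ u, f u * ∫ x, H (x - u) * W x := by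
  have h := integral_integral_swap (f := fun x u => W x * f u * H (x - u))
    (integrable_prod_mul_comp_sub hW hf hH hB)
  calc ∫ x, (∫ u, f u * H (x - u)) * W x = ∫ x, ∫ u, W x * f u * H (x - u) := by
        refine integral_congr_ae (Eventually.of_forall fun x => ?_)
        simp only
        rw [mul_comm, ← integral_const_mul]
        simp only [mul_assoc]
    _ = ∫ u, ∫ x, W x * f u * H (x - u) := h
    _ = _ := by
        refine integral_congr_ae (Eventually.of_forall fun u => ?_)
        simp only
        rw [← integral_const_mul]
        refine integral_congr_ae (Eventually.of_forall fun x => ?_)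
        simp only
        ring

lemma integrable_prod_comp_sub_mul {f W : ℝ → ℝ} (hf : Integrable f) (hW : Integrable W) :
    Integrable (fun p : ℝ × ℝ => W p.2 * f (p.2 - p.1)) (volume.prod volume) := by
  have := Integrable.convolution_integrand (ContinuousLinearMap.mul ℝ ℝ) hW hf.comp_neg
    (μ := volume)
  simpa using this

/-- Substituting `u ↦ x - u` before Fubini moves the smoothing from `H` onto `W`; this is how the
correlation of `f` and `W` enters. -/
lemma integral_convolution_mul' {f W H : ℝ → ℝ} (hf : Integrable f) (hW : Integrable W)
    (hH : Continuous H) {B : ℝ} (hB : ∀ x, |H x| ≤ B) :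
    ∫ x, (∫ u, f u * H (x - u)) * W x = ∫ y, H y * ∫ x, f (x - y) * W x := by
  have h := integral_integral_swap (f := fun y x => W x * f (x - y) * H y)
    (integrable_mul_of_bounded (integrable_prod_comp_sub_mul hf hW)
      (by fun_prop : Continuous fun p : ℝ × ℝ => H p.1).aestronglyMeasurable (fun p => hB _))
  calc ∫ x, (∫ u, f u * H (x - u)) * W x = ∫ x, ∫ y, W x * f (x - y) * H y := by
        refine integral_congr_ae (Eventually.of_forall fun x => ?_)
        simp only
        rw [mul_comm, ← integral_const_mul,
          ← integral_sub_left_eq_self (fun u => W x * (f u * H (x - u))) volume x]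
        simp only [sub_sub_cancel, mul_assoc]
    _ = ∫ y, ∫ x, W x * f (x - y) * H y := h.symm
    _ = _ := by
        refine integral_congr_ae (Eventually.of_forall fun u => ?_)
        simp only
        rw [← integral_const_mul]
        refine integral_congr_ae (Eventually.of_forall fun x => ?_)
        simp only
        ring

/-! ### Functions with many small values, and correlations vanishing on a lattice. -/

/-- Mean value estimate: a function with a family of derivatives that is small at `2 ^ n`
separated nodes is controlled by its derivative of order `n + 1`. -/
lemma exists_abs_le_of_nodes (n : ℕ) : ∀ h : ℝ, 0 < h → ∀ ℓ : ℝ, 0 ≤ ℓ → ∃ C : ℝ, 0 ≤ C ∧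
    ∀ G : ℕ → ℝ → ℝ, (∀ i x, HasDerivAt (G i) (G (i + 1) x) x) → ∀ a : ℝ, ∀ node : ℕ → ℝ,
      (∀ i < 2 ^ n, node i ∈ Icc a (a + ℓ)) →
      (∀ i, i + 1 < 2 ^ n → node i + h ≤ node (i + 1)) → ∀ δ : ℝ,
      (∀ i < 2 ^ n, |G 0 (node i)| ≤ δ) → ∀ x ∈ Icc a (a + ℓ),
      |G 0 x| ≤ C * δ + ℓ ^ n * ∫ t in Icc a (a + ℓ), |G (n + 1) t| := by
  have key : ∀ G : ℕ → ℝ → ℝ, (∀ i x, HasDerivAt (G i) (G (i + 1) x) x) →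
      ∀ a ℓ : ℝ, 0 ≤ ℓ → ∀ x ∈ Icc a (a + ℓ), ∀ y ∈ Icc a (a + ℓ),
      |G 0 x| ≤ |G 0 y| + ∫ t in Icc a (a + ℓ), |G 1 t| := by
    intro G hG a ℓ hℓ x hx y hy
    have hc : Continuous (G 1) := continuous_iff_continuousAt.2 fun x => (hG 1 x).continuousAt
    have h1 : ∫ t in y..x, G 1 t = G 0 x - G 0 y :=
      intervalIntegral.integral_eq_sub_of_hasDerivAt (fun t _ => hG 0 t)
        (hc.intervalIntegrable _ _)
    have h2 : |∫ t in y..x, G 1 t| ≤ ∫ t in Icc a (a + ℓ), |G 1 t| := by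
      rw [← Real.norm_eq_abs]
      refine (intervalIntegral.norm_integral_le_integral_norm_uIoc).trans ?_
      refine setIntegral_mono_set (hc.abs.integrableOn_Icc)
        (Eventually.of_forall fun t => abs_nonneg _) ?_
      refine LE.le.eventuallyLE ?_
      intro t ht
      have := uIoc_subset_uIcc ht
      exact (uIcc_subset_Icc hy hx) this
    have : |G 0 x| ≤ |G 0 y| + |G 0 x - G 0 y| := by
      have := abs_add_le (G 0 y) (G 0 x - G 0 y); simpa using this
    rw [h1] at h2
    linarith
  induction n with
  | zero =>
    intro h hh ℓ hℓ
    refine ⟨1, zero_le_one, ?_⟩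
    intro G hG a node hn _ δ hδ x hx
    have := key G hG a ℓ hℓ x hx (node 0) (hn 0 (by norm_num))
    have h0 := hδ 0 (by norm_num)
    simp only [pow_zero, one_mul]
    linarith
  | succ n ih =>
    intro h hh ℓ hℓ
    obtain ⟨C, hC, ih⟩ := ih h hh ℓ hℓ
    refine ⟨1 + ℓ * (C * (2 / h)), by positivity, ?_⟩
    intro G hG a node hn hsep δ hδ x hx
    have hlt : ∀ i < 2 ^ n, 2 * i + 1 < 2 ^ (n + 1) := fun i hi => by rw [pow_succ]; omega
    -- The nodes are paired as `(2i, 2i + 1)`, and each pair yields a point where the slope, hence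
    -- the derivative, is at most `2δ / h`. Disjoint pairs keep the new points `h`-separated,
    -- because nodes `2i + 1` and `2i + 2` lie between consecutive ones; this is why `2 ^ n` nodes
    -- are used.
    have hmv : ∀ i, ∃ ξ, i < 2 ^ n → ξ ∈ Ioo (node (2 * i)) (node (2 * i + 1)) ∧
        |G 1 ξ| ≤ 2 / h * δ := by
      intro i
      by_cases hi : i < 2 ^ n
      swap
      · exact ⟨0, fun h => absurd h hi⟩
      have hl := hlt i hi
      have hs := hsep (2 * i) hl
      have hlt' : node (2 * i) < node (2 * i + 1) := by linarith
      obtain ⟨ξ, hξ, he⟩ := exists_hasDerivAt_eq_slope (G 0) (G 1) hlt'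
        (fun t _ => (hG 0 t).continuousAt.continuousWithinAt) (fun t _ => hG 0 t)
      refine ⟨ξ, fun _ => ⟨hξ, ?_⟩⟩
      rw [he, abs_div, abs_of_pos (by linarith : 0 < node (2 * i + 1) - node (2 * i)),
        div_le_iff₀ (by linarith)]
      have e1 := hδ (2 * i) (by omega)
      have e2 := hδ (2 * i + 1) hl
      have e3 : |G 0 (node (2 * i + 1)) - G 0 (node (2 * i))| ≤ 2 * δ := by
        refine (abs_sub _ _).trans ?_; linarith
      have hδ0 : 0 ≤ δ := (abs_nonneg _).trans e1
      calc |G 0 (node (2 * i + 1)) - G 0 (node (2 * i))| ≤ 2 / h * δ * h := by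
            rw [div_mul_eq_mul_div, div_mul_cancel₀ _ hh.ne']; exact e3
        _ ≤ _ := by
            apply mul_le_mul_of_nonneg_left (by linarith) (by positivity)
    choose ξ hξ using hmv
    have hin : ∀ i < 2 ^ n, ξ i ∈ Icc a (a + ℓ) := fun i hi =>
      ⟨(hn (2 * i) (by have := hlt i hi; omega)).1.trans (hξ i hi).1.1.le,
        (hξ i hi).1.2.le.trans (hn (2 * i + 1) (hlt i hi)).2⟩
    have hG1 : ∀ t ∈ Icc a (a + ℓ), |G 1 t| ≤ C * (2 / h * δ) +
        ℓ ^ n * ∫ t in Icc a (a + ℓ), |G (n + 1 + 1) t| := by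
      refine ih (fun i => G (i + 1)) (fun i x => hG (i + 1) x) a ξ hin ?_ _
        (fun i hi => (hξ i hi).2)
      intro i hi
      have h1 := (hξ i (by omega)).1.2
      have h2 := (hξ (i + 1) hi).1.1
      have h3 := hsep (2 * i + 1) (by have := hlt (i + 1) hi; omega)
      have : 2 * (i + 1) = 2 * i + 1 + 1 := by ring
      rw [this] at h2
      linarith
    have hk := key G hG a ℓ hℓ x hx (node 0) (hn 0 (by positivity))
    have h0 := hδ 0 (by positivity)
    have hint : ∫ t in Icc a (a + ℓ), |G 1 t| ≤ ℓ * (C * (2 / h * δ) +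
        ℓ ^ n * ∫ t in Icc a (a + ℓ), |G (n + 1 + 1) t|) := by
      have hc : Continuous (G 1) := continuous_iff_continuousAt.2 fun x => (hG 1 x).continuousAt
      calc ∫ t in Icc a (a + ℓ), |G 1 t| ≤ ∫ t in Icc a (a + ℓ), (C * (2 / h * δ) +
            ℓ ^ n * ∫ t in Icc a (a + ℓ), |G (n + 1 + 1) t|) :=
            setIntegral_mono_on hc.abs.integrableOn_Icc (by simp)
              measurableSet_Icc hG1
        _ = _ := by
            rw [setIntegral_const]
            simp [hℓ]
    calc |G 0 x| ≤ δ + ℓ * (C * (2 / h * δ) +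
        ℓ ^ n * ∫ t in Icc a (a + ℓ), |G (n + 1 + 1) t|) := by linarith
      _ = _ := by ring

lemma hasCompactSupport_iteratedDeriv {f : ℝ → ℝ} (hf : HasCompactSupport f) (i : ℕ) :
    HasCompactSupport (iteratedDeriv i f) := by
  induction i with
  | zero => simpa using hf
  | succ i ih => rw [iteratedDeriv_succ]; exact ih.deriv

lemma isDerivFamily_iteratedDeriv {f : ℝ → ℝ} (hf : ContDiff ℝ ∞ f) (hc : HasCompactSupport f) :
    IsDerivFamily (fun i => iteratedDeriv i f) where
  deriv i x := by
    have h := (hf.differentiable_iteratedDeriv i (by exact_mod_cast ENat.natCast_lt_top i)) x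
    simpa only [iteratedDeriv_succ] using h.hasDerivAt
  bdd i := (hasCompactSupport_iteratedDeriv hc i).exists_bound_of_continuous
    (hf.differentiable_iteratedDeriv i (by exact_mod_cast ENat.natCast_lt_top i)).continuous

/-- The correlation `y ↦ ∫ f(x - y) W(x) dx`. -/
def correlation (f W : ℝ → ℝ) (y : ℝ) : ℝ := ∫ x, f (x - y) * W x

lemma integrable_correlation {f W : ℝ → ℝ} (hf : Integrable f) (hW : Integrable W) :
    Integrable (correlation f W) := by
  have := (integrable_prod_comp_sub_mul hf hW).integral_prod_left
  refine this.congr (Eventually.of_forall fun y => ?_)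
  simp only [correlation, mul_comm]

lemma abs_correlation_le {f W : ℝ → ℝ} (hf : Integrable f) {B : ℝ} (hB : ∀ x, |W x| ≤ B) (y : ℝ) :
    |correlation f W y| ≤ (∫ x, |f x|) * B := by
  have := abs_integral_mul_le_of_bounded (hf.comp_sub_right y) hB
  rwa [integral_sub_right_eq_self (fun x => |f x|) y] at this

lemma integral_abs_correlation_le {f W : ℝ → ℝ} (hf : Integrable f) (hW : Integrable W) :
    ∫ y, |correlation f W y| ≤ (∫ x, |f x|) * ∫ x, |W x| := by
  have hi := integrable_prod_comp_sub_mul hf hW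
  calc ∫ y, |correlation f W y| ≤ ∫ y, ∫ x, |W x * f (x - y)| := by
        refine integral_mono (integrable_correlation hf hW).abs hi.abs.integral_prod_left
          (fun y => ?_)
        simp only [correlation]
        refine (abs_integral_le_integral_abs).trans (le_of_eq ?_)
        simp only [mul_comm]
    _ = ∫ x, ∫ y, |W x * f (x - y)| := integral_integral_swap hi.abs
    _ = ∫ x, |W x| * ∫ z, |f z| := by
        refine integral_congr_ae (Eventually.of_forall fun x => ?_)
        simp only [abs_mul]
        rw [integral_const_mul, integral_sub_left_eq_self (fun z => |f z|)]
    _ = _ := by rw [integral_mul_const, mul_comm]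

/-- As `f` is only integrable, it is replaced by a continuous compactly supported `g` close in `L¹`;
since `W` is bounded, the two correlations are then uniformly close. -/
lemma continuous_correlation {f W : ℝ → ℝ} (hf : Integrable f) (hW : Integrable W) {B : ℝ}
    (hB : ∀ x, |W x| ≤ B) : Continuous (correlation f W) := by
  refine continuous_of_uniform_approx_of_continuous fun s hs => ?_
  obtain ⟨ε, hε, hεs⟩ := Metric.mem_uniformity_dist.1 hs
  have hB0 : 0 ≤ B := (abs_nonneg _).trans (hB 0)
  obtain ⟨g, hgc, hgε, hg, hgi⟩ := hf.exists_hasCompactSupport_integral_sub_le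
    (show 0 < ε / (2 * (B + 1)) by positivity)
  obtain ⟨Bg, hBg⟩ := hgc.exists_bound_of_continuous hg
  refine ⟨correlation g W, ?_, fun y => hεs ?_⟩
  · unfold correlation
    refine continuous_of_dominated (bound := fun x => Bg * |W x|)
      (fun y => (by fun_prop : Continuous fun x => g (x - y)).aestronglyMeasurable.mul
        hW.aestronglyMeasurable) ?_ (hW.abs.const_mul _) ?_
    · refine fun y => Eventually.of_forall fun x => ?_
      rw [norm_mul]
      exact mul_le_mul_of_nonneg_right (hBg _) (norm_nonneg _)
    · exact Eventually.of_forall fun x => by fun_prop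
  · have h1 : correlation f W y - correlation g W y = correlation (fun x => f x - g x) W y := by
      unfold correlation
      rw [← integral_sub]
      · simp only [sub_mul]
      · exact integrable_mul_of_bounded (hf.comp_sub_right y) hW.aestronglyMeasurable hB
      · exact integrable_mul_of_bounded (hgi.comp_sub_right y) hW.aestronglyMeasurable hB
    rw [Real.dist_eq, h1]
    refine (abs_correlation_le (hf.sub hgi) hB y).trans_lt ?_
    calc (∫ x, |f x - g x|) * B ≤ ε / (2 * (B + 1)) * B :=
          mul_le_mul_of_nonneg_right hgε hB0
      _ < ε := by
          rw [div_mul_eq_mul_div, div_lt_iff₀ (by positivity)]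
          nlinarith

/-- The weak derivative of `f` passes to its correlation with `W`: for each `x` it is tested against
the translate `u ↦ η (y - x + u)`, and the result is integrated against `W x`. -/
lemma integral_correlation_mul_weakDeriv {f v W : ℝ → ℝ} {m : ℕ} (hf : Integrable f)
    (hv : Integrable v) (hw : IsWeakDeriv m f v) (hW : Integrable W) {η : ℝ → ℝ}
    (hη : ContDiff ℝ ∞ η) (hc : HasCompactSupport η) (y : ℝ) :
    ∫ x, correlation f W x * iteratedDeriv m η (y - x) =
      (-1) ^ m * ∫ x, correlation v W x * η (y - x) := by
  have hfam := isDerivFamily_iteratedDeriv hη hc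
  obtain ⟨B, hB⟩ := hfam.bdd m
  obtain ⟨B0, hB0⟩ := hfam.bdd 0
  simp only [iteratedDeriv_zero] at hB0
  have hcm : Continuous (iteratedDeriv m η) := hfam.continuous m
  have e1 := integral_convolution_mul' hf hW (H := fun x => iteratedDeriv m η (y - x))
    (by fun_prop) (fun x => hB _)
  have e2 := integral_convolution_mul' hv hW (H := fun x => η (y - x))
    (by have := hη.continuous; fun_prop) (fun x => hB0 _)
  simp only [correlation]
  calc ∫ x, (∫ x_1, f (x_1 - x) * W x_1) * iteratedDeriv m η (y - x)
      = ∫ x, (∫ u, f u * iteratedDeriv m η (y - (x - u))) * W x := by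
        rw [e1]; simp only [mul_comm]
    _ = ∫ x, ((-1) ^ m * ∫ u, v u * η (y - (x - u))) * W x := by
        refine integral_congr_ae (Eventually.of_forall fun x => ?_)
        simp only
        congr 1
        have h := hw.2.2 (fun u => η ((y - x) + u)) (by fun_prop)
          (by simpa only [Function.comp_def, Homeomorph.coe_addLeft] using
            hc.comp_homeomorph (Homeomorph.addLeft (y - x)))
        rw [iteratedDeriv_comp_const_add] at h
        simpa only [sub_add] using h
    _ = (-1) ^ m * ∫ x, (∫ u, v u * η (y - (x - u))) * W x := by
        rw [← integral_const_mul]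
        simp only [mul_assoc]
    _ = _ := by rw [e2]; simp only [mul_comm]

/-- By Tonelli: a mollifier of radius `ε` moves mass by at most `ε`, so only the `ε`-neighbourhood
of the interval contributes. -/
lemma setIntegral_convolution_abs_le {e ρ : ℝ → ℝ} (he : Integrable e) (hρ : Continuous ρ)
    (hρc : HasCompactSupport ρ) (hρ0 : ∀ x, 0 ≤ ρ x) (hρ1 : ∫ x, ρ x = 1) {ε : ℝ}
    (hsupp : ∀ x, ε ≤ |x| → ρ x = 0) (a b : ℝ) :
    ∫ y in Icc a b, |∫ x, e x * ρ (y - x)| ≤ ∫ x in Icc (a - ε) (b + ε), |e x| := by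
  have hρi : Integrable ρ := hρ.integrable_of_hasCompactSupport hρc
  have hi : Integrable (fun p : ℝ × ℝ => |e p.2| * ρ (p.1 - p.2)) (volume.prod volume) := by
    have := Integrable.convolution_integrand (ContinuousLinearMap.mul ℝ ℝ) he.abs hρi
      (μ := volume)
    simpa using this
  have hir : Integrable (fun p : ℝ × ℝ => |e p.2| * ρ (p.1 - p.2))
      ((volume.restrict (Icc a b)).prod volume) := by
    have h2 : (volume.restrict (Icc a b)).prod (volume : Measure ℝ) =
        (volume.prod volume).restrict (Icc a b ×ˢ univ) := by
      rw [← Measure.prod_restrict, Measure.restrict_univ]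
    rw [h2]
    exact hi.restrict
  have hmeas : Integrable (fun y => ∫ x, e x * ρ (y - x)) := by
    have := Integrable.convolution_integrand (ContinuousLinearMap.mul ℝ ℝ) he hρi (μ := volume)
    simpa using this.integral_prod_left
  calc ∫ y in Icc a b, |∫ x, e x * ρ (y - x)|
      ≤ ∫ y in Icc a b, ∫ x, |e x| * ρ (y - x) := by
        refine integral_mono hmeas.abs.restrict hir.integral_prod_left (fun y => ?_)
        refine abs_integral_le_integral_abs.trans (le_of_eq ?_)
        simp only [abs_mul, abs_of_nonneg (hρ0 _)]
    _ = ∫ x, ∫ y in Icc a b, |e x| * ρ (y - x) := integral_integral_swap hir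
    _ ≤ ∫ x, (Icc (a - ε) (b + ε)).indicator (fun x => |e x|) x := by
        refine integral_mono hir.integral_prod_right
          (he.abs.indicator measurableSet_Icc) (fun x => ?_)
        simp only
        rw [integral_const_mul]
        by_cases hx : x ∈ Icc (a - ε) (b + ε)
        · rw [indicator_of_mem hx]
          refine mul_le_of_le_one_right (abs_nonneg _) ?_
          rw [← hρ1, ← integral_sub_right_eq_self ρ x]
          exact setIntegral_le_integral (hρi.comp_sub_right x)
            (Eventually.of_forall fun y => hρ0 _)
        · rw [indicator_of_notMem hx, setIntegral_eq_zero_of_forall_eq_zero, mul_zero]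
          intro y hy
          apply hsupp
          rw [mem_Icc, not_and_or, not_le, not_le] at hx
          rcases hx with hx | hx
          · exact le_trans (by linarith [hy.1]) (le_abs_self _)
          · exact le_trans (by linarith [hy.2]) (neg_le_abs _)
    _ = _ := integral_indicator measurableSet_Icc

/-- A correlation with an `N + 1` times weakly differentiable function that vanishes on a lattice
of mesh `h` is controlled by the correlation with the weak derivative. -/
lemma abs_correlation_le_of_lattice {N : ℕ} {f v W : ℝ → ℝ} (hf : Integrable f)
    (hv : Integrable v) (hw : IsWeakDeriv (N + 1) f v) (hW : Integrable W) {B : ℝ}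
    (hB : ∀ x, |W x| ≤ B) {h : ℝ} (hh : 0 < h) (hz : ∀ i : ℤ, correlation f W (i * h) = 0)
    (y : ℝ) :
    |correlation f W y| ≤ (2 ^ N * h) ^ N *
      ∫ x in Icc (y - (2 ^ N + 1) * h) (y + (2 ^ N + 1) * h), |correlation v W x| := by
  set E := correlation f W
  set e := correlation v W
  have hEc : Continuous E := continuous_correlation hf hW hB
  have hEi : Integrable E := integrable_correlation hf hW
  have hei : Integrable e := integrable_correlation hv hW
  obtain ⟨C, hC, hnode⟩ := exists_abs_le_of_nodes N h hh (2 ^ N * h) (by positivity)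
  refine le_of_forall_pos_le_add fun η hη => ?_
  set a : ℝ := ⌊y / h⌋ * h with ha
  have hay : a ≤ y := by
    have := Int.floor_le (y / h)
    rwa [le_div_iff₀ hh] at this
  have hya : y < a + h := by
    have := Int.lt_floor_add_one (y / h)
    rw [div_lt_iff₀ hh] at this
    linarith
  have h2N : (1 : ℝ) ≤ 2 ^ N := one_le_pow₀ (by norm_num)
  have hh2 : h ≤ 2 ^ N * h := le_mul_of_one_le_left hh.le h2N
  -- `C` depends on `h` in an uncontrolled way, but it multiplies only the values at the nodes.
  -- These are pure mollification error and can be made arbitrarily small, so `C` does not survive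
  -- in the estimate.
  set δ := η / (C + 1)
  have hδ : 0 < δ := by positivity
  have huc : UniformContinuousOn E (Icc (a - h) (a + 2 ^ N * h + h)) :=
    isCompact_Icc.uniformContinuousOn_of_continuous hEc.continuousOn
  obtain ⟨ε₀, hε₀, hunif⟩ := Metric.uniformContinuousOn_iff_le.1 huc δ hδ
  set ε := min ε₀ h
  have hε : 0 < ε := lt_min hε₀ hh
  let b : ContDiffBump (0 : ℝ) := ⟨ε / 2, ε, by positivity, by linarith⟩
  set ρ := b.normed volume
  have hρ : ContDiff ℝ ∞ ρ := b.contDiff_normed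
  have hρc : HasCompactSupport ρ := b.hasCompactSupport_normed
  have hρ0 : ∀ x, 0 ≤ ρ x := b.nonneg_normed
  have hρ1 : ∫ x, ρ x = 1 := b.integral_normed
  have hsupp : ∀ x, ε ≤ |x| → ρ x = 0 := by
    intro x hx
    by_contra hne
    have : x ∈ Function.support ρ := hne
    rw [b.support_normed_eq, mem_ball_zero_iff] at this
    exact absurd this (not_lt.2 hx)
  have hρi : Integrable ρ := hρ.continuous.integrable_of_hasCompactSupport hρc
  have hfam := isDerivFamily_iteratedDeriv hρ hρc
  -- The correlation has only a weak derivative, while the node estimate needs classical ones; in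
  -- the mollified version all derivatives fall on `ρ`.
  let G : ℕ → ℝ → ℝ := fun i y => ∫ x, E x * iteratedDeriv i ρ (y + (-1) * x)
  have hG : ∀ i x, HasDerivAt (G i) (G (i + 1) x) x := by
    intro i x
    obtain ⟨B1, hB1⟩ := hfam.bdd i
    obtain ⟨B2, hB2⟩ := hfam.bdd (i + 1)
    exact hasDerivAt_integral_mul_comp_add hEi (-1) (hfam.deriv i) (hfam.continuous (i + 1))
      hB1 hB2 x
  have hneg : ∀ y x : ℝ, y + (-1) * x = y - x := fun y x => by ring
  have hclose : ∀ x ∈ Icc a (a + 2 ^ N * h), |G 0 x - E x| ≤ δ := by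
    intro x hx
    have h1 : G 0 x - E x = ∫ t, ρ (x - t) * (E t - E x) := by
      have hρx : Integrable fun t => ρ (x - t) := hρi.comp_sub_left x
      obtain ⟨B0, hB0⟩ := hfam.bdd 0
      have h2 : Integrable fun t => ρ (x - t) * E t := by
        have := integrable_mul_of_bounded hEi (g := fun t => ρ (x - t))
          (by have := hρ.continuous; fun_prop : Continuous fun t => ρ (x - t)).aestronglyMeasurable
          (fun t => by simpa using hB0 (x - t))
        simpa only [mul_comm] using this
      simp only [mul_sub]
      rw [integral_sub h2 (hρx.mul_const _), integral_mul_const,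
        integral_sub_left_eq_self ρ, hρ1, one_mul]
      simp only [G, hneg, iteratedDeriv_zero]
      simp only [mul_comm]
    rw [h1]
    calc |∫ t, ρ (x - t) * (E t - E x)| ≤ ∫ t, ρ (x - t) * δ := by
          rw [← Real.norm_eq_abs]
          refine norm_integral_le_of_norm_le ((hρi.comp_sub_left x).mul_const δ)
            (Eventually.of_forall fun t => ?_)
          rw [norm_mul, Real.norm_of_nonneg (hρ0 _)]
          by_cases ht : ε ≤ |x - t|
          · rw [hsupp _ ht]; simp
          · push Not at ht
            refine mul_le_mul_of_nonneg_left ?_ (hρ0 _)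
            have h3 := abs_lt.1 ht
            have hεh : ε ≤ h := min_le_right _ _
            rw [← dist_eq_norm]
            refine hunif t ⟨by linarith [hx.1], by linarith [hx.2]⟩ x
              ⟨by linarith [hx.1], by linarith [hx.2]⟩ ?_
            rw [dist_comm, Real.dist_eq]
            exact ht.le.trans (min_le_left _ _)
      _ = δ := by
          rw [integral_mul_const, integral_sub_left_eq_self ρ, hρ1, one_mul]
  have hyI : y ∈ Icc a (a + 2 ^ N * h) := ⟨hay, by linarith⟩
  have hnodeI : ∀ i < 2 ^ N, a + (i : ℕ) * h ∈ Icc a (a + 2 ^ N * h) := by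
    intro i hi
    have : (i : ℝ) ≤ 2 ^ N := by exact_mod_cast hi.le
    exact ⟨by nlinarith [(Nat.cast_nonneg i : (0 : ℝ) ≤ i)], by nlinarith⟩
  have hmain := hnode G hG a (fun i => a + i * h) hnodeI
    (fun i _ => by push_cast; linarith) δ (fun i hi => by
      have h1 := hclose _ (hnodeI i hi)
      have h2 : E (a + i * h) = 0 := by
        have := hz (⌊y / h⌋ + i)
        rw [← this]; push_cast; congr 1; rw [ha]; ring
      rwa [h2, sub_zero] at h1) y hyI
  have hder : ∫ t in Icc a (a + 2 ^ N * h), |G (N + 1) t| ≤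
      ∫ x in Icc (y - (2 ^ N + 1) * h) (y + (2 ^ N + 1) * h), |e x| := by
    have h1 : ∀ t, |G (N + 1) t| = |∫ x, e x * ρ (t - x)| := by
      intro t
      have := integral_correlation_mul_weakDeriv hf hv hw hW hρ hρc t
      simp only [G, hneg]
      rw [this, abs_mul]
      simp [e]
    simp only [h1]
    refine (setIntegral_convolution_abs_le hei hρ.continuous hρc hρ0 hρ1 hsupp _ _).trans ?_
    refine setIntegral_mono_set hei.abs.integrableOn
      (Eventually.of_forall fun t => abs_nonneg _) (LE.le.eventuallyLE ?_)
    -- Since `a ≤ y < a + h`, the interval `[a, a + 2 ^ N * h]` enlarged by `ε ≤ h` stays within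
    -- distance `(2 ^ N + 1) * h` of `y`.
    have hεh : ε ≤ h := min_le_right _ _
    exact Icc_subset_Icc (by nlinarith) (by nlinarith)
  have hfin : |E y| ≤ |G 0 y| + δ := by
    have h1 := hclose y hyI
    have h2 := abs_sub_abs_le_abs_sub (E y) (G 0 y)
    rw [abs_sub_comm] at h2
    linarith
  have hsum : C * δ + δ = η := by
    have : (C + 1) * δ = η := mul_div_cancel₀ η (by positivity)
    linarith
  have hmul := mul_le_mul_of_nonneg_left hder (show 0 ≤ (2 ^ N * h) ^ N by positivity)
  linarith

/-! ### Dilations, the spaces `V_j`, and size bounds for the wavelets. -/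

lemma aestronglyMeasurable_comp_mul_sub {f : ℝ → ℝ} (hf : AEStronglyMeasurable f volume) {a : ℝ}
    (ha : a ≠ 0) (b : ℝ) : AEStronglyMeasurable (fun x => f (a * x - b)) volume := by
  have h1 : Measure.QuasiMeasurePreserving (fun x : ℝ => a * x) volume volume := by
    refine ⟨by fun_prop, ?_⟩
    rw [Real.map_volume_mul_left ha]
    exact Measure.smul_absolutelyContinuous
  have h2 := (measurePreserving_sub_right (volume : Measure ℝ) b).quasiMeasurePreserving.comp h1
  exact hf.comp_quasiMeasurePreserving h2

lemma integral_comp_mul_sub (f : ℝ → ℝ) {a : ℝ} (ha : 0 < a) (b : ℝ) :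
    ∫ x, f (a * x - b) = a⁻¹ * ∫ x, f x := by
  rw [Measure.integral_comp_mul_left (fun x => f (x - b)) a, integral_sub_right_eq_self,
    abs_of_pos (inv_pos.2 ha), smul_eq_mul]

lemma integrable_comp_mul_sub {f : ℝ → ℝ} (hf : Integrable f) {a : ℝ} (ha : a ≠ 0) (b : ℝ) :
    Integrable fun x => f (a * x - b) :=
  (hf.comp_sub_right b).comp_mul_left' ha

lemma dilate_zero (g : ℝ → ℝ) (k : ℤ) (x : ℝ) : dilate g 0 k x = g (x - k) := by
  simp [dilate]

lemma two_rpow_half_mul_self (j : ℤ) :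
    (2 : ℝ) ^ ((j : ℝ) / 2) * (2 : ℝ) ^ ((j : ℝ) / 2) = (2 : ℝ) ^ j := by
  rw [← Real.rpow_add two_pos, add_halves, Real.rpow_intCast]

lemma aestronglyMeasurable_dilate {g : ℝ → ℝ} (hg : AEStronglyMeasurable g volume) (j k : ℤ) :
    AEStronglyMeasurable (dilate g j k) volume :=
  (aestronglyMeasurable_comp_mul_sub hg (by positivity) _).const_mul _

lemma memLp_dilate {g : ℝ → ℝ} (hg : MemLp g 2 volume) (j k : ℤ) :
    MemLp (dilate g j k) 2 volume := by
  rw [memLp_two_iff_integrable_sq (aestronglyMeasurable_dilate hg.1 j k)]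
  have h := (memLp_two_iff_integrable_sq hg.1).1 hg
  have := (integrable_comp_mul_sub h (a := (2 : ℝ) ^ j) (by positivity) k).const_mul
    (((2 : ℝ) ^ ((j : ℝ) / 2)) ^ 2)
  simpa only [dilate, mul_pow] using this

lemma integral_dilate_mul_dilate (f g : ℝ → ℝ) (i j k l : ℤ) :
    ∫ x, dilate f (i + j) k x * dilate g j l x = ∫ x, dilate f i k x * dilate g 0 l x := by
  have h := integral_comp_mul_sub (fun y => dilate f i k y * dilate g 0 l y)
    (a := (2 : ℝ) ^ j) (by positivity) 0
  simp only [sub_zero] at h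
  have h2 : ∀ x, dilate f (i + j) k x * dilate g j l x =
      (2 : ℝ) ^ j * (dilate f i k ((2 : ℝ) ^ j * x) * dilate g 0 l ((2 : ℝ) ^ j * x)) := by
    intro x
    rw [← two_rpow_half_mul_self j]
    simp only [dilate]
    rw [zpow_add₀ two_ne_zero, ← two_rpow_half_mul_self j]
    push_cast
    rw [add_div, Real.rpow_add two_pos]
    simp only [zero_div, Real.rpow_zero, zpow_zero, one_mul]
    ring_nf
  simp only [h2]
  rw [integral_const_mul, h, mul_inv_cancel_left₀ (by positivity)]

lemma inner_toLp_eq_integral {f g : ℝ → ℝ} (hf : MemLp f 2 volume) (hg : MemLp g 2 volume) :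
    inner ℝ (hf.toLp f) (hg.toLp g) = ∫ x, f x * g x := by
  rw [L2.inner_def]
  refine integral_congr_ae ?_
  filter_upwards [hf.coeFn_toLp, hg.coeFn_toLp] with x h1 h2
  rw [h1, h2]
  simp [mul_comm]

lemma toLp_dilate_mem_scaleSpace {g : ℝ → ℝ} (hg : MemLp g 2 volume) (j k : ℤ) :
    (memLp_dilate hg j k).toLp _ ∈ scaleSpace g j :=
  Submodule.le_topologicalClosure _ (Submodule.subset_span ⟨k, MemLp.coeFn_toLp _⟩)

lemma scaleSpace_le_of_le {φ : ℝ → ℝ} (hφ : ∀ j : ℤ, scaleSpace φ j ≤ scaleSpace φ (j + 1))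
    {i j : ℤ} (hij : i ≤ j) : scaleSpace φ i ≤ scaleSpace φ j :=
  monotone_int_of_le_succ hφ hij

/-- The wavelets at level `D` annihilate the lattice translates of `φ`. -/
lemma correlation_eq_zero_of_lattice {N : ℕ} {φ ψ : ℝ → ℝ} (hφ : IsFatherWavelet N φ)
    (hψ : IsMotherWavelet N φ ψ) (hφi : Integrable φ) {B : ℝ} (hψB : ∀ x, |ψ x| ≤ B) (D : ℕ)
    (F : Finset ℤ) (σ : ℤ → ℝ) (i : ℤ) :
    correlation φ (fun x => ∑ k ∈ F, σ k * ψ (2 ^ D * x - k)) (i * (2 ^ D)⁻¹) = 0 := by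
  have hφ2 := hφ.mra.1.1
  have hψ2 := hψ.orthonormal.1
  -- Everything is rescaled to level `0`: there `φ` has become `φ_{-D,0} ∈ V_{-D} ⊆ V_0`, which is
  -- orthogonal to the translates of `ψ`. The lattice shift `i` is absorbed into the translation
  -- index as `k - i`.
  have horth : ∀ k : ℤ, ∫ x, dilate φ (-D) 0 x * dilate ψ 0 k x = 0 := by
    intro k
    rw [← inner_toLp_eq_integral (memLp_dilate hφ2 _ _) (memLp_dilate hψ2 _ _)]
    have h1 := scaleSpace_le_of_le hφ.mra.2.1 (show (-D : ℤ) ≤ 0 by simp)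
      (toLp_dilate_mem_scaleSpace hφ2 (-D) 0)
    have h2 := toLp_dilate_mem_scaleSpace hψ2 0 k
    rw [hψ.span_eq] at h2
    exact (Submodule.mem_orthogonal _ _).1 h2.2 _ h1
  have hD : (0 : ℝ) < 2 ^ D := by positivity
  have hterm : ∀ k : ℤ, ∫ x, φ (x - i * (2 ^ D)⁻¹) * ψ (2 ^ D * x - k) = 0 := by
    intro k
    have h := integral_comp_mul_sub (fun y => φ ((2 ^ D)⁻¹ * y) * ψ (y - (k - i : ℤ)))
      hD i
    have h3 : ∀ x, dilate φ (-D) 0 x * dilate ψ 0 (k - i) x =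
        (2 : ℝ) ^ (((-D : ℤ) : ℝ) / 2) * (φ ((2 ^ D)⁻¹ * x) * ψ (x - (k - i : ℤ))) := by
      intro x
      rw [dilate_zero, dilate]
      simp only [zpow_neg, zpow_natCast, Int.cast_zero, sub_zero, mul_assoc]
    have h4 := horth (k - i)
    simp only [h3] at h4
    rw [integral_const_mul] at h4
    have h5 := (mul_eq_zero.1 h4).resolve_left (by positivity)
    rw [h5, mul_zero] at h
    rw [← h]
    refine integral_congr_ae (Eventually.of_forall fun x => ?_)
    simp only
    congr 2
    · field_simp
    · push_cast; ring
  unfold correlation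
  simp only [Finset.mul_sum]
  rw [integral_finsetSum]
  · refine Finset.sum_eq_zero fun k _ => ?_
    simp only [mul_left_comm]
    rw [integral_const_mul, hterm, mul_zero]
  · intro k _
    simp only [mul_left_comm]
    exact (integrable_mul_of_bounded (hφi.comp_sub_right _)
      (aestronglyMeasurable_comp_mul_sub hψ2.1 hD.ne' _) (fun x => hψB _)).const_mul _

/-- The line is cut into unit intervals, all moved to `(0, 1]`; by Tonelli the `L¹` norm is the
integral there of the sum over translates, which is bounded. -/
lemma integrable_of_tsum_translates_le {v : ℝ → ℝ} (hv : LocallyIntegrable v volume) {B : ℝ}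
    (hB : ∀ᵐ x ∂(volume : Measure ℝ), ∑' k : ℤ, ‖v (x - k)‖ₑ ≤ ENNReal.ofReal B) :
    Integrable v := by
  refine ⟨hv.aestronglyMeasurable, ?_⟩
  have hm : AEMeasurable (fun x => ‖v x‖ₑ) volume := hv.aestronglyMeasurable.enorm
  have h1 : ∫⁻ x, ‖v x‖ₑ = ∑' n : ℤ, ∫⁻ x in Ioc (n : ℝ) (n + 1), ‖v x‖ₑ := by
    rw [← lintegral_iUnion (fun n => measurableSet_Ioc) (pairwise_disjoint_Ioc_intCast ℝ),
      iUnion_Ioc_intCast, setLIntegral_univ]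
  have h2 : ∀ n : ℤ, ∫⁻ x in Ioc (n : ℝ) (n + 1), ‖v x‖ₑ =
      ∫⁻ x in Ioc (0 : ℝ) 1, ‖v (x + n)‖ₑ := by
    intro n
    rw [← lintegral_indicator measurableSet_Ioc, ← lintegral_indicator measurableSet_Ioc,
      ← lintegral_add_right_eq_self _ (n : ℝ)]
    refine lintegral_congr fun x => ?_
    simp only [indicator, mem_Ioc]
    congr 1
    simp [add_comm (n : ℝ) 1]
  rw [hasFiniteIntegral_iff_enorm, h1]
  simp only [h2]
  rw [← lintegral_tsum]
  · refine lt_of_le_of_lt (lintegral_mono_ae (g := fun _ => ENNReal.ofReal B) ?_) ?_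
    · refine ae_restrict_of_ae ?_
      filter_upwards [hB] with x hx
      rw [← (Equiv.neg ℤ).tsum_eq]
      simpa [sub_eq_add_neg] using hx
    · simp
  · intro n
    exact (hm.comp_quasiMeasurePreserving
      (measurePreserving_add_right volume (n : ℝ)).quasiMeasurePreserving).restrict

lemma HasRadialMajorant.integrable {N : ℕ} {g : ℝ → ℝ} (hg : HasRadialMajorant N g)
    (hm : AEStronglyMeasurable g volume) : Integrable g := by
  obtain ⟨Φ, -, -, hb, hi, -⟩ := hg
  exact hi.mono' hm (Eventually.of_forall hb)

/-- Monotonicity bounds `∑ Φ(i)` over the natural numbers by `Φ 0 + ∫ Φ`. On each side of `x` the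
distances `|x - k|` dominate distinct natural numbers: `⌊x⌋ - k` on the left and `k - ⌊x⌋ - 1` on
the right, the `- 1` compensating for the floor. The two sides account for the factor `2`. -/
lemma HasRadialMajorant.exists_bound {N : ℕ} {g : ℝ → ℝ} (hg : HasRadialMajorant N g) :
    ∃ C : ℝ, 0 ≤ C ∧ (∀ x, |g x| ≤ C) ∧ ∀ (x : ℝ) (F : Finset ℤ), ∑ k ∈ F, |g (x - k)| ≤ C := by
  obtain ⟨Φ, -, hanti, hb, hi, -⟩ := hg
  have hΦ0 : ∀ u, 0 ≤ u → 0 ≤ Φ u := fun u hu => by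
    have := (abs_nonneg _).trans (hb u); rwa [abs_of_nonneg hu] at this
  have hle : ∀ u (w : ℝ), 0 ≤ w → w ≤ |u| → |g u| ≤ Φ w := fun u w hw hwu =>
    (hb u).trans (hanti hw (mem_Ici.2 (abs_nonneg u)) hwu)
  set I := ∫ u, Φ |u|
  have hI0 : 0 ≤ I := integral_nonneg fun u => hΦ0 _ (abs_nonneg u)
  have hrange : ∀ n : ℕ, ∑ i ∈ Finset.range n, Φ i ≤ Φ 0 + I := by
    intro n
    have h1 : ∑ i ∈ Finset.range n, Φ (0 + (i + 1 : ℕ)) ≤ ∫ x in (0 : ℝ)..0 + n, Φ x :=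
      AntitoneOn.sum_le_integral (hanti.mono fun x hx => hx.1)
    have h2 : ∫ x in (0 : ℝ)..0 + n, Φ x ≤ I := by
      rw [intervalIntegral.integral_of_le (by simp)]
      calc ∫ x in Ioc (0 : ℝ) (0 + n), Φ x = ∫ x in Ioc (0 : ℝ) (0 + n), Φ |x| :=
            setIntegral_congr_fun measurableSet_Ioc fun x hx => by
              simp only [abs_of_pos hx.1]
        _ ≤ I := setIntegral_le_integral hi (Eventually.of_forall fun u => hΦ0 _ (abs_nonneg u))
    have h3 : ∑ i ∈ Finset.range n, Φ i ≤ ∑ i ∈ Finset.range (n + 1), Φ i :=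
      Finset.sum_le_sum_of_subset_of_nonneg (Finset.range_mono (Nat.le_succ n))
        fun i _ _ => hΦ0 _ (Nat.cast_nonneg i)
    rw [Finset.sum_range_succ'] at h3
    simp only [zero_add] at h1
    simp only [Nat.cast_zero] at h3
    simp only [zero_add] at h2
    linarith
  have hset : ∀ (F : Finset ℤ) (m : ℤ → ℕ), Set.InjOn m F →
      ∑ k ∈ F, Φ (m k) ≤ Φ 0 + I := by
    intro F m hm
    rw [← Finset.sum_image (f := fun i : ℕ => Φ i) hm]
    obtain ⟨n, hn⟩ := (F.image m).exists_nat_subset_range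
    exact (Finset.sum_le_sum_of_subset_of_nonneg hn
      fun i _ _ => hΦ0 _ (Nat.cast_nonneg i)).trans (hrange n)
  refine ⟨2 * (Φ 0 + I), by have := hΦ0 0 le_rfl; positivity, fun x => ?_, fun x F => ?_⟩
  · have h := hle x 0 le_rfl (abs_nonneg x)
    have := hΦ0 0 le_rfl
    linarith
  · rw [← Finset.sum_filter_add_sum_filter_not F (fun k => k ≤ ⌊x⌋), two_mul]
    have hf1 := Int.floor_le x
    have hf2 := Int.lt_floor_add_one x
    refine add_le_add ?_ ?_
    · refine le_trans (Finset.sum_le_sum fun k hk => ?_)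
        (hset (F.filter (fun k => k ≤ ⌊x⌋)) (fun k => (⌊x⌋ - k).toNat) ?_)
      · refine hle _ _ (Nat.cast_nonneg _) ?_
        have hk' := (Finset.mem_filter.1 hk).2
        have h1 : (((⌊x⌋ - k).toNat : ℕ) : ℝ) = ((⌊x⌋ - k : ℤ) : ℝ) := by
          exact_mod_cast congrArg (Int.cast (R := ℝ)) (Int.toNat_of_nonneg (sub_nonneg.2 hk'))
        rw [h1]
        push_cast
        exact le_trans (by linarith) (le_abs_self _)
      · intro a ha b hb hab
        have h1 := (Finset.mem_filter.1 ha).2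
        have h2 := (Finset.mem_filter.1 hb).2
        simp only at hab
        omega
    · refine le_trans (Finset.sum_le_sum fun k hk => ?_)
        (hset (F.filter (fun k => ¬ k ≤ ⌊x⌋)) (fun k => (k - ⌊x⌋ - 1).toNat) ?_)
      · refine hle _ _ (Nat.cast_nonneg _) ?_
        have hk' := (Finset.mem_filter.1 hk).2
        have h1 : (((k - ⌊x⌋ - 1).toNat : ℕ) : ℝ) = ((k - ⌊x⌋ - 1 : ℤ) : ℝ) := by
          exact_mod_cast congrArg (Int.cast (R := ℝ)) (Int.toNat_of_nonneg (by omega))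
        rw [h1]
        push_cast
        exact le_trans (by linarith) (neg_le_abs _)
      · intro a ha b hb hab
        have h1 := (Finset.mem_filter.1 ha).2
        have h2 := (Finset.mem_filter.1 hb).2
        simp only at hab
        omega

/-! ### The integral of the father wavelet is not zero. -/

/-- If the integral of `φ` vanishes, its coefficients against a Lipschitz function are small. -/
lemma abs_integral_mul_comp_le {φ f : ℝ → ℝ} (hφ : Integrable φ) (h0 : ∫ x, φ x = 0)
    (hf : Continuous f) (hlip : ∀ x y, |f x - f y| ≤ |x - y|) (hb : ∀ x, |f x| ≤ 1) {δ : ℝ}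
    (hδ : 0 ≤ δ) (b : ℝ) :
    |∫ u, φ u * f (δ * (u + b))| ≤ ∫ u, |φ u| * min (δ * |u|) 2 := by
  have h1 : ∫ u, φ u * f (δ * (u + b)) = ∫ u, φ u * (f (δ * (u + b)) - f (δ * b)) := by
    simp only [mul_sub]
    rw [integral_sub, integral_mul_const, h0, zero_mul, sub_zero]
    · exact integrable_mul_of_bounded hφ
        (by fun_prop : Continuous fun u => f (δ * (u + b))).aestronglyMeasurable (fun _ => hb _)
    · exact hφ.mul_const _
  rw [h1, ← Real.norm_eq_abs]
  refine norm_integral_le_of_norm_le ?_ (Eventually.of_forall fun u => ?_)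
  · refine integrable_mul_of_bounded hφ.abs
      (by fun_prop : Continuous fun u : ℝ => min (δ * |u|) 2).aestronglyMeasurable (B := 2) ?_
    intro u
    rw [abs_of_nonneg (by positivity)]
    exact min_le_right _ _
  · rw [norm_mul]
    refine mul_le_mul_of_nonneg_left (le_min ?_ ?_) (norm_nonneg _)
    · refine (hlip _ _).trans (le_of_eq ?_)
      rw [← mul_sub, add_sub_cancel_right, abs_mul, abs_of_nonneg hδ]
    · have h2 := abs_sub (f (δ * (u + b))) (f (δ * b))
      have h3 := hb (δ * (u + b))
      have h4 := hb (δ * b)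
      rw [Real.norm_eq_abs]
      linarith

lemma tendsto_integral_abs_mul_min {φ : ℝ → ℝ} (hφ : Integrable φ) :
    Tendsto (fun j : ℕ => ∫ u, |φ u| * min ((2 ^ j)⁻¹ * |u|) 2) atTop (𝓝 0) := by
  have h := tendsto_integral_of_dominated_convergence (μ := (volume : Measure ℝ))
    (F := fun (j : ℕ) u => |φ u| * min ((2 ^ j)⁻¹ * |u|) 2) (f := fun _ => 0)
    (fun u => |φ u| * 2) (fun j => hφ.abs.aestronglyMeasurable.mul
      (by fun_prop : Continuous fun u : ℝ => min ((2 ^ j)⁻¹ * |u|) 2).aestronglyMeasurable)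
    (hφ.abs.mul_const 2) (fun j => Eventually.of_forall fun u => ?_)
    (Eventually.of_forall fun u => ?_)
  · simpa using h
  · rw [norm_mul, Real.norm_of_nonneg (by positivity : 0 ≤ min ((2 ^ j)⁻¹ * |u|) 2)]
    simp only [Real.norm_eq_abs, abs_abs]
    exact mul_le_mul_of_nonneg_left (min_le_right _ _) (abs_nonneg _)
  · have h1 : Tendsto (fun j : ℕ => ((2 : ℝ) ^ j)⁻¹) atTop (𝓝 0) :=
      tendsto_inv_atTop_zero.comp (tendsto_pow_atTop_atTop_of_one_lt (by norm_num))
    have h2 : Tendsto (fun j : ℕ => |φ u| * min (((2 : ℝ) ^ j)⁻¹ * |u|) 2) atTop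
        (𝓝 (|φ u| * min (0 * |u|) 2)) := ((h1.mul_const |u|).min tendsto_const_nhds).const_mul _
    simpa using h2

lemma sum_abs_integral_mul_le {g f : ℝ → ℝ} (hf : Integrable f)
    (hg : AEStronglyMeasurable g volume) {C : ℝ} (hC : ∀ x, |g x| ≤ C)
    (hsum : ∀ (x : ℝ) (F : Finset ℤ), ∑ k ∈ F, |g (x - k)| ≤ C) {a : ℝ} (ha : a ≠ 0)
    (F : Finset ℤ) :
    ∑ k ∈ F, |∫ x, f x * g (a * x - k)| ≤ C * ∫ x, |f x| := by
  have hi : ∀ k ∈ F, Integrable (fun x => |f x * g (a * x - k)|) := fun k _ =>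
    (integrable_mul_of_bounded hf (aestronglyMeasurable_comp_mul_sub hg ha _)
      (fun _ => hC _)).abs
  calc ∑ k ∈ F, |∫ x, f x * g (a * x - k)| ≤ ∑ k ∈ F, ∫ x, |f x * g (a * x - k)| :=
        Finset.sum_le_sum fun k _ => abs_integral_le_integral_abs
    _ = ∫ x, ∑ k ∈ F, |f x * g (a * x - k)| := (integral_finsetSum _ hi).symm
    _ ≤ ∫ x, C * |f x| := by
        refine integral_mono (integrable_finsetSum _ hi) (hf.abs.const_mul _) fun x => ?_
        simp only [abs_mul]
        rw [← Finset.mul_sum, mul_comm]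
        exact mul_le_mul_of_nonneg_right (hsum _ F) (abs_nonneg _)
    _ = _ := integral_const_mul _ _

lemma orthonormal_dilate {g : ℝ → ℝ} (hg : OrthonormalTranslates g) (j : ℤ) :
    Orthonormal ℝ fun k : ℤ => (memLp_dilate hg.1 j k).toLp (dilate g j k) := by
  rw [orthonormal_iff_ite]
  intro k l
  rw [inner_toLp_eq_integral]
  have := integral_dilate_mul_dilate g g 0 j k l
  rw [zero_add] at this
  rw [this, hg.2]

/-- Best approximation by an orthonormal system. -/
lemma norm_sq_sub_sum_inner_sq_le {E ι : Type*} [NormedAddCommGroup E] [InnerProductSpace ℝ E]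
    {e : ι → E} (he : Orthonormal ℝ e) (f : E) (a : ι → ℝ) (F : Finset ι) :
    ‖f‖ ^ 2 - ∑ k ∈ F, inner ℝ f (e k) ^ 2 ≤ ‖f - ∑ k ∈ F, a k • e k‖ ^ 2 := by
  rw [norm_sub_sq_real, ← real_inner_self_eq_norm_sq (∑ k ∈ F, a k • e k), he.inner_sum, inner_sum]
  simp only [inner_smul_right, conj_trivial]
  have : 0 ≤ ∑ k ∈ F, (a k - inner ℝ f (e k)) ^ 2 := Finset.sum_nonneg fun k _ => sq_nonneg _
  have h2 : ∑ k ∈ F, (a k - inner ℝ f (e k)) ^ 2 = ∑ k ∈ F, a k * a k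
      - 2 * ∑ k ∈ F, a k * inner ℝ f (e k) + ∑ k ∈ F, inner ℝ f (e k) ^ 2 := by
    rw [Finset.mul_sum, ← Finset.sum_sub_distrib, ← Finset.sum_add_distrib]
    exact Finset.sum_congr rfl fun k _ => by ring
  linarith

/-- The integral of a father wavelet does not vanish. -/
lemma IsFatherWavelet.integral_ne_zero {N : ℕ} {φ : ℝ → ℝ} (hφ : IsFatherWavelet N φ) :
    ∫ x, φ x ≠ 0 := by
  intro h0
  obtain ⟨⟨hφ2, horth⟩, hmono, hdense⟩ := hφ.mra
  have hφi := hφ.decay.integrable hφ2.1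
  obtain ⟨C, hC0, hC, hCs⟩ := hφ.decay.exists_bound
  -- A Lipschitz hat function serves as the witness: if `∫ φ = 0`, its energy in `V_j` tends to
  -- zero, although density and nestedness force it to stay above three quarters of the total.
  set f : ℝ → ℝ := fun x => max 0 (1 - |x|) with hfdef
  have hfc : Continuous f := by fun_prop
  have hfl : ∀ x y, |f x - f y| ≤ |x - y| := by
    intro x y
    have h1 := abs_max_sub_max_le_abs (1 - |x|) (1 - |y|) 0
    rw [max_comm _ (0 : ℝ), max_comm _ (0 : ℝ)] at h1
    refine h1.trans ?_
    rw [show 1 - |x| - (1 - |y|) = |y| - |x| by ring, abs_sub_comm x y]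
    exact abs_abs_sub_abs_le _ _
  have hfb : ∀ x, |f x| ≤ 1 := by
    intro x
    rw [abs_of_nonneg (le_max_left _ _)]
    exact max_le zero_le_one (by have := abs_nonneg x; linarith)
  have hfcs : HasCompactSupport f := by
    refine HasCompactSupport.intro (K := Icc (-1) 1) isCompact_Icc fun x hx => ?_
    refine max_eq_left ?_
    by_contra! h
    exact hx (abs_le.1 (by linarith))
  have hfi : Integrable f := hfc.integrable_of_hasCompactSupport hfcs
  have hf2 : MemLp f 2 volume := hfc.memLp_of_hasCompactSupport hfcs
  set f₂ := hf2.toLp f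
  have hpos : 0 < ‖f₂‖ ^ 2 := by
    rw [← real_inner_self_eq_norm_sq, inner_toLp_eq_integral]
    have hcc : Continuous fun x => f x * f x := by fun_prop
    refine hcc.integral_pos_of_hasCompactSupport_nonneg_nonzero hfcs.mul_left
      (fun x => mul_self_nonneg _) (x := 0) ?_
    simp [hfdef]
  obtain ⟨v, hv, hvd⟩ := hdense.exists_dist_lt f₂
    (half_pos (lt_of_le_of_ne (norm_nonneg _) (sq_pos_iff.1 hpos).symm))
  obtain ⟨J, hJ⟩ := mem_iUnion.1 hv
  have hlower : ∀ j : ℤ, J ≤ j → ∃ F : Finset ℤ, ‖f₂‖ ^ 2 * (3 / 4) ≤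
      ∑ k ∈ F, (∫ x, f x * dilate φ j k x) ^ 2 := by
    intro j hj
    have hvj : v ∈ closure (Submodule.span ℝ {h : Lp ℝ 2 (volume : Measure ℝ) |
        ∃ k : ℤ, h =ᵐ[volume] dilate φ j k} : Set (Lp ℝ 2 (volume : Measure ℝ))) :=
      scaleSpace_le_of_le hmono hj hJ
    obtain ⟨w, hw, hwd⟩ := Metric.mem_closure_iff.1 hvj (‖f₂‖ / 2 - dist f₂ v) (by linarith)
    have hset : {h : Lp ℝ 2 (volume : Measure ℝ) | ∃ k : ℤ, h =ᵐ[volume] dilate φ j k} =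
        Set.range fun k : ℤ => (memLp_dilate hφ2 j k).toLp (dilate φ j k) := by
      ext h
      simp only [mem_ofPred_eq, mem_range]
      refine exists_congr fun k => ⟨fun hk => ?_, fun hk => ?_⟩
      · exact Lp.ext ((MemLp.coeFn_toLp _).trans hk.symm)
      · rw [← hk]; exact MemLp.coeFn_toLp _
    rw [SetLike.mem_coe, hset, Finsupp.mem_span_range_iff_exists_finsupp] at hw
    obtain ⟨a, ha⟩ := hw
    refine ⟨a.support, ?_⟩
    have h1 := norm_sq_sub_sum_inner_sq_le (orthonormal_dilate ⟨hφ2, horth⟩ j) f₂ a a.support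
    have h2 : ∑ k ∈ a.support, a k • (memLp_dilate hφ2 j k).toLp (dilate φ j k) = w := ha
    rw [h2] at h1
    have h3 : ‖f₂ - w‖ ≤ ‖f₂‖ / 2 := by
      rw [← dist_eq_norm]
      have := dist_triangle f₂ v w
      linarith
    have h4 : ‖f₂ - w‖ ^ 2 ≤ (‖f₂‖ / 2) ^ 2 := pow_le_pow_left₀ (norm_nonneg _) h3 2
    simp only [f₂, inner_toLp_eq_integral] at h1
    simp only [f₂] at h4 ⊢
    linarith
  -- The sum of squares is at most the largest coefficient times the `ℓ¹` norm of the coefficients.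
  -- The cancellation of `φ` makes the former small, and bounded overlap of the translates controls
  -- the latter.
  have hupper : ∀ (j : ℕ) (F : Finset ℤ), ∑ k ∈ F, (∫ x, f x * dilate φ j k x) ^ 2 ≤
      (∫ u, |φ u| * min ((2 ^ j)⁻¹ * |u|) 2) * (C * ∫ x, |f x|) := by
    intro j F
    have hj : (0 : ℝ) < 2 ^ j := by positivity
    have hA : ∀ k : ℤ, |∫ x, f x * φ (2 ^ j * x - k)| ≤
        (2 ^ j)⁻¹ * ∫ u, |φ u| * min ((2 ^ j)⁻¹ * |u|) 2 := by
      intro k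
      have h1 := integral_comp_mul_sub (fun u => φ u * f ((2 ^ j)⁻¹ * (u + k))) hj k
      have h2 : ∀ x, φ (2 ^ j * x - k) * f ((2 ^ j)⁻¹ * (2 ^ j * x - k + k)) =
          f x * φ (2 ^ j * x - k) := by
        intro x
        rw [sub_add_cancel, inv_mul_cancel_left₀ hj.ne', mul_comm]
      simp only [h2] at h1
      rw [h1, abs_mul, abs_of_pos (inv_pos.2 hj)]
      exact mul_le_mul_of_nonneg_left (abs_integral_mul_comp_le hφi h0 hfc hfl hfb
        (by positivity) _) (by positivity)
    have hco : ∀ k : ℤ, (∫ x, f x * dilate φ j k x) ^ 2 =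
        2 ^ j * |∫ x, f x * φ (2 ^ j * x - k)| * |∫ x, f x * φ (2 ^ j * x - k)| := by
      intro k
      have h1 : ∀ x, f x * dilate φ j k x = (2 : ℝ) ^ (((j : ℤ) : ℝ) / 2) *
          (f x * φ (2 ^ j * x - k)) := fun x => by
        simp only [dilate, zpow_natCast]; ring
      simp only [h1]
      rw [integral_const_mul, mul_pow, sq, two_rpow_half_mul_self, zpow_natCast, mul_assoc,
        abs_mul_abs_self, sq]
    calc ∑ k ∈ F, (∫ x, f x * dilate φ j k x) ^ 2
        ≤ ∑ k ∈ F, (∫ u, |φ u| * min ((2 ^ j)⁻¹ * |u|) 2) * |∫ x, f x * φ (2 ^ j * x - k)| := by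
          refine Finset.sum_le_sum fun k _ => ?_
          rw [hco]
          refine mul_le_mul_of_nonneg_right ?_ (abs_nonneg _)
          have := mul_le_mul_of_nonneg_left (hA k) hj.le
          rwa [mul_inv_cancel_left₀ hj.ne'] at this
      _ ≤ _ := by
          rw [← Finset.mul_sum]
          refine mul_le_mul_of_nonneg_left (sum_abs_integral_mul_le hfi hφ2.1 hC hCs hj.ne' F)
            (integral_nonneg fun u => by positivity)
  have hlim := (tendsto_integral_abs_mul_min hφi).mul_const (C * ∫ x, |f x|)
  rw [zero_mul] at hlim
  obtain ⟨j, hj1, hj2⟩ := ((hlim.eventually_lt_const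
    (show 0 < ‖f₂‖ ^ 2 * (3 / 4) by positivity)).and
    (eventually_ge_atTop J.toNat)).exists
  obtain ⟨F, hF⟩ := hlower j (by omega)
  linarith [hupper j F]

/-! ### Gauges treating the `L¹` and the sup norm together, and smoothing by `φ`. -/

/-- Bounded integrable functions, against which bounded functions are tested. -/
def IsTest (W : ℝ → ℝ) : Prop := Integrable W ∧ ∃ B, ∀ x, |W x| ≤ B

/-- An abstract translation invariant size bound for test functions; `lam` records how it scales.
The bounds of the `L¹` norm and of the sup norm are the two instances. -/
structure IsGauge (rel : ℝ → (ℝ → ℝ) → Prop) (lam : ℝ → ℝ) : Prop where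
  lam_pos : ∀ a, 0 < a → 0 < lam a
  lam_inv : ∀ a, 0 < a → lam a * lam a⁻¹ = 1
  nonneg : ∀ {M W}, rel M W → 0 ≤ M
  translate : ∀ {M W} (t : ℝ), rel M W → rel M fun x => W (x + t)
  scale : ∀ {M W} {a : ℝ}, 0 < a → rel M W → rel (lam a * M) fun x => W (a⁻¹ * x)
  correlation : ∀ {M W f}, Integrable f → IsTest W → rel M W →
    rel ((∫ x, |f x|) * M) (correlation f W)
  average : ∀ {M e E} {A b : ℝ}, 0 ≤ A → 0 < b → Integrable e → Integrable E → rel M e →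
    (∀ y, |E y| ≤ A * ∫ x in Icc (y - b) (y + b), |e x|) → rel (A * (2 * b) * M) E

/-- `|∫ h W| ≤ X M` for all test functions `W` of size `M`. -/
def BoundedBy (rel : ℝ → (ℝ → ℝ) → Prop) (X : ℝ) (h : ℝ → ℝ) : Prop :=
  ∀ W M, IsTest W → rel M W → |∫ x, h x * W x| ≤ X * M

lemma IsTest.comp_mul_add {W : ℝ → ℝ} (hW : IsTest W) {a : ℝ} (ha : a ≠ 0) (t : ℝ) :
    IsTest fun x => W (a * x + t) := by
  obtain ⟨hi, B, hB⟩ := hW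
  exact ⟨(hi.comp_add_right t).comp_mul_left' ha, B, fun x => hB _⟩

lemma IsTest.translate {W : ℝ → ℝ} (hW : IsTest W) (t : ℝ) : IsTest fun x => W (x + t) := by
  simpa using hW.comp_mul_add one_ne_zero t

lemma IsTest.scale {W : ℝ → ℝ} (hW : IsTest W) {a : ℝ} (ha : a ≠ 0) :
    IsTest fun x => W (a * x) := by
  simpa using hW.comp_mul_add ha 0

lemma isTest_correlation {f W : ℝ → ℝ} (hf : Integrable f) (hW : IsTest W) :
    IsTest (correlation f W) := by
  obtain ⟨hi, B, hB⟩ := hW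
  exact ⟨integrable_correlation hf hi, _, abs_correlation_le hf hB⟩

lemma isGauge_sup : IsGauge (fun M W => ∀ x, |W x| ≤ M) (fun _ => 1) where
  lam_pos _ _ := one_pos
  lam_inv _ _ := one_mul 1
  nonneg h := (abs_nonneg _).trans (h 0)
  translate t h x := h _
  scale _ h x := by rw [one_mul]; exact h _
  correlation hf _ h := abs_correlation_le hf h
  average {M e E A b} hA hb he _ h hE y := by
    refine (hE y).trans ?_
    rw [mul_assoc]
    refine mul_le_mul_of_nonneg_left ?_ hA
    calc ∫ x in Icc (y - b) (y + b), |e x| ≤ ∫ x in Icc (y - b) (y + b), M :=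
          setIntegral_mono_on he.abs.integrableOn (by simp) measurableSet_Icc fun x _ => h x
      _ = 2 * b * M := by
          rw [setIntegral_const, Real.volume_real_Icc_of_le (by linarith), smul_eq_mul]
          ring

lemma isGauge_integral : IsGauge (fun M W => ∫ x, |W x| ≤ M) (fun a => a) where
  lam_pos _ h := h
  lam_inv _ h := mul_inv_cancel₀ h.ne'
  nonneg h := (integral_nonneg fun _ => abs_nonneg _).trans h
  translate {M W} t h := by rwa [integral_add_right_eq_self (fun x => |W x|) t]
  scale {M W a} ha h := by
    rw [Measure.integral_comp_mul_left (fun x => |W x|) a⁻¹, inv_inv, abs_of_pos ha, smul_eq_mul]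
    exact mul_le_mul_of_nonneg_left h ha.le
  correlation hf hW h := (integral_abs_correlation_le hf hW.1).trans
    (mul_le_mul_of_nonneg_left h (integral_nonneg fun _ => abs_nonneg _))
  average {M e E A b} hA hb he hE h hb' := by
    have hind : ∀ y, ∫ x in Icc (y - b) (y + b), |e x| =
        ∫ x, |e x| * (Icc (-b) b).indicator (fun _ => (1 : ℝ)) (y - x) := by
      intro y
      rw [← integral_indicator measurableSet_Icc]
      refine integral_congr_ae (Eventually.of_forall fun x => ?_)
      simp only [indicator, mem_Icc]
      have : (y - b ≤ x ∧ x ≤ y + b) ↔ (-b ≤ y - x ∧ y - x ≤ b) := by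
        constructor <;> rintro ⟨h1, h2⟩ <;> constructor <;> linarith
      simp only [this, mul_ite, mul_one, mul_zero]
    have h1i : Integrable ((Icc (-b) b).indicator (fun _ => (1 : ℝ))) :=
      (integrable_indicator_iff measurableSet_Icc).2 (by simp)
    have hi : Integrable (fun p : ℝ × ℝ => |e p.2| *
        (Icc (-b) b).indicator (fun _ => (1 : ℝ)) (p.1 - p.2)) (volume.prod volume) := by
      have := Integrable.convolution_integrand (ContinuousLinearMap.mul ℝ ℝ) he.abs h1i
        (μ := volume)
      simpa using this
    calc ∫ y, |E y| ≤ ∫ y, A * ∫ x, |e x| * (Icc (-b) b).indicator (fun _ => (1 : ℝ)) (y - x) :=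
          integral_mono hE.abs (hi.integral_prod_left.const_mul A) fun y => by
            simp only; rw [← hind]; exact hb' y
      _ = A * ∫ x, ∫ y, |e x| * (Icc (-b) b).indicator (fun _ => (1 : ℝ)) (y - x) := by
          rw [integral_const_mul, integral_integral_swap hi]
      _ = A * ∫ x, |e x| * (2 * b) := by
          congr 1
          refine integral_congr_ae (Eventually.of_forall fun x => ?_)
          simp only
          rw [integral_const_mul,
            integral_sub_right_eq_self ((Icc (-b) b).indicator (fun _ => (1 : ℝ))),
            integral_indicator measurableSet_Icc, setIntegral_const,
            Real.volume_real_Icc_of_le (by linarith), smul_eq_mul]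
          ring
      _ = A * (2 * b) * ∫ x, |e x| := by rw [integral_mul_const]; ring
      _ ≤ _ := mul_le_mul_of_nonneg_left h (by positivity)

lemma boundedBy_integral {h : ℝ → ℝ} {X : ℝ} (hX : ∀ x, |h x| ≤ X) :
    BoundedBy (fun M W => ∫ x, |W x| ≤ M) X h := by
  intro W M hW hM
  simp only [mul_comm (h _)]
  refine (abs_integral_mul_le_of_bounded hW.1 hX).trans ?_
  rw [mul_comm]
  exact mul_le_mul_of_nonneg_left hM ((abs_nonneg _).trans (hX 0))

lemma boundedBy_sup {h : ℝ → ℝ} (hi : Integrable h) {X : ℝ} (hX : ∫ x, |h x| ≤ X) :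
    BoundedBy (fun M W => ∀ x, |W x| ≤ M) X h := by
  intro W M hW hM
  exact (abs_integral_mul_le_of_bounded hi hM).trans
    (mul_le_mul_of_nonneg_right hX ((abs_nonneg _).trans (hM 0)))

/-- The smoothing operator `h ↦ c⁻¹ ∫ φ(u) h(· - u) du` with `c = ∫ φ`. -/
def smoothing (φ h : ℝ → ℝ) (x : ℝ) : ℝ := (∫ u, φ u)⁻¹ * ∫ u, φ u * h (x - u)

lemma isDerivFamily_sub_smoothing {φ : ℝ → ℝ} (hφ : Integrable φ) {H : ℕ → ℝ → ℝ}
    (hH : IsDerivFamily H) : IsDerivFamily fun i x => H i x - smoothing φ (H i) x where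
  deriv i x := by
    obtain ⟨B, hB⟩ := hH.bdd i
    obtain ⟨B', hB'⟩ := hH.bdd (i + 1)
    have h := hasDerivAt_integral_mul_comp_add hφ (-1) (hH.deriv i) (hH.continuous (i + 1)) hB hB' x
    have hneg : ∀ y x : ℝ, y + (-1) * x = y - x := fun y x => by ring
    simp only [hneg] at h
    exact (hH.deriv i x).sub (h.const_mul _)
  bdd i := by
    obtain ⟨B, hB⟩ := hH.bdd i
    refine ⟨B + |(∫ u, φ u)⁻¹| * ((∫ u, |φ u|) * B), fun x => (abs_sub _ _).trans ?_⟩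
    refine add_le_add (hB x) ?_
    rw [smoothing, abs_mul]
    exact mul_le_mul_of_nonneg_left (abs_integral_mul_le_of_bounded hφ fun u => hB _)
      (abs_nonneg _)

lemma integral_smoothing_mul {φ W H : ℝ → ℝ} (hφ : Integrable φ) (hW : Integrable W)
    (hH : Continuous H) {B : ℝ} (hB : ∀ x, |H x| ≤ B) :
    ∫ x, smoothing φ H x * W x = (∫ u, φ u)⁻¹ * ∫ u, φ u * ∫ x, H (x - u) * W x := by
  rw [← integral_convolution_mul hφ hW hH hB, ← integral_const_mul]
  simp only [smoothing, mul_assoc]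

lemma integral_smoothing_mul' {φ W H : ℝ → ℝ} (hφ : Integrable φ) (hW : Integrable W)
    (hH : Continuous H) {B : ℝ} (hB : ∀ x, |H x| ≤ B) :
    ∫ x, smoothing φ H x * W x = (∫ u, φ u)⁻¹ * ∫ y, H y * correlation φ W y := by
  have := integral_convolution_mul' hφ hW hH hB
  simp only [smoothing, mul_assoc]
  rw [integral_const_mul, this]
  rfl

lemma integrable_mul_of_continuous {W H : ℝ → ℝ} (hW : Integrable W)
    (hH : Continuous H) {B : ℝ} (hB : ∀ x, |H x| ≤ B) : Integrable fun x => H x * W x := by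
  simpa only [mul_comm] using integrable_mul_of_bounded hW hH.aestronglyMeasurable hB

lemma integrable_smoothing_mul {φ W H : ℝ → ℝ} (hφ : Integrable φ) (hW : Integrable W)
    (hH : Continuous H) {B : ℝ} (hB : ∀ x, |H x| ≤ B) :
    Integrable fun x => smoothing φ H x * W x := by
  have := (integrable_prod_mul_comp_sub hW hφ hH hB).integral_prod_left.const_mul (∫ u, φ u)⁻¹
  refine this.congr (Eventually.of_forall fun x => ?_)
  simp only [smoothing, mul_assoc]
  rw [integral_const_mul]
  ring

section

variable {rel : ℝ → (ℝ → ℝ) → Prop} {lam : ℝ → ℝ}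

lemma BoundedBy.translate (hrel : IsGauge rel lam) {h : ℝ → ℝ} {X : ℝ} (hX : BoundedBy rel X h)
    (t : ℝ) : BoundedBy rel X fun x => h (x - t) := by
  intro W M hW hM
  have := hX _ M (hW.translate t) (hrel.translate t hM)
  rw [← integral_sub_right_eq_self (fun x => h x * W (x + t)) t] at this
  simpa using this

lemma BoundedBy.scale (hrel : IsGauge rel lam) {h : ℝ → ℝ} {X : ℝ} (hX : BoundedBy rel X h)
    {a : ℝ} (ha : 0 < a) (b : ℝ) :
    BoundedBy rel (|b| * (a⁻¹ * lam a * X)) fun x => b * h (a * x) := by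
  intro W M hW hM
  have h1 := hX _ _ (hW.scale (inv_ne_zero ha.ne')) (hrel.scale ha hM)
  have h2 := Measure.integral_comp_mul_left (fun x => h x * W (a⁻¹ * x)) a
  simp only [inv_mul_cancel_left₀ ha.ne', abs_of_pos (inv_pos.2 ha), smul_eq_mul] at h2
  simp only [mul_assoc]
  rw [integral_const_mul, h2, abs_mul, abs_mul, abs_of_pos (inv_pos.2 ha)]
  refine mul_le_mul_of_nonneg_left ?_ (abs_nonneg _)
  refine mul_le_mul_of_nonneg_left ?_ (inv_pos.2 ha).le
  linarith

/-- The pairing of `W` with the translate of `H` by `y` is differentiable in `y`, its derivative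
being the pairing with a translate of `H'`; the mean value inequality then gives the factor `|u|`.
-/
lemma abs_sub_integral_translate_le (hrel : IsGauge rel lam) {H H' : ℝ → ℝ}
    (hd : ∀ x, HasDerivAt H (H' x) x) (hc : Continuous H') {B B' : ℝ} (hB : ∀ x, |H x| ≤ B)
    (hB' : ∀ x, |H' x| ≤ B') {X₁ : ℝ} (hX₁ : BoundedBy rel X₁ H') {W : ℝ → ℝ} {M : ℝ}
    (hW : IsTest W) (hM : rel M W) (u : ℝ) :
    |(∫ x, H x * W x) - ∫ x, H (x - u) * W x| ≤ X₁ * M * |u| := by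
  set G : ℝ → ℝ := fun y => ∫ x, W x * H (y + 1 * x) with hG
  have hGd : ∀ y, HasDerivAt G (∫ x, W x * H' (y + 1 * x)) y := fun y =>
    hasDerivAt_integral_mul_comp_add hW.1 1 hd hc hB hB' y
  have hbound : ∀ y, |∫ x, W x * H' (y + 1 * x)| ≤ X₁ * M := by
    intro y
    have h := hX₁.translate hrel (-y) W M hW hM
    simp only [one_mul, add_comm y]
    simpa only [sub_neg_eq_add, mul_comm] using h
  have h := (convex_univ (𝕜 := ℝ) (E := ℝ)).norm_image_sub_le_of_norm_hasDerivWithin_le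
    (f := G) (x := -u) (y := 0) (C := X₁ * M)
    (fun y _ => (hGd y).hasDerivWithinAt) (fun y _ => hbound y) (mem_univ _) (mem_univ _)
  have e0 : G 0 = ∫ x, H x * W x := by
    simp only [hG, zero_add, one_mul]
    simp only [mul_comm]
  have e1 : G (-u) = ∫ x, H (x - u) * W x := by
    simp only [hG, one_mul, neg_add_eq_sub]
    simp only [mul_comm]
  rw [e0, e1] at h
  simpa using h

lemma integral_sub_smoothing_mul {φ W H : ℝ → ℝ} (hφ : Integrable φ) (hc : ∫ u, φ u ≠ 0)
    (hW : Integrable W) (hH : Continuous H) {B : ℝ} (hB : ∀ x, |H x| ≤ B) :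
    ∫ x, (H x - smoothing φ H x) * W x = (∫ u, φ u)⁻¹ *
      ∫ u, φ u * ((∫ x, H x * W x) - ∫ x, H (x - u) * W x) := by
  have hi : Integrable fun u => φ u * ∫ x, H (x - u) * W x := by
    refine (integrable_prod_mul_comp_sub hW hφ hH hB).integral_prod_right.congr
      (Eventually.of_forall fun u => ?_)
    simp only
    rw [← integral_const_mul]
    congr 1
    ext x
    ring
  simp only [sub_mul, mul_sub]
  rw [integral_sub (integrable_mul_of_continuous hW hH hB)
    (integrable_smoothing_mul hφ hW hH hB), integral_sub (hφ.mul_const _) hi,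
    integral_mul_const, integral_smoothing_mul hφ hW hH hB, mul_sub, inv_mul_cancel_left₀ hc]

/-- A crude bound that costs no derivative; it is used for the highest derivative under control,
where none is left to spend. -/
lemma boundedBy_sub_smoothing (hrel : IsGauge rel lam) {φ H : ℝ → ℝ} (hφ : Integrable φ)
    (hH : Continuous H) {B : ℝ} (hB : ∀ x, |H x| ≤ B) {X : ℝ} (hX : BoundedBy rel X H) :
    BoundedBy rel ((1 + |(∫ u, φ u)⁻¹| * ∫ u, |φ u|) * X) fun x => H x - smoothing φ H x := by
  intro W M hW hM
  simp only [sub_mul]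
  rw [integral_sub (integrable_mul_of_continuous hW.1 hH hB)
    (integrable_smoothing_mul hφ hW.1 hH hB), integral_smoothing_mul hφ hW.1 hH hB]
  refine (abs_sub _ _).trans ?_
  rw [abs_mul]
  have h1 := hX W M hW hM
  have h2 := abs_integral_mul_le_of_bounded hφ (g := fun u => ∫ x, H (x - u) * W x)
    fun u => hX.translate hrel u W M hW hM
  have h3 := mul_le_mul_of_nonneg_left h2 (abs_nonneg (∫ u, φ u)⁻¹)
  linarith

/-- The smoothing operator is close to the identity on slowly varying functions. -/
lemma exists_boundedBy_sub_smoothing (hrel : IsGauge rel lam) {φ : ℝ → ℝ} (hφ : Integrable φ)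
    (hc : ∫ u, φ u ≠ 0) {η : ℝ} (hη : 0 < η) :
    ∃ c₁ : ℝ, 0 < c₁ ∧ ∀ H H' : ℝ → ℝ, (∀ x, HasDerivAt H (H' x) x) → Continuous H' →
      (∃ B, ∀ x, |H x| ≤ B) → (∃ B', ∀ x, |H' x| ≤ B') → ∀ X₀ X₁, BoundedBy rel X₀ H →
      BoundedBy rel X₁ H' → BoundedBy rel (η * X₀ + c₁ * X₁) fun x => H x - smoothing φ H x := by
  set c := ∫ u, φ u
  have htail : Tendsto (fun n : ℕ => ∫ u, {u : ℝ | (n : ℝ) < |u|}.indicator (fun u => |φ u|) u)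
      atTop (𝓝 0) := by
    have h := tendsto_integral_of_dominated_convergence (μ := (volume : Measure ℝ))
      (F := fun (n : ℕ) u => {u : ℝ | (n : ℝ) < |u|}.indicator (fun u => |φ u|) u)
      (f := fun _ => 0) (fun u => |φ u|)
      (fun n => hφ.abs.aestronglyMeasurable.indicator (measurableSet_lt (by fun_prop) (by fun_prop)))
      hφ.abs (fun n => Eventually.of_forall fun u => ?_) (Eventually.of_forall fun u => ?_)
    · simpa using h
    · rw [Real.norm_of_nonneg (indicator_nonneg (fun _ _ => abs_nonneg _) _)]
      exact indicator_le_self' (fun _ _ => abs_nonneg _) _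
    · refine tendsto_const_nhds.congr' ?_
      obtain ⟨n₀, hn₀⟩ := exists_nat_ge |u|
      filter_upwards [eventually_ge_atTop n₀] with n hn
      rw [indicator_of_notMem]
      simp only [mem_ofPred_eq, not_lt]
      exact hn₀.trans (by exact_mod_cast hn)
  have hcp : 0 < |c⁻¹| := abs_pos.2 (inv_ne_zero hc)
  obtain ⟨n, hn⟩ := (htail.eventually_lt_const (show 0 < η / (2 * |c⁻¹|) by positivity)).exists
  set τ := ∫ u, {u : ℝ | (n : ℝ) < |u|}.indicator (fun u => |φ u|) u
  have hτ : |c⁻¹| * (2 * τ) ≤ η := by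
    rw [lt_div_iff₀ (by positivity)] at hn
    linarith
  have hτi : Integrable ({u : ℝ | (n : ℝ) < |u|}.indicator (fun u => |φ u|)) :=
    hφ.abs.indicator (measurableSet_lt (by fun_prop) (by fun_prop))
  have hI0 : 0 ≤ ∫ u, |φ u| := integral_nonneg fun _ => abs_nonneg _
  refine ⟨|c⁻¹| * (n * ∫ u, |φ u|) + 1, by positivity, ?_⟩
  intro H H' hd hH'c ⟨B, hB⟩ ⟨B', hB'⟩ X₀ X₁ hX₀ hX₁ W M hW hM
  have hH : Continuous H := continuous_iff_continuousAt.2 fun x => (hd x).continuousAt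
  have h0 := (abs_nonneg _).trans (hX₀ W M hW hM)
  have h1 := (abs_nonneg _).trans (hX₁ W M hW hM)
  rw [integral_sub_smoothing_mul hφ hc hW.1 hH hB, abs_mul]
  have hmain : |∫ u, φ u * ((∫ x, H x * W x) - ∫ x, H (x - u) * W x)| ≤
      τ * (2 * (X₀ * M)) + (∫ u, |φ u|) * (n * (X₁ * M)) := by
    rw [← integral_mul_const, ← integral_mul_const, ← integral_add (hτi.mul_const _)
      (hφ.abs.mul_const _), ← Real.norm_eq_abs]
    refine norm_integral_le_of_norm_le ((hτi.mul_const _).add (hφ.abs.mul_const _))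
      (Eventually.of_forall fun u => ?_)
    rw [norm_mul, Real.norm_eq_abs, Real.norm_eq_abs]
    -- For large `|u|` the two translates are bounded separately and the small tail mass of `φ`
    -- gives `η`; for `|u| ≤ n` the derivative bound applies.
    by_cases hu : (n : ℝ) < |u|
    · rw [indicator_of_mem (by exact hu)]
      have e1 := hX₀ W M hW hM
      have e2 := hX₀.translate hrel u W M hW hM
      have e3 : |(∫ x, H x * W x) - ∫ x, H (x - u) * W x| ≤ 2 * (X₀ * M) := by
        refine (abs_sub _ _).trans ?_; linarith
      have e4 := mul_le_mul_of_nonneg_left e3 (abs_nonneg (φ u))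
      have e5 : 0 ≤ |φ u| * (n * (X₁ * M)) := by positivity
      linarith
    · rw [indicator_of_notMem (by exact hu), zero_mul, zero_add]
      refine mul_le_mul_of_nonneg_left ?_ (abs_nonneg _)
      refine (abs_sub_integral_translate_le hrel hd hH'c hB hB' hX₁ hW hM u).trans ?_
      push Not at hu
      rw [mul_comm]
      exact mul_le_mul_of_nonneg_right hu h1
  have e1 := mul_le_mul_of_nonneg_left hmain (abs_nonneg c⁻¹)
  have e2 := mul_le_mul_of_nonneg_right hτ h0
  calc |c⁻¹| * |∫ u, φ u * ((∫ x, H x * W x) - ∫ x, H (x - u) * W x)|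
      ≤ |c⁻¹| * (τ * (2 * (X₀ * M)) + (∫ u, |φ u|) * (n * (X₁ * M))) := e1
    _ = |c⁻¹| * (2 * τ) * (X₀ * M) + |c⁻¹| * (n * ∫ u, |φ u|) * (X₁ * M) := by ring
    _ ≤ η * (X₀ * M) + (|c⁻¹| * (n * ∫ u, |φ u|) * (X₁ * M) + X₁ * M) := by linarith
    _ = _ := by ring

end

lemma hasDerivAt_comp_mul {f : ℝ → ℝ} {f' a x : ℝ} (h : HasDerivAt f f' (a * x)) :
    HasDerivAt (fun x => f (a * x)) (f' * a) x :=
  HasDerivAt.comp x h (by simpa using (hasDerivAt_id x).const_mul a)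

/-! ### Decay of the wavelet coefficients of smooth functions. -/

/-- Finite linear combinations of the wavelets at level `D`, without the `L²` normalisation. -/
def waveletSum (ψ : ℝ → ℝ) (D : ℕ) (F : Finset ℤ) (σ : ℤ → ℝ) (x : ℝ) : ℝ :=
  ∑ k ∈ F, σ k * ψ (2 ^ D * x - k)

lemma isTest_waveletSum {ψ : ℝ → ℝ} (hi : Integrable ψ) {B : ℝ} (hB : ∀ x, |ψ x| ≤ B) (D : ℕ)
    (F : Finset ℤ) (σ : ℤ → ℝ) : IsTest (waveletSum ψ D F σ) := by
  refine ⟨integrable_finsetSum _ fun k _ =>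
    (integrable_comp_mul_sub hi (by positivity) _).const_mul _, ∑ k ∈ F, |σ k| * B, fun x => ?_⟩
  refine (Finset.abs_sum_le_sum_abs _ _).trans (Finset.sum_le_sum fun k _ => ?_)
  rw [abs_mul]
  exact mul_le_mul_of_nonneg_left (hB _) (abs_nonneg _)

section

variable {rel : ℝ → (ℝ → ℝ) → Prop} {lam : ℝ → ℝ}

/-- The correlation vanishes on a lattice of mesh `h = 2^(-D)`, so it is dominated by `h ^ N` times
a local integral of its weak derivative over a window of length proportional to `h`; averaging
supplies the last factor `h`. This gain takes the place of vanishing moments of `ψ`. -/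
lemma rel_correlation_waveletSum (hrel : IsGauge rel lam) {N : ℕ} {φ ψ : ℝ → ℝ}
    (hφ : IsFatherWavelet N φ) (hψ : IsMotherWavelet N φ ψ) :
    ∃ C : ℝ, 0 ≤ C ∧ ∀ D F σ M, rel M (waveletSum ψ D F σ) →
      rel (C * ((2 ^ (N + 1))⁻¹) ^ D * M) (correlation φ (waveletSum ψ D F σ)) := by
  have hφi := hφ.decay.integrable hφ.mra.1.1.1
  have hψi := hψ.decay.integrable hψ.orthonormal.1.1
  obtain ⟨Cψ, -, hCψ, -⟩ := hψ.decay.exists_bound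
  obtain ⟨v, hv, B, hB⟩ := hφ.smooth
  have hvi := integrable_of_tsum_translates_le hv.2.1 hB
  have hI : 0 ≤ ∫ x, |v x| := integral_nonneg fun _ => abs_nonneg _
  refine ⟨(2 ^ N) ^ N * (2 * (2 ^ N + 1)) * ∫ x, |v x|, by positivity, ?_⟩
  intro D F σ M hM
  have hW := isTest_waveletSum hψi hCψ D F σ
  obtain ⟨BW, hBW⟩ := hW.2
  have hh : (0 : ℝ) < (2 ^ D)⁻¹ := by positivity
  have h1 := abs_correlation_le_of_lattice hφi hvi hv hW.1 hBW hh
    (fun i => correlation_eq_zero_of_lattice hφ hψ hφi hCψ D F σ i)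
  have h2 := hrel.average (by positivity) (by positivity) (integrable_correlation hvi hW.1)
    (integrable_correlation hφi hW.1) (hrel.correlation hvi hW hM) h1
  convert h2 using 1
  have hpow : (((2 : ℝ) ^ (N + 1))⁻¹) ^ D = ((2 ^ D)⁻¹) ^ N * (2 ^ D)⁻¹ := by
    rw [inv_pow, inv_pow, ← mul_inv, ← pow_mul, ← pow_mul, ← pow_add]
    congr 2
    ring
  rw [hpow, mul_pow]
  ring

/-- Smooth functions have small coefficients at high levels: the case of slowly varying ones. -/
lemma exists_abs_integral_waveletSum_le_of_slow (hrel : IsGauge rel lam) {N : ℕ} {φ ψ : ℝ → ℝ}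
    (hφ : IsFatherWavelet N φ) (hψ : IsMotherWavelet N φ ψ) :
    ∃ C : ℝ, 0 ≤ C ∧ ∃ d : ℕ, ∃ δ : ℝ, 0 < δ ∧ ∀ D H X, IsDerivFamily H →
      (∀ i ≤ d, BoundedBy rel (X * δ ^ i) (H i)) → ∀ F σ M, rel M (waveletSum ψ D F σ) →
      |∫ x, H 0 x * waveletSum ψ D F σ x| ≤ C * X * ((2 ^ (N + 1))⁻¹) ^ D * M := by
  have hφi := hφ.decay.integrable hφ.mra.1.1.1
  have hψi := hψ.decay.integrable hψ.orthonormal.1.1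
  obtain ⟨Cψ, -, hCψ, -⟩ := hψ.decay.exists_bound
  have hc := hφ.integral_ne_zero
  obtain ⟨C₁, hC₁, hcor⟩ := rel_correlation_waveletSum hrel hφ hψ
  set q : ℝ := (2 ^ (N + 1))⁻¹ with hq
  have hq0 : 0 < q := by positivity
  -- With this choice the smoothing remainder contributes `2ηC = Cq/2` per level, half of the
  -- permitted `Cq`; the other half of `C` absorbs the smoothed part.
  set η := q / 4 with hη
  obtain ⟨c₁, hc₁, hnear⟩ := exists_boundedBy_sub_smoothing hrel hφi hc
    (show 0 < η by positivity)
  set c := ∫ u, φ u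
  set A := 1 + |c⁻¹| * ∫ u, |φ u|
  have hA : 0 < A := by
    have : 0 ≤ ∫ u, |φ u| := integral_nonneg fun _ => abs_nonneg _
    positivity
  -- The derivative of order `d` admits only the crude factor `A`; the factor `2^(-d)` from halving
  -- the argument brings it back below `2η`.
  obtain ⟨d, hd⟩ := exists_pow_lt_of_lt_one (show 0 < 2 * η / A by positivity)
    (show (2 : ℝ)⁻¹ < 1 by norm_num)
  have hAd : A * 2⁻¹ ^ d ≤ 2 * η := by
    rw [lt_div_iff₀ hA] at hd; linarith
  -- Then `η X δ^i + c₁ X δ^(i+1) = 2η X δ^i`: the derivative term costs no more than the tail term.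
  set δ := η / c₁
  have hδ : 0 < δ := by positivity
  have hcδ : c₁ * δ = η := mul_div_cancel₀ η hc₁.ne'
  refine ⟨1 + 2 * (|c⁻¹| * C₁), by positivity, d, δ, hδ, ?_⟩
  set C := 1 + 2 * (|c⁻¹| * C₁)
  have hC0 : 0 < C := by positivity
  intro D
  induction D with
  | zero =>
    intro H X hH hX F σ M hM
    have hW := isTest_waveletSum hψi hCψ 0 F σ
    have h1 := hX 0 (Nat.zero_le _) _ M hW hM
    rw [pow_zero, mul_one] at h1
    rw [pow_zero, mul_one]
    have h2 := (abs_nonneg _).trans h1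
    have h3 : 0 ≤ 2 * (|c⁻¹| * C₁) * (X * M) := by positivity
    calc _ ≤ X * M := h1
      _ ≤ C * X * M := by simp only [C]; linarith
  | succ D ih =>
    intro H X hH hX F σ M hM
    set W := waveletSum ψ (D + 1) F σ
    have hW : IsTest W := isTest_waveletSum hψi hCψ (D + 1) F σ
    obtain ⟨B0, hB0⟩ := hH.bdd 0
    have hXM : 0 ≤ X * M := by
      have := (abs_nonneg _).trans (hX 0 (Nat.zero_le _) _ M hW hM)
      rwa [pow_zero, mul_one] at this
    have hM0 := hrel.nonneg hM
    have hsplit : ∫ x, H 0 x * W x =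
        (∫ x, smoothing φ (H 0) x * W x) + ∫ x, (H 0 x - smoothing φ (H 0) x) * W x := by
      rw [← integral_add (integrable_smoothing_mul hφi hW.1 (hH.continuous 0) hB0)]
      · refine integral_congr_ae (Eventually.of_forall fun x => ?_)
        simp only
        ring
      · simp only [sub_mul]
        exact (integrable_mul_of_continuous hW.1 (hH.continuous 0) hB0).sub
          (integrable_smoothing_mul hφi hW.1 (hH.continuous 0) hB0)
    have hS : |∫ x, smoothing φ (H 0) x * W x| ≤ |c⁻¹| * (X * (C₁ * q ^ (D + 1) * M)) := by
      rw [integral_smoothing_mul' hφi hW.1 (hH.continuous 0) hB0, abs_mul]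
      refine mul_le_mul_of_nonneg_left ?_ (abs_nonneg _)
      have := hX 0 (Nat.zero_le _) _ _ (isTest_correlation hφi hW) (hcor _ _ _ _ hM)
      rwa [pow_zero, mul_one] at this
    have hT : |∫ x, (H 0 x - smoothing φ (H 0) x) * W x| ≤ 2 * η * C * (X * M) * q ^ D := by
      have hfam := isDerivFamily_sub_smoothing hφi hH
      -- Halving the argument turns wavelets of level `D + 1` into wavelets of level `D` and
      -- multiplies the `i`th derivative by `2^(-i)`. The remainder of the smoothing thus satisfies
      -- the induction hypothesis again, with `X` replaced by a multiple of `η X`.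
      have hfam2 : IsDerivFamily fun i x =>
          2⁻¹ ^ i * (H i (2⁻¹ * x) - smoothing φ (H i) (2⁻¹ * x)) := by
        constructor
        · intro i x
          have h1 := hasDerivAt_comp_mul (hfam.deriv i (2⁻¹ * x))
          have h2 := h1.const_mul ((2⁻¹ : ℝ) ^ i)
          refine h2.congr_deriv ?_
          rw [pow_succ]
          ring
        · intro i
          obtain ⟨B, hB⟩ := hfam.bdd i
          refine ⟨2⁻¹ ^ i * B, fun x => ?_⟩
          rw [abs_mul, abs_of_pos (by positivity : (0 : ℝ) < 2⁻¹ ^ i)]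
          exact mul_le_mul_of_nonneg_left (hB _) (by positivity)
      have hl := hrel.lam_pos 2⁻¹ (by norm_num)
      have hl2 := hrel.lam_inv 2⁻¹ (by norm_num)
      rw [inv_inv] at hl2
      have hbd : ∀ i ≤ d, BoundedBy rel (2 * lam 2⁻¹ * (2 * η * X) * δ ^ i) fun x =>
          2⁻¹ ^ i * (H i (2⁻¹ * x) - smoothing φ (H i) (2⁻¹ * x)) := by
        intro i hi W' M' hW' hM'
        obtain ⟨B, hB⟩ := hH.bdd i
        obtain ⟨B', hB'⟩ := hH.bdd (i + 1)
        have hXi := (abs_nonneg _).trans (hX i hi W' M' hW' hM')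
        have hbase : BoundedBy rel (2 * η * (2 ^ i) * (X * δ ^ i)) fun x =>
            H i x - smoothing φ (H i) x := by
          intro W'' M'' hW'' hM''
          have hXi := (abs_nonneg _).trans (hX i hi W'' M'' hW'' hM'')
          rcases hi.lt_or_eq with hlt | heq
          · have h1 := hnear (H i) (H (i + 1)) (hH.deriv i) (hH.continuous _) ⟨B, hB⟩ ⟨B', hB'⟩
              _ _ (hX i hi) (hX (i + 1) hlt) W'' M'' hW'' hM''
            refine h1.trans ?_
            have h2 : (1 : ℝ) ≤ 2 ^ i := one_le_pow₀ (by norm_num)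
            have h3 : (η * (X * δ ^ i) + c₁ * (X * δ ^ (i + 1))) * M'' =
                2 * η * 1 * (X * δ ^ i * M'') := by
              rw [pow_succ]
              linear_combination (X * δ ^ i * M'') * hcδ
            rw [h3, mul_assoc (2 * η * 2 ^ i)]
            refine mul_le_mul_of_nonneg_right ?_ hXi
            exact mul_le_mul_of_nonneg_left h2 (by positivity)
          · refine (boundedBy_sub_smoothing hrel hφi (hH.continuous i) hB (hX i hi) W'' M''
              hW'' hM'').trans ?_
            rw [mul_assoc, mul_assoc (2 * η * 2 ^ i)]
            refine mul_le_mul_of_nonneg_right ?_ hXi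
            rw [heq]
            have := mul_le_mul_of_nonneg_right hAd (show (0 : ℝ) ≤ 2 ^ d by positivity)
            rwa [mul_assoc, ← mul_pow, inv_mul_cancel₀ two_ne_zero, one_pow, mul_one] at this
        refine (hbase.scale hrel (show (0 : ℝ) < 2⁻¹ by norm_num) (2⁻¹ ^ i) W' M' hW' hM').trans
          (le_of_eq ?_)
        rw [abs_of_pos (by positivity : (0 : ℝ) < 2⁻¹ ^ i), inv_inv]
        have : (2 : ℝ)⁻¹ ^ i * 2 ^ i = 1 := by
          rw [← mul_pow, inv_mul_cancel₀ two_ne_zero, one_pow]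
        linear_combination (2 * lam 2⁻¹ * (2 * η) * (X * δ ^ i) * M') * this
      have hWhalf : (fun x => W ((2 : ℝ)⁻¹ * x)) = waveletSum ψ D F σ := by
        ext x
        simp only [W, waveletSum]
        refine Finset.sum_congr rfl fun k _ => ?_
        rw [pow_succ, mul_assoc, mul_inv_cancel_left₀ two_ne_zero]
      have hMhalf := hrel.scale (a := 2) two_pos hM
      rw [hWhalf] at hMhalf
      have h1 := ih _ _ hfam2 hbd F σ _ hMhalf
      have h2 := Measure.integral_comp_mul_left
        (fun x => (H 0 x - smoothing φ (H 0) x) * W x) (2⁻¹ : ℝ)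
      rw [← hWhalf] at h1
      simp only [pow_zero, one_mul] at h1
      rw [h2, inv_inv, abs_of_pos (two_pos : (0 : ℝ) < 2), smul_eq_mul, abs_mul,
        abs_of_pos (two_pos : (0 : ℝ) < 2)] at h1
      have h3 : C * (2 * lam 2⁻¹ * (2 * η * X)) * q ^ D * (lam 2 * M) =
          2 * (2 * η * C * (X * M) * q ^ D) := by
        linear_combination (C * 2 * (2 * η * X) * q ^ D * M) * hl2
      rw [h3] at h1
      linarith
    rw [hsplit]
    refine (abs_add_le _ _).trans ((add_le_add hS hT).trans ?_)
    have hfin : |c⁻¹| * C₁ + C / 2 ≤ C := by simp only [C]; linarith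
    have h5 : 2 * η = q / 2 := by rw [hη]; ring
    rw [h5]
    calc |c⁻¹| * (X * (C₁ * q ^ (D + 1) * M)) + q / 2 * C * (X * M) * q ^ D
        = (|c⁻¹| * C₁ + C / 2) * (X * M * q ^ (D + 1)) := by rw [pow_succ]; ring
      _ ≤ C * (X * M * q ^ (D + 1)) := mul_le_mul_of_nonneg_right hfin (by positivity)
      _ = _ := by ring

/-- Smooth functions have small coefficients at high levels. -/
lemma exists_abs_integral_waveletSum_le (hrel : IsGauge rel lam) {N : ℕ} {φ ψ : ℝ → ℝ}
    (hφ : IsFatherWavelet N φ) (hψ : IsMotherWavelet N φ ψ) :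
    ∃ C : ℝ, 0 ≤ C ∧ ∃ d : ℕ, ∀ H X, IsDerivFamily H →
      (∀ i ≤ d, BoundedBy rel X (H i)) → ∀ D F σ M, rel M (waveletSum ψ D F σ) →
      |∫ x, H 0 x * waveletSum ψ D F σ x| ≤ C * X * ((2 ^ (N + 1))⁻¹) ^ D * M := by
  have hψi := hψ.decay.integrable hψ.orthonormal.1.1
  obtain ⟨Cψ, -, hCψ, -⟩ := hψ.decay.exists_bound
  obtain ⟨C, hC, d, δ, hδ, hmain⟩ := exists_abs_integral_waveletSum_le_of_slow hrel hφ hψ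
  set q : ℝ := (2 ^ (N + 1))⁻¹ with hq
  have hq0 : 0 < q := by positivity
  have hq1 : q ≤ 1 := inv_le_one_of_one_le₀ (one_le_pow₀ (by norm_num))
  -- A dilation by `2^(-l) < δ` makes any family slowly varying. It uses up `l` levels, which costs
  -- the constant `q^(-l)`; below level `l` the trivial bound suffices.
  obtain ⟨l, hl⟩ := exists_pow_lt_of_lt_one hδ (show (2 : ℝ)⁻¹ < 1 by norm_num)
  refine ⟨(q⁻¹) ^ l * (1 + C), by positivity, d, ?_⟩
  intro H X hH hX D F σ M hM
  have hW := isTest_waveletSum hψi hCψ D F σ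
  have h0 := hX 0 (Nat.zero_le _) _ M hW hM
  have hXM := (abs_nonneg _).trans h0
  by_cases hDl : D < l
  · refine h0.trans ?_
    have h1 : 1 ≤ (q⁻¹) ^ l * q ^ D := by
      rw [inv_pow, inv_mul_eq_div, one_le_div (by positivity)]
      exact pow_le_pow_of_le_one hq0.le hq1 hDl.le
    calc X * M ≤ ((q⁻¹) ^ l * q ^ D) * (1 + C) * (X * M) :=
          le_mul_of_one_le_left hXM (one_le_mul_of_one_le_of_one_le h1 (by linarith))
      _ = _ := by ring
  · push Not at hDl
    set a : ℝ := 2⁻¹ ^ l with ha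
    have ha0 : 0 < a := by positivity
    have hfam : IsDerivFamily fun i x => a ^ i * H i (a * x) := by
      constructor
      · intro i x
        refine ((hasDerivAt_comp_mul (hH.deriv i (a * x))).const_mul (a ^ i)).congr_deriv ?_
        rw [pow_succ]
        ring
      · intro i
        obtain ⟨B, hB⟩ := hH.bdd i
        refine ⟨a ^ i * B, fun x => ?_⟩
        rw [abs_mul, abs_of_pos (by positivity : (0 : ℝ) < a ^ i)]
        exact mul_le_mul_of_nonneg_left (hB _) (by positivity)
    have hbd : ∀ i ≤ d, BoundedBy rel (a⁻¹ * lam a * X * δ ^ i) fun x => a ^ i * H i (a * x) := by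
      intro i hi W' M' hW' hM'
      have hb := (hX i hi).scale hrel ha0 (a ^ i) W' M' hW' hM'
      have hsc := (abs_nonneg _).trans (hX i hi _ _ (hW'.scale (inv_ne_zero ha0.ne'))
        (hrel.scale ha0 hM'))
      refine hb.trans ?_
      rw [abs_of_pos (by positivity : 0 < a ^ i)]
      have h1 : a ^ i ≤ δ ^ i := pow_le_pow_left₀ ha0.le hl.le i
      have h2 : 0 ≤ a⁻¹ * (X * (lam a * M')) := mul_nonneg (inv_pos.2 ha0).le hsc
      have h3 := mul_le_mul_of_nonneg_right h1 h2
      calc _ = a ^ i * (a⁻¹ * (X * (lam a * M'))) := by ring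
        _ ≤ _ := h3
        _ = _ := by ring
    have hWa : (fun x => waveletSum ψ D F σ (a * x)) = waveletSum ψ (D - l) F σ := by
      ext x
      simp only [waveletSum]
      refine Finset.sum_congr rfl fun k _ => ?_
      have h1 : (2 : ℝ) ^ D = 2 ^ (D - l) * 2 ^ l := by rw [← pow_add, Nat.sub_add_cancel hDl]
      have h2 : (2 : ℝ) ^ l * a = 1 := by
        rw [ha, ← mul_pow, mul_inv_cancel₀ two_ne_zero, one_pow]
      rw [h1, mul_assoc, ← mul_assoc _ a, h2, one_mul]
    have hMa := hrel.scale (a := a⁻¹) (inv_pos.2 ha0) hM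
    rw [inv_inv, hWa] at hMa
    have h1 := hmain (D - l) _ _ hfam hbd F σ _ hMa
    have h2 := Measure.integral_comp_mul_left (fun x => H 0 x * waveletSum ψ D F σ x) a
    rw [← hWa] at h1
    simp only [pow_zero, one_mul] at h1
    rw [h2, abs_of_pos (inv_pos.2 ha0), smul_eq_mul, abs_mul, abs_of_pos (inv_pos.2 ha0)] at h1
    have hla := hrel.lam_inv a ha0
    have h3 : C * (a⁻¹ * lam a * X) * q ^ (D - l) * (lam a⁻¹ * M) =
        a⁻¹ * (C * q ^ (D - l) * (X * M)) := by
      linear_combination (C * a⁻¹ * X * q ^ (D - l) * M) * hla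
    rw [h3] at h1
    have h4 := le_of_mul_le_mul_left h1 (inv_pos.2 ha0)
    refine h4.trans ?_
    have h5 : q ^ (D - l) = (q⁻¹) ^ l * q ^ D := by
      rw [inv_pow q l, inv_mul_eq_div, eq_div_iff (by positivity), ← pow_add,
        Nat.sub_add_cancel hDl]
    rw [h5]
    have h6 : 0 ≤ (q⁻¹) ^ l * q ^ D * (X * M) := by positivity
    calc _ = C * ((q⁻¹) ^ l * q ^ D * (X * M)) := by ring
      _ ≤ (1 + C) * ((q⁻¹) ^ l * q ^ D * (X * M)) :=
          mul_le_mul_of_nonneg_right (by linarith) h6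
      _ = _ := by ring

end

/-- `h` is a test function whose derivatives up to order `d` are bounded by `G₁` in `L¹` and
by `G` in the sup norm. -/
structure SmoothBounds (d : ℕ) (h : ℝ → ℝ) (G₁ G : ℝ) : Prop where
  contDiff : ContDiff ℝ ∞ h
  compact : HasCompactSupport h
  sup_le : ∀ i ≤ d, ∀ x, |iteratedDeriv i h x| ≤ G
  integral_le : ∀ i ≤ d, ∫ x, |iteratedDeriv i h x| ≤ G₁

lemma SmoothBounds.sup_nonneg {d : ℕ} {h : ℝ → ℝ} {G₁ G : ℝ} (H : SmoothBounds d h G₁ G) :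
    0 ≤ G := (abs_nonneg _).trans (H.sup_le 0 (Nat.zero_le _) 0)

lemma SmoothBounds.integral_nonneg {d : ℕ} {h : ℝ → ℝ} {G₁ G : ℝ} (H : SmoothBounds d h G₁ G) :
    0 ≤ G₁ := (MeasureTheory.integral_nonneg fun _ => abs_nonneg _).trans
      (H.integral_le 0 (Nat.zero_le _))

lemma SmoothBounds.abs_le {d : ℕ} {h : ℝ → ℝ} {G₁ G : ℝ} (H : SmoothBounds d h G₁ G) (x : ℝ) :
    |h x| ≤ G := by simpa using H.sup_le 0 (Nat.zero_le _) x

lemma SmoothBounds.integral_abs_le {d : ℕ} {h : ℝ → ℝ} {G₁ G : ℝ} (H : SmoothBounds d h G₁ G) :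
    ∫ x, |h x| ≤ G₁ := by simpa using H.integral_le 0 (Nat.zero_le _)

lemma SmoothBounds.integrable {d : ℕ} {h : ℝ → ℝ} {G₁ G : ℝ} (H : SmoothBounds d h G₁ G) :
    Integrable h := H.contDiff.continuous.integrable_of_hasCompactSupport H.compact

lemma integral_abs_comp_mul_sub (g : ℝ → ℝ) {a : ℝ} (ha : 0 < a) (b : ℝ) :
    ∫ x, |g (a * x - b)| = a⁻¹ * ∫ x, |g x| :=
  integral_comp_mul_sub (fun x => |g x|) ha b

lemma waveletSum_singleton (ψ : ℝ → ℝ) (D : ℕ) (k : ℤ) :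
    waveletSum ψ D {k} (fun _ => 1) = fun x => ψ (2 ^ D * x - k) := by
  ext x; simp [waveletSum]

/-- Decay of the coefficients of test functions, uniformly and summed over the translates. -/
lemma exists_coeff_decay {N : ℕ} {φ ψ : ℝ → ℝ} (hφ : IsFatherWavelet N φ)
    (hψ : IsMotherWavelet N φ ψ) :
    ∃ C : ℝ, 0 ≤ C ∧ ∃ d : ℕ, ∀ h G₁ G, SmoothBounds d h G₁ G → ∀ D : ℕ,
      (∀ k : ℤ, |∫ x, h x * ψ (2 ^ D * x - k)| ≤
        C * G * (2 ^ D)⁻¹ * ((2 ^ (N + 1))⁻¹) ^ D) ∧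
      ∀ F : Finset ℤ, ∑ k ∈ F, |∫ x, h x * ψ (2 ^ D * x - k)| ≤
        C * G₁ * ((2 ^ (N + 1))⁻¹) ^ D := by
  have hψi := hψ.decay.integrable hψ.orthonormal.1.1
  obtain ⟨Cψ, hCψ0, hCψ, hsum⟩ := hψ.decay.exists_bound
  obtain ⟨C₁, hC₁, d₁, h₁⟩ := exists_abs_integral_waveletSum_le isGauge_integral hφ hψ
  obtain ⟨C₂, hC₂, d₂, h₂⟩ := exists_abs_integral_waveletSum_le isGauge_sup hφ hψ
  set I := ∫ x, |ψ x|
  have hI : 0 ≤ I := integral_nonneg fun _ => abs_nonneg _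
  refine ⟨C₁ * I + C₂ * Cψ, by positivity, max d₁ d₂, ?_⟩
  intro h G₁ G hG D
  have hfam := isDerivFamily_iteratedDeriv hG.contDiff hG.compact
  have hG0 := hG.sup_nonneg
  have hG10 := hG.integral_nonneg
  constructor
  · intro k
    -- The uniform bound uses sup norms of the derivatives against the `L¹` norm of a single
    -- wavelet, which is `2^(-D) ∫ |ψ|`.
    have h3 := h₁ _ G hfam (fun i hi => boundedBy_integral
      (hG.sup_le i (hi.trans (le_max_left _ _)))) D {k} (fun _ => 1) ((2 ^ D)⁻¹ * I) (by
        rw [waveletSum_singleton, integral_abs_comp_mul_sub ψ (by positivity)])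
    rw [waveletSum_singleton] at h3
    simp only [iteratedDeriv_zero] at h3
    refine h3.trans ?_
    have : 0 ≤ C₂ * Cψ * (G * (2 ^ D)⁻¹ * ((2 ^ (N + 1))⁻¹) ^ D) := by positivity
    linarith
  · intro F
    set c : ℤ → ℝ := fun k => ∫ x, h x * ψ (2 ^ D * x - k)
    -- With the signs of the coefficients as weights, the `ℓ¹` norm becomes one pairing with a
    -- wavelet sum whose sup norm is at most `Cψ`, whatever `F` and `D` are.
    set σ : ℤ → ℝ := fun k => SignType.sign (c k)
    have hσ : ∀ k, |σ k| ≤ 1 := fun k => by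
      simp only [σ]
      rcases lt_trichotomy (c k) 0 with hk | hk | hk <;> simp [hk]
    have h3 := h₂ _ G₁ hfam (fun i hi => boundedBy_sup
      ((hfam.continuous i).integrable_of_hasCompactSupport
        (hasCompactSupport_iteratedDeriv hG.compact i))
      (hG.integral_le i (hi.trans (le_max_right _ _)))) D F σ Cψ (by
        intro x
        refine (Finset.abs_sum_le_sum_abs _ _).trans (le_trans ?_ (hsum (2 ^ D * x) F))
        refine Finset.sum_le_sum fun k _ => ?_
        rw [abs_mul]
        exact mul_le_of_le_one_left (abs_nonneg _) (hσ k))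
    have h4 : ∑ k ∈ F, |c k| = ∫ x, iteratedDeriv 0 h x * waveletSum ψ D F σ x := by
      simp only [iteratedDeriv_zero, waveletSum, Finset.mul_sum]
      rw [integral_finsetSum]
      · refine Finset.sum_congr rfl fun k _ => ?_
        simp only [mul_left_comm (h _)]
        rw [integral_const_mul, ← sign_mul_self]
      · intro k _
        simp only [mul_left_comm (h _)]
        exact (integrable_mul_of_continuous (integrable_comp_mul_sub hψi (by positivity) _)
          hG.contDiff.continuous hG.abs_le).const_mul _
    rw [h4]
    refine (le_abs_self _).trans (h3.trans ?_)
    have : 0 ≤ C₁ * I * (G₁ * ((2 ^ (N + 1))⁻¹) ^ D) := by positivity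
    linarith

/-! ### The Besov functional of dilated test functions. -/

lemma abs_integral_mul_dilate_le {g h : ℝ → ℝ} (hg : Integrable g) {G : ℝ} (hG : ∀ x, |h x| ≤ G)
    {a : ℝ} (ha : 0 < a) (b : ℝ) :
    |∫ x, h x * g (a * x - b)| ≤ (∫ x, |g x|) * G * a⁻¹ := by
  have h1 := abs_integral_mul_le_of_bounded (integrable_comp_mul_sub hg ha.ne' b) hG
  rw [integral_abs_comp_mul_sub g ha] at h1
  simp only [mul_comm (h _)]
  linarith

/-- Interpolation between the `ℓ¹` and the `ℓ^∞` norm. -/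
lemma eLpNorm_count_le {ι ε : Type*} [MeasurableSpace ι] [MeasurableSingletonClass ι]
    [TopologicalSpace ε] [ContinuousENorm ε] {f : ι → ε} {p : ℝ≥0∞} (hp : 1 ≤ p) {A B : ℝ≥0∞}
    (hA : ∀ i, ‖f i‖ₑ ≤ A) (hB : ∑' i, ‖f i‖ₑ ≤ B) :
    eLpNorm f p Measure.count ≤ A ^ (1 - 1 / p.toReal) * B ^ (1 / p.toReal) := by
  rcases eq_or_ne p ∞ with rfl | hpt
  · simp only [eLpNorm_exponent_top, ENNReal.toReal_top, div_zero, sub_zero, ENNReal.rpow_one,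
      ENNReal.rpow_zero, mul_one]
    exact eLpNormEssSup_le_of_ae_enorm_bound (Eventually.of_forall hA)
  have hp0 : p ≠ 0 := (zero_lt_one.trans_le hp).ne'
  have hp1 : 1 ≤ p.toReal := by
    rw [← ENNReal.toReal_one]; exact ENNReal.toReal_mono hpt hp
  rw [eLpNorm_eq_lintegral_rpow_enorm_toReal hp0 hpt, lintegral_count]
  calc (∑' i, ‖f i‖ₑ ^ p.toReal) ^ (1 / p.toReal)
      ≤ (A ^ (p.toReal - 1) * B) ^ (1 / p.toReal) := by
        refine ENNReal.rpow_le_rpow ?_ (by positivity)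
        calc ∑' i, ‖f i‖ₑ ^ p.toReal ≤ ∑' i, A ^ (p.toReal - 1) * ‖f i‖ₑ := by
              refine ENNReal.tsum_le_tsum fun i => ?_
              have : ‖f i‖ₑ ^ p.toReal = ‖f i‖ₑ ^ (p.toReal - 1) * ‖f i‖ₑ := by
                conv_rhs => rw [← ENNReal.rpow_one ‖f i‖ₑ, ← ENNReal.rpow_mul, one_mul]
                rw [← ENNReal.rpow_add_of_nonneg _ _ (by linarith) zero_le_one, sub_add_cancel]
              rw [this]
              gcongr
              exact hA i
          _ = A ^ (p.toReal - 1) * ∑' i, ‖f i‖ₑ := ENNReal.tsum_mul_left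
          _ ≤ _ := by gcongr
    _ = _ := by
        rw [ENNReal.mul_rpow_of_nonneg _ _ (by positivity), ← ENNReal.rpow_mul]
        congr 2
        field_simp

lemma eLpNorm_count_le_tsum {ι : Type*} [MeasurableSpace ι] [MeasurableSingletonClass ι]
    {f : ι → ℝ≥0∞} {p : ℝ≥0∞} (hp : 1 ≤ p) :
    eLpNorm f p Measure.count ≤ ∑' i, f i := by
  have h := eLpNorm_count_le (f := f) hp (fun i => ENNReal.le_tsum i) le_rfl
  simp only [enorm_eq_self] at h
  refine h.trans (le_of_eq ?_)
  rcases eq_or_ne p ∞ with rfl | hpt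
  · simp
  have hp1 : 1 ≤ p.toReal := by
    rw [← ENNReal.toReal_one]; exact ENNReal.toReal_mono hpt hp
  have : 1 / p.toReal ≤ 1 := by rw [div_le_one (by linarith)]; exact hp1
  rw [← ENNReal.rpow_add_of_nonneg _ _ (by linarith) (by positivity), sub_add_cancel,
    ENNReal.rpow_one]

lemma eLpNorm_count_le_ofReal {c : ℤ → ℝ} {p : ℝ≥0∞} (hp : 1 ≤ p) {A B : ℝ}
    (hA : ∀ k, |c k| ≤ A) (hB : ∀ F : Finset ℤ, ∑ k ∈ F, |c k| ≤ B) :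
    eLpNorm c p Measure.count ≤ ENNReal.ofReal (A ^ (1 - 1 / p.toReal) * B ^ (1 / p.toReal)) := by
  have hA0 : 0 ≤ A := (abs_nonneg _).trans (hA 0)
  have hB0 : 0 ≤ B := by simpa using hB ∅
  have hP : 1 / p.toReal ≤ 1 := by
    rcases eq_or_ne p ∞ with rfl | hpt
    · simp
    have hp1 : 1 ≤ p.toReal := by
      rw [← ENNReal.toReal_one]; exact ENNReal.toReal_mono hpt hp
    rw [div_le_one (by linarith)]; exact hp1
  rw [ENNReal.ofReal_mul (by positivity), ← ENNReal.ofReal_rpow_of_nonneg hA0 (by linarith),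
    ← ENNReal.ofReal_rpow_of_nonneg hB0 (by positivity)]
  have he : ∀ k, ‖c k‖ₑ = ENNReal.ofReal |c k| := fun k => Real.enorm_eq_ofReal_abs _
  refine eLpNorm_count_le hp (fun k => ?_) ?_
  · rw [he]; exact ENNReal.ofReal_le_ofReal (hA k)
  · rw [ENNReal.tsum_eq_iSup_sum]
    refine iSup_le fun F => ?_
    simp only [he]
    rw [← ENNReal.ofReal_sum_of_nonneg fun _ _ => abs_nonneg _]
    exact ENNReal.ofReal_le_ofReal (hB F)

lemma one_div_toReal_le_one {p : ℝ≥0∞} (hp : 1 ≤ p) : 1 / p.toReal ≤ 1 := by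
  rcases eq_or_ne p ∞ with rfl | hpt
  · simp
  have hp1 : 1 ≤ p.toReal := by
    rw [← ENNReal.toReal_one]; exact ENNReal.toReal_mono hpt hp
  rw [div_le_one (by linarith)]; exact hp1

lemma waveletCoeff_comp_mul (g h : ℝ → ℝ) (J j : ℕ) (k : ℤ) :
    waveletCoeff g (fun x => h (2 ^ J * x)) j k =
      (2 : ℝ) ^ ((j : ℝ) / 2) * (2 ^ J)⁻¹ * ∫ x, h x * g (2 ^ j * (2 ^ J)⁻¹ * x - k) := by
  have hJ : (0 : ℝ) < 2 ^ J := by positivity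
  have h1 := Measure.integral_comp_mul_left
    (fun x => h x * g (2 ^ j * (2 ^ J)⁻¹ * x - k)) ((2 : ℝ) ^ J)
  rw [abs_of_pos (inv_pos.2 hJ), smul_eq_mul] at h1
  rw [mul_assoc, ← h1, ← integral_const_mul]
  simp only [waveletCoeff, dilate, zpow_natCast, Int.cast_natCast]
  refine integral_congr_ae (Eventually.of_forall fun x => ?_)
  simp only
  rw [mul_assoc (2 ^ j) _ (2 ^ J * x), inv_mul_cancel_left₀ hJ.ne']
  ring

/-- The uniform and the summed bound are interpolated. The power of two collects the normalisation
`2^(j/2)` and the Jacobian of the dilation; `w` carries the decay in the level difference. -/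
lemma eLpNorm_waveletCoeff_comp_mul_le {g h : ℝ → ℝ} {p : ℝ≥0∞} (hp : 1 ≤ p) {J j : ℕ}
    {C G₁ G w : ℝ} (hC : 0 ≤ C) (hG₁ : 0 ≤ G₁) (hG : 0 ≤ G) (hw : 0 ≤ w)
    (h1 : ∀ k : ℤ, |∫ x, h x * g (2 ^ j * (2 ^ J)⁻¹ * x - k)| ≤
      C * G * (2 ^ j * (2 ^ J)⁻¹)⁻¹ * w)
    (h2 : ∀ F : Finset ℤ, ∑ k ∈ F, |∫ x, h x * g (2 ^ j * (2 ^ J)⁻¹ * x - k)| ≤ C * G₁ * w) :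
    eLpNorm (fun k : ℤ => waveletCoeff g (fun x => h (2 ^ J * x)) j k) p Measure.count ≤
      ENNReal.ofReal (C * (G ^ (1 - 1 / p.toReal) * G₁ ^ (1 / p.toReal)) *
        ((2 : ℝ) ^ ((j : ℝ) * (1 / p.toReal - 1 / 2) - J * (1 / p.toReal)) * w)) := by
  set P := 1 / p.toReal
  have hP1 : P ≤ 1 := one_div_toReal_le_one hp
  have hP0 : 0 ≤ P := by positivity
  have ht : (0 : ℝ) < (2 : ℝ) ^ ((j : ℝ) / 2) * (2 ^ J)⁻¹ := by positivity
  refine (eLpNorm_count_le_ofReal hp (A := (2 : ℝ) ^ ((j : ℝ) / 2) * (2 ^ J)⁻¹ *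
    (C * G * (2 ^ j * (2 ^ J)⁻¹)⁻¹ * w)) (B := (2 : ℝ) ^ ((j : ℝ) / 2) * (2 ^ J)⁻¹ *
    (C * G₁ * w)) (fun k => ?_) (fun F => ?_)).trans (le_of_eq ?_)
  · rw [waveletCoeff_comp_mul, abs_mul, abs_of_pos ht]
    exact mul_le_mul_of_nonneg_left (h1 k) ht.le
  · simp only [waveletCoeff_comp_mul, abs_mul, abs_of_pos ht]
    rw [← Finset.mul_sum]
    exact mul_le_mul_of_nonneg_left (h2 F) ht.le
  · congr 1
    have e1 : (2 : ℝ) ^ ((j : ℝ) / 2) * (2 ^ J)⁻¹ * (C * G * (2 ^ j * (2 ^ J)⁻¹)⁻¹ * w) =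
        (C * w) * G * (2 : ℝ) ^ (-(j : ℝ) / 2) := by
      rw [mul_inv, inv_inv]
      have : (2 : ℝ) ^ (-(j : ℝ) / 2) = (2 : ℝ) ^ ((j : ℝ) / 2) * (2 ^ j)⁻¹ := by
        rw [← Real.rpow_natCast, ← Real.rpow_neg two_pos.le, ← Real.rpow_add two_pos]
        congr 1; ring
      rw [this]
      field_simp
    have e2 : (2 : ℝ) ^ ((j : ℝ) / 2) * (2 ^ J)⁻¹ * (C * G₁ * w) =
        (C * w) * G₁ * (2 : ℝ) ^ ((j : ℝ) / 2 - J) := by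
      rw [← Real.rpow_natCast 2 J, ← Real.rpow_neg two_pos.le, Real.rpow_sub two_pos,
        Real.rpow_neg two_pos.le]
      ring
    rw [e1, e2, Real.mul_rpow (x := C * w * G) (by positivity) (by positivity),
      Real.mul_rpow (x := C * w) (y := G) (by positivity) hG,
      Real.mul_rpow (x := C * w * G₁) (by positivity) (by positivity),
      Real.mul_rpow (x := C * w) (y := G₁) (by positivity) hG₁, ← Real.rpow_mul two_pos.le,
      ← Real.rpow_mul two_pos.le]
    have e3 : (C * w) ^ (1 - P) * (C * w) ^ P = C * w := by
      rw [← Real.rpow_add_of_nonneg (by positivity) (by linarith) hP0, sub_add_cancel,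
        Real.rpow_one]
    have e4 : (2 : ℝ) ^ (-(j : ℝ) / 2 * (1 - P)) * (2 : ℝ) ^ (((j : ℝ) / 2 - J) * P) =
        (2 : ℝ) ^ ((j : ℝ) * (P - 1 / 2) - J * P) := by
      rw [← Real.rpow_add two_pos]; congr 1; ring
    calc _ = ((C * w) ^ (1 - P) * (C * w) ^ P) * (G ^ (1 - P) * G₁ ^ P) *
          ((2 : ℝ) ^ (-(j : ℝ) / 2 * (1 - P)) * (2 : ℝ) ^ (((j : ℝ) / 2 - J) * P)) := by ring
      _ = _ := by rw [e3, e4]; ring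

/-- Bernstein type bound: the Besov functional of a dilated test function. -/
lemma exists_besovJ_comp_mul_le {N : ℕ} {φ ψ : ℝ → ℝ} (hφ : IsFatherWavelet N φ)
    (hψ : IsMotherWavelet N φ ψ) {s : ℝ} (hs : 0 < s) (hsN : s < (N : ℝ) + 1) {p q : ℝ≥0∞}
    (hp : 1 ≤ p) (hq : 1 ≤ q) :
    ∃ C : ℝ, 0 ≤ C ∧ ∃ d : ℕ, ∀ h G₁ G, SmoothBounds d h G₁ G → ∀ J : ℕ,
      besovJ φ ψ s p q (fun x => h (2 ^ J * x)) ≤ ENNReal.ofReal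
        (C * (G ^ (1 - 1 / p.toReal) * G₁ ^ (1 / p.toReal)) *
          (2 : ℝ) ^ ((J : ℝ) * (s - 1 / p.toReal))) := by
  have hφi := hφ.decay.integrable hφ.mra.1.1.1
  have hψi := hψ.decay.integrable hψ.orthonormal.1.1
  obtain ⟨Cφ, hCφ0, hCφ, hsumφ⟩ := hφ.decay.exists_bound
  obtain ⟨Cψ, hCψ0, hCψ, hsumψ⟩ := hψ.decay.exists_bound
  obtain ⟨C₀, hC₀, d, hdec⟩ := exists_coeff_decay hφ hψ
  set P := 1 / p.toReal with hP
  have hIφ : 0 ≤ ∫ x, |φ x| := integral_nonneg fun _ => abs_nonneg _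
  have hIψ : 0 ≤ ∫ x, |ψ x| := integral_nonneg fun _ => abs_nonneg _
  set Cf := (∫ x, |φ x|) + Cφ
  set Cm := (∫ x, |ψ x|) + Cψ + C₀
  have hCf : 0 ≤ Cf := by positivity
  have hCm : 0 ≤ Cm := by positivity
  set Q : ℝ := (2 ^ (N + 1))⁻¹ with hQ
  have hQ0 : 0 < Q := by positivity
  set t : ℝ := (2 : ℝ) ^ s * Q with ht
  have ht0 : 0 < t := by positivity
  have ht1 : t < 1 := by
    rw [ht, hQ, ← Real.rpow_natCast, ← Real.rpow_neg two_pos.le, ← Real.rpow_add two_pos]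
    exact Real.rpow_lt_one_of_one_lt_of_neg one_lt_two (by push_cast; linarith)
  set t' : ℝ := (2 : ℝ) ^ (-s) with ht'
  have ht'0 : 0 < t' := by positivity
  have ht'1 : t' < 1 := Real.rpow_lt_one_of_one_lt_of_neg one_lt_two (by linarith)
  set K := (1 - t')⁻¹ + (1 - t)⁻¹
  have hK : 0 ≤ K := add_nonneg (inv_nonneg.2 (by linarith)) (inv_nonneg.2 (by linarith))
  refine ⟨Cf + Cm * K, by positivity, d, ?_⟩
  intro h G₁ G hG J
  have hG0 := hG.sup_nonneg
  have hG10 := hG.integral_nonneg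
  set 𝒢 := G ^ (1 - P) * G₁ ^ P
  have h𝒢 : 0 ≤ 𝒢 := by positivity
  have hJ : (0 : ℝ) < 2 ^ J := by positivity
  have hfather : eLpNorm (fun k : ℤ => waveletCoeff φ (fun x => h (2 ^ J * x)) 0 k) p
      Measure.count ≤ ENNReal.ofReal (Cf * 𝒢 * (2 : ℝ) ^ ((J : ℝ) * (s - P))) := by
    have h1 := eLpNorm_waveletCoeff_comp_mul_le (g := φ) (h := h) hp (J := J) (j := 0) (C := Cf)
      (w := 1) hCf hG10 hG0 zero_le_one (fun k => ?_) (fun F => ?_)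
    · refine h1.trans (ENNReal.ofReal_le_ofReal ?_)
      refine mul_le_mul_of_nonneg_left ?_ (by positivity)
      rw [mul_one]
      refine Real.rpow_le_rpow_of_exponent_le one_le_two ?_
      have : 0 ≤ (J : ℝ) * s := by positivity
      push_cast
      linarith
    · refine (abs_integral_mul_dilate_le hφi hG.abs_le (by positivity) _).trans ?_
      rw [mul_one]
      have : 0 ≤ Cφ * (G * (2 ^ 0 * (2 ^ J)⁻¹)⁻¹) := by positivity
      simp only [Cf]
      linarith
    · refine (sum_abs_integral_mul_le hG.integrable hφ.mra.1.1.1 hCφ hsumφ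
        (by positivity) F).trans ?_
      have h2 := mul_le_mul_of_nonneg_left hG.integral_abs_le hCφ0
      have : 0 ≤ (∫ x, |φ x|) * G₁ := by positivity
      simp only [Cf]
      linarith
  -- After factoring out `2^(J(s - P))`, level `j` contributes `2^(-s(J - j))` below `J` by trivial
  -- bounds, and `(2^s 2^(-(N+1)))^(j - J)` above it by coefficient decay. Both geometric series
  -- converge because `0 < s < N + 1`, and the `ℓ^q` norm is at most their sum.
  set b : ℕ → ℝ := fun j => if j < J then t' ^ (J - j) else t ^ (j - J)
  have hmother : ∀ j : ℕ, ENNReal.ofReal ((2 : ℝ) ^ ((j : ℝ) * (s + 1 / 2 - P))) *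
      eLpNorm (fun k : ℤ => waveletCoeff ψ (fun x => h (2 ^ J * x)) j k) p Measure.count ≤
      ENNReal.ofReal (Cm * 𝒢 * (2 : ℝ) ^ ((J : ℝ) * (s - P))) * ENNReal.ofReal (b j) := by
    intro j
    have hj : (0 : ℝ) < 2 ^ j := by positivity
    have h1 := eLpNorm_waveletCoeff_comp_mul_le (g := ψ) (h := h) hp (J := J) (j := j) (C := Cm)
      (w := Q ^ (j - J)) hCm hG10 hG0 (by positivity) (fun k => ?_) (fun F => ?_)
    · refine (mul_le_mul_right h1 _).trans ?_
      rw [← ENNReal.ofReal_mul (by positivity), ← ENNReal.ofReal_mul (by positivity)]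
      refine ENNReal.ofReal_le_ofReal (le_of_eq ?_)
      rw [← hP]
      have e1 : (2 : ℝ) ^ ((j : ℝ) * (s + 1 / 2 - P)) *
          ((2 : ℝ) ^ ((j : ℝ) * (P - 1 / 2) - J * P) * Q ^ (j - J)) =
          (2 : ℝ) ^ ((J : ℝ) * (s - P)) * b j := by
        rw [← mul_assoc, ← Real.rpow_add two_pos]
        have e2 : (2 : ℝ) ^ ((j : ℝ) * (s + 1 / 2 - P) + ((j : ℝ) * (P - 1 / 2) - J * P)) =
            (2 : ℝ) ^ ((J : ℝ) * (s - P)) * (2 : ℝ) ^ (((j : ℝ) - J) * s) := by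
          rw [← Real.rpow_add two_pos]; congr 1; ring
        rw [e2, mul_assoc]
        congr 1
        simp only [b]
        split_ifs with hjJ
        · rw [Nat.sub_eq_zero_of_le hjJ.le, pow_zero, mul_one, ht', ← Real.rpow_natCast,
            ← Real.rpow_mul two_pos.le, Nat.cast_sub hjJ.le]
          congr 1; ring
        · rw [ht, mul_pow, ← Real.rpow_natCast ((2 : ℝ) ^ s), ← Real.rpow_mul two_pos.le,
            Nat.cast_sub (not_lt.1 hjJ), mul_comm s]
      calc _ = Cm * 𝒢 * ((2 : ℝ) ^ ((j : ℝ) * (s + 1 / 2 - P)) *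
          ((2 : ℝ) ^ ((j : ℝ) * (P - 1 / 2) - J * P) * Q ^ (j - J))) := by ring
        _ = _ := by rw [e1]; ring
    · by_cases hjJ : j < J
      · refine (abs_integral_mul_dilate_le hψi hG.abs_le (by positivity) _).trans ?_
        rw [Nat.sub_eq_zero_of_le hjJ.le, pow_zero, mul_one]
        have : 0 ≤ (Cψ + C₀) * (G * (2 ^ j * (2 ^ J)⁻¹)⁻¹) := by positivity
        simp only [Cm]
        linarith
      · have e : (2 : ℝ) ^ j * (2 ^ J)⁻¹ = 2 ^ (j - J) := by
          rw [pow_sub₀ _ two_ne_zero (not_lt.1 hjJ)]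
        rw [e]
        refine ((hdec h G₁ G hG (j - J)).1 k).trans ?_
        have : 0 ≤ ((∫ x, |ψ x|) + Cψ) * (G * (2 ^ (j - J))⁻¹ * Q ^ (j - J)) := by positivity
        simp only [Cm]
        linarith
    · by_cases hjJ : j < J
      · refine (sum_abs_integral_mul_le hG.integrable hψ.orthonormal.1.1 hCψ hsumψ
          (by positivity) F).trans ?_
        rw [Nat.sub_eq_zero_of_le hjJ.le, pow_zero, mul_one]
        have h2 := mul_le_mul_of_nonneg_left hG.integral_abs_le hCψ0
        have : 0 ≤ ((∫ x, |ψ x|) + C₀) * G₁ := by positivity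
        simp only [Cm]
        linarith
      · have e : (2 : ℝ) ^ j * (2 ^ J)⁻¹ = 2 ^ (j - J) := by
          rw [pow_sub₀ _ two_ne_zero (not_lt.1 hjJ)]
        rw [e]
        refine ((hdec h G₁ G hG (j - J)).2 F).trans ?_
        have : 0 ≤ ((∫ x, |ψ x|) + Cψ) * (G₁ * Q ^ (j - J)) := by positivity
        simp only [Cm]
        linarith
  have hb : ∑' j, ENNReal.ofReal (b j) ≤ ENNReal.ofReal K := by
    have hgeo : ∀ u : ℝ, 0 < u → u < 1 → ∀ F : Finset ℕ, ∑ i ∈ F, u ^ i ≤ (1 - u)⁻¹ := by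
      intro u hu0 hu1 F
      rw [← tsum_geometric_of_lt_one hu0.le hu1]
      exact (summable_geometric_of_lt_one hu0.le hu1).sum_le_tsum F fun i _ => by positivity
    have hb0 : ∀ j, 0 ≤ b j := fun j => by simp only [b]; split_ifs <;> positivity
    rw [ENNReal.tsum_eq_iSup_sum]
    refine iSup_le fun F => ?_
    rw [← ENNReal.ofReal_sum_of_nonneg fun j _ => hb0 j]
    refine ENNReal.ofReal_le_ofReal ?_
    rw [← Finset.sum_filter_add_sum_filter_not F (fun j => j < J)]
    refine add_le_add ?_ ?_
    · have h1 : ∑ j ∈ F.filter (fun j => j < J), b j =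
          ∑ i ∈ (F.filter (fun j => j < J)).image (fun j => J - j), t' ^ i := by
        rw [Finset.sum_image]
        · refine Finset.sum_congr rfl fun j hj => ?_
          simp only [b, (Finset.mem_filter.1 hj).2, if_true]
        · intro x hx y hy hxy
          have h1 := (Finset.mem_filter.1 hx).2
          have h2 := (Finset.mem_filter.1 hy).2
          simp only at hxy
          omega
      rw [h1]
      exact hgeo t' ht'0 ht'1 _
    · have h1 : ∑ j ∈ F.filter (fun j => ¬ j < J), b j =
          ∑ i ∈ (F.filter (fun j => ¬ j < J)).image (fun j => j - J), t ^ i := by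
        rw [Finset.sum_image]
        · refine Finset.sum_congr rfl fun j hj => ?_
          simp only [b, (Finset.mem_filter.1 hj).2, if_false]
        · intro x hx y hy hxy
          have h1 := (Finset.mem_filter.1 hx).2
          have h2 := (Finset.mem_filter.1 hy).2
          simp only at hxy
          omega
      rw [h1]
      exact hgeo t ht0 ht1 _
  have hsum := (eLpNorm_count_le_tsum (f := fun j : ℕ =>
    ENNReal.ofReal ((2 : ℝ) ^ ((j : ℝ) * (s + 1 / 2 - P))) *
      eLpNorm (fun k : ℤ => waveletCoeff ψ (fun x => h (2 ^ J * x)) j k) p Measure.count) hq).trans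
    ((ENNReal.tsum_le_tsum hmother).trans
      (ENNReal.tsum_mul_left.trans_le (mul_le_mul_right hb _)))
  refine (add_le_add hfather hsum).trans ?_
  rw [← ENNReal.ofReal_mul (by positivity), ← ENNReal.ofReal_add (by positivity) (by positivity)]
  refine ENNReal.ofReal_le_ofReal (le_of_eq ?_)
  ring

/-! ### Laws of the private views. -/

/-- `f` is a probability density on the line. -/
structure IsDensity (f : ℝ → ℝ) : Prop where
  measurable : Measurable f
  nonneg : ∀ x, 0 ≤ f x
  integrable : Integrable f
  integral_eq : ∫ x, f x = 1

/-- The measure with density `f`. -/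
def densityMeasure (f : ℝ → ℝ) : Measure ℝ := volume.withDensity fun x => ENNReal.ofReal (f x)

lemma IsDensity.isProbabilityMeasure {f : ℝ → ℝ} (hf : IsDensity f) :
    IsProbabilityMeasure (densityMeasure f) := by
  refine ⟨?_⟩
  rw [densityMeasure, withDensity_apply _ MeasurableSet.univ, setLIntegral_univ,
    ← ofReal_integral_eq_lintegral_ofReal hf.integrable (Eventually.of_forall hf.nonneg),
    hf.integral_eq, ENNReal.ofReal_one]

lemma lintegral_densityMeasure {f : ℝ → ℝ} (hf : Measurable f) {u : ℝ → ℝ≥0∞}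
    (hu : Measurable u) :
    ∫⁻ x, u x ∂densityMeasure f = ∫⁻ x, ENNReal.ofReal (f x) * u x := by
  rw [densityMeasure, lintegral_withDensity_eq_lintegral_mul _ (by fun_prop) hu]
  rfl

section Chain

variable {𝒵 : Type u} [MeasurableSpace 𝒵]

lemma measurable_snoc (n : ℕ) : Measurable fun y : (Fin n → 𝒵) × 𝒵 =>
    (Fin.snoc (α := fun _ => 𝒵) y.1 y.2 : Fin (n + 1) → 𝒵) := by
  refine measurable_pi_iff.2 fun i => ?_
  refine Fin.lastCases ?_ (fun i => ?_) i
  · simpa using measurable_snd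
  · simp only [Fin.snoc_castSucc]
    exact (measurable_pi_apply i).comp measurable_fst

lemma isMarkovKernel_channel {Q : Mechanism 𝒵} (hQ : ∀ i, IsMarkovKernel (Q i)) (n : ℕ) :
    IsMarkovKernel (channel Q n) := by
  induction n with
  | zero => unfold channel; infer_instance
  | succ n ih =>
    have := hQ n
    unfold channel
    exact Kernel.IsMarkovKernel.map _ (measurable_snoc n)

lemma isProbabilityMeasure_privateLaw {Q : Mechanism 𝒵} (hQ : ∀ i, IsMarkovKernel (Q i)) (n : ℕ)
    {f : ℝ → ℝ} (hf : IsDensity f) : IsProbabilityMeasure (privateLaw Q n f) := by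
  have := isMarkovKernel_channel hQ n
  have : IsProbabilityMeasure (volume.withDensity fun x => ENNReal.ofReal (f x)) :=
    hf.isProbabilityMeasure
  unfold privateLaw
  infer_instance

lemma lintegral_channel_succ {Q : Mechanism 𝒵} (hQ : ∀ i, IsMarkovKernel (Q i)) (n : ℕ)
    (x : Fin (n + 1) → ℝ) {u : (Fin (n + 1) → 𝒵) → ℝ≥0∞} (hu : Measurable u) :
    ∫⁻ z, u z ∂channel Q (n + 1) x = ∫⁻ z, ∫⁻ z', u (Fin.snoc (α := fun _ => 𝒵) z z')
      ∂Q n (x (Fin.last n), z) ∂channel Q n (fun i => x i.castSucc) := by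
  have := isMarkovKernel_channel hQ n
  have := hQ n
  conv_lhs => unfold channel
  rw [Kernel.lintegral_map _ (measurable_snoc n) _ hu,
    Kernel.lintegral_compProd _ _ _
      (f := fun y => u (Fin.snoc (α := fun _ => 𝒵) y.1 y.2)) (hu.comp (measurable_snoc n)),
    Kernel.lintegral_comap]
  simp only [Kernel.lintegral_comap]

/-- The law of the next private view given the preceding ones. -/
def viewLaw (Q : Mechanism 𝒵) (n : ℕ) (f : ℝ → ℝ) (z : Fin n → 𝒵) : Measure 𝒵 :=
  (densityMeasure f).bind fun x => Q n (x, z)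

lemma lintegral_viewLaw (Q : Mechanism 𝒵) (n : ℕ) (f : ℝ → ℝ) (z : Fin n → 𝒵) {u : 𝒵 → ℝ≥0∞}
    (hu : Measurable u) :
    ∫⁻ z', u z' ∂viewLaw Q n f z = ∫⁻ x, ∫⁻ z', u z' ∂Q n (x, z) ∂densityMeasure f :=
  Measure.lintegral_bind
    ((Kernel.measurable (Q n)).comp (by fun_prop : Measurable fun x : ℝ => (x, z))).aemeasurable
    hu.aemeasurable

lemma isProbabilityMeasure_viewLaw {Q : Mechanism 𝒵} (hQ : ∀ i, IsMarkovKernel (Q i)) (n : ℕ)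
    {f : ℝ → ℝ} (hf : IsDensity f) (z : Fin n → 𝒵) : IsProbabilityMeasure (viewLaw Q n f z) := by
  have := hQ n
  have := hf.isProbabilityMeasure
  exact isProbabilityMeasure_bind
    ((Kernel.measurable (Q n)).comp (by fun_prop : Measurable fun x : ℝ => (x, z))).aemeasurable
    (Eventually.of_forall fun x => inferInstance)

lemma measurable_lintegral_mechanism {Q : Mechanism 𝒵} (hQ : ∀ i, IsMarkovKernel (Q i)) (n : ℕ)
    {u : (Fin (n + 1) → 𝒵) → ℝ≥0∞} (hu : Measurable u) :
    Measurable fun y : ℝ × (Fin n → 𝒵) =>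
      ∫⁻ z', u (Fin.snoc (α := fun _ => 𝒵) y.2 z') ∂Q n y := by
  have := hQ n
  refine Measurable.lintegral_kernel_prod_right (κ := Q n)
    (f := fun (y : ℝ × (Fin n → 𝒵)) z' => u (Fin.snoc (α := fun _ => 𝒵) y.2 z')) ?_
  exact hu.comp ((measurable_snoc n).comp
    (by fun_prop : Measurable fun p : (ℝ × (Fin n → 𝒵)) × 𝒵 => (p.1.2, p.2)))

lemma lintegral_privateLaw (Q : Mechanism 𝒵) (n : ℕ) (f : ℝ → ℝ)
    {u : (Fin n → 𝒵) → ℝ≥0∞} (hu : Measurable u) :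
    ∫⁻ z, u z ∂privateLaw Q n f =
      ∫⁻ x, ∫⁻ z, u z ∂channel Q n x ∂(Measure.pi fun _ : Fin n => densityMeasure f) :=
  Measure.lintegral_bind (Kernel.measurable _).aemeasurable hu.aemeasurable

/-- The private views are generated successively, each from its conditional law. -/
lemma lintegral_privateLaw_succ {Q : Mechanism 𝒵} (hQ : ∀ i, IsMarkovKernel (Q i)) (n : ℕ)
    {f : ℝ → ℝ} (hf : IsDensity f) {u : (Fin (n + 1) → 𝒵) → ℝ≥0∞} (hu : Measurable u) :
    ∫⁻ z, u z ∂privateLaw Q (n + 1) f =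
      ∫⁻ z, ∫⁻ z', u (Fin.snoc (α := fun _ => 𝒵) z z') ∂viewLaw Q n f z ∂privateLaw Q n f := by
  have hprob := hf.isProbabilityMeasure
  have hmark := isMarkovKernel_channel hQ n
  have hm := measurable_lintegral_mechanism hQ n hu
  have hsnoc : ∀ z : Fin n → 𝒵,
      Measurable fun z' => u (Fin.snoc (α := fun _ => 𝒵) z z') := fun z =>
    hu.comp ((measurable_snoc n).comp (by fun_prop : Measurable fun z' : 𝒵 => (z, z')))
  have hm2 : Measurable fun z : Fin n → 𝒵 => ∫⁻ x, ∫⁻ z', u (Fin.snoc (α := fun _ => 𝒵) z z')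
      ∂Q n (x, z) ∂densityMeasure f := by
    refine Measurable.lintegral_prod_left' (f := fun y : ℝ × (Fin n → 𝒵) =>
      ∫⁻ z', u (Fin.snoc (α := fun _ => 𝒵) y.2 z') ∂Q n y) hm
  simp only [lintegral_viewLaw Q n f _ (hsnoc _)]
  rw [lintegral_privateLaw _ _ _ hu, lintegral_privateLaw _ _ _ hm2]
  simp only [lintegral_channel_succ hQ n _ hu]
  -- The last datum is independent of the earlier ones; splitting it off and integrating it out
  -- turns the kernel `Q n` into `viewLaw`.
  have hmp := measurePreserving_piFinSuccAbove (fun _ : Fin (n + 1) => densityMeasure f)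
    (Fin.last n)
  set g : ℝ × (Fin n → ℝ) → ℝ≥0∞ := fun p => ∫⁻ z, ∫⁻ z', u (Fin.snoc (α := fun _ => 𝒵) z z')
    ∂Q n (p.1, z) ∂channel Q n p.2 with hg
  have hgm : Measurable g := by
    refine Measurable.lintegral_kernel_prod_right
      (κ := (channel Q n).comap (fun p : ℝ × (Fin n → ℝ) => p.2) measurable_snd)
      (f := fun (p : ℝ × (Fin n → ℝ)) z => ∫⁻ z', u (Fin.snoc (α := fun _ => 𝒵) z z')
        ∂Q n (p.1, z)) ?_
    exact hm.comp (by fun_prop :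
      Measurable fun q : (ℝ × (Fin n → ℝ)) × (Fin n → 𝒵) => (q.1.1, q.2))
  have h1 : ∀ x : Fin (n + 1) → ℝ, (∫⁻ z, ∫⁻ z', u (Fin.snoc (α := fun _ => 𝒵) z z')
      ∂Q n (x (Fin.last n), z) ∂channel Q n (fun i => x i.castSucc)) =
      g (MeasurableEquiv.piFinSuccAbove (fun _ => ℝ) (Fin.last n) x) := by
    intro x
    simp only [hg, MeasurableEquiv.piFinSuccAbove_apply, Fin.insertNthEquiv_symm_apply]
    congr 2
    ext i
    simp [Fin.removeNth]
  simp only [h1]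
  rw [hmp.lintegral_comp hgm, lintegral_prod_symm _ hgm.aemeasurable]
  refine lintegral_congr fun y => ?_
  simp only [hg]
  exact lintegral_lintegral_swap (f := fun x z =>
    ∫⁻ z', u (Fin.snoc (α := fun _ => 𝒵) z z') ∂Q n (x, z)) hm.aemeasurable

end Chain

/-! ### Information in private views. -/

lemma sq_lintegral_mul_le {α : Type*} [MeasurableSpace α] {μ : Measure α} {a b : α → ℝ≥0∞}
    (ha : Measurable a) (hb : Measurable b) :
    (∫⁻ x, a x * b x ∂μ) ^ 2 ≤ (∫⁻ x, a x ^ 2 ∂μ) * ∫⁻ x, b x ^ 2 ∂μ := by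
  have h := ENNReal.lintegral_mul_le_Lp_mul_Lq μ Real.HolderConjugate.two_two ha.aemeasurable
    hb.aemeasurable
  calc (∫⁻ x, a x * b x ∂μ) ^ 2 ≤ ((∫⁻ x, a x ^ (2 : ℝ) ∂μ) ^ (1 / (2 : ℝ)) *
        (∫⁻ x, b x ^ (2 : ℝ) ∂μ) ^ (1 / (2 : ℝ))) ^ 2 := pow_le_pow_left' h 2
    _ = _ := by
        rw [mul_pow, ← ENNReal.rpow_natCast, ← ENNReal.rpow_mul, ← ENNReal.rpow_natCast,
          ← ENNReal.rpow_mul]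
        norm_num

lemma sq_lintegral_le {α : Type*} [MeasurableSpace α] {μ : Measure α} [IsProbabilityMeasure μ]
    {a : α → ℝ≥0∞} (ha : Measurable a) : (∫⁻ x, a x ∂μ) ^ 2 ≤ ∫⁻ x, a x ^ 2 ∂μ := by
  simpa using sq_lintegral_mul_le (μ := μ) ha (measurable_const (a := (1 : ℝ≥0∞)))

/-- `χ²`-type domination of measures in dual form. -/
def SqDominated {α : Type*} [MeasurableSpace α] (Λ : ℝ≥0∞) (P P' : Measure α) : Prop :=
  ∀ u : α → ℝ≥0∞, Measurable u → (∫⁻ x, u x ∂P) ^ 2 ≤ Λ * ∫⁻ x, u x ^ 2 ∂P'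

lemma SqDominated.measure_sq_le {α : Type*} [MeasurableSpace α] {Λ : ℝ≥0∞} {P P' : Measure α}
    (h : SqDominated Λ P P') {A : Set α} (hA : MeasurableSet A) : P A ^ 2 ≤ Λ * P' A := by
  have h1 := h (A.indicator 1) (measurable_one.indicator hA)
  rw [lintegral_indicator_one hA] at h1
  have h2 : ∀ x, (A.indicator (1 : α → ℝ≥0∞) x) ^ 2 = A.indicator 1 x := fun x => by
    by_cases hx : x ∈ A <;> simp [hx]
  simp only [h2] at h1
  rwa [lintegral_indicator_one hA] at h1

/-- Tensorization over the successive private views. -/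
lemma sqDominated_privateLaw {𝒵 : Type u} [MeasurableSpace 𝒵] {Q : Mechanism 𝒵}
    (hQ : ∀ i, IsMarkovKernel (Q i)) {f g : ℝ → ℝ} (hf : IsDensity f) (hg : IsDensity g)
    {Λ : ℝ≥0∞} (h : ∀ n z, SqDominated Λ (viewLaw Q n f z) (viewLaw Q n g z)) (n : ℕ) :
    SqDominated (Λ ^ n) (privateLaw Q n f) (privateLaw Q n g) := by
  induction n with
  | zero =>
    intro u hu
    have h1 : ∀ f' : ℝ → ℝ, IsDensity f' → ∀ w : (Fin 0 → 𝒵) → ℝ≥0∞,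
        ∫⁻ x, w x ∂privateLaw Q 0 f' = w Fin.elim0 := by
      intro f' hf' w
      have := isProbabilityMeasure_privateLaw hQ 0 hf'
      have h2 : ∀ x, w x = w Fin.elim0 := fun x => by congr 1; exact Subsingleton.elim _ _
      simp only [h2, lintegral_const, measure_univ, mul_one]
    rw [h1 f hf, h1 g hg, pow_zero, one_mul]
  | succ n ih =>
    intro u hu
    have hsnoc : ∀ z : Fin n → 𝒵,
        Measurable fun z' => u (Fin.snoc (α := fun _ => 𝒵) z z') := fun z =>
      hu.comp ((measurable_snoc n).comp (by fun_prop : Measurable fun z' : 𝒵 => (z, z')))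
    have hmeas : Measurable fun z : Fin n → 𝒵 =>
        ∫⁻ z', u (Fin.snoc (α := fun _ => 𝒵) z z') ∂viewLaw Q n f z := by
      simp only [lintegral_viewLaw Q n f _ (hsnoc _)]
      have := hf.isProbabilityMeasure
      exact Measurable.lintegral_prod_left' (f := fun y : ℝ × (Fin n → 𝒵) =>
        ∫⁻ z', u (Fin.snoc (α := fun _ => 𝒵) y.2 z') ∂Q n y)
        (measurable_lintegral_mechanism hQ n hu)
    rw [lintegral_privateLaw_succ hQ n hf hu,
      lintegral_privateLaw_succ hQ n hg (hu.pow_const 2)]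
    calc _ ≤ Λ ^ n * ∫⁻ z, (∫⁻ z', u (Fin.snoc (α := fun _ => 𝒵) z z') ∂viewLaw Q n f z) ^ 2
          ∂privateLaw Q n g := ih _ hmeas
      _ ≤ Λ ^ n * ∫⁻ z, Λ * ∫⁻ z', u (Fin.snoc (α := fun _ => 𝒵) z z') ^ 2 ∂viewLaw Q n g z
          ∂privateLaw Q n g := by
          gcongr with z
          exact h n z _ (hsnoc z)
      _ = _ := by
          rw [lintegral_const_mul, pow_succ, mul_assoc]
          have hsnoc2 : ∀ z : Fin n → 𝒵,
              Measurable fun z' => u (Fin.snoc (α := fun _ => 𝒵) z z') ^ 2 := fun z =>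
            (hsnoc z).pow_const 2
          simp only [lintegral_viewLaw Q n g _ (hsnoc2 _)]
          have := hg.isProbabilityMeasure
          exact Measurable.lintegral_prod_left' (f := fun y : ℝ × (Fin n → 𝒵) =>
            ∫⁻ z', u (Fin.snoc (α := fun _ => 𝒵) y.2 z') ^ 2 ∂Q n y)
            (measurable_lintegral_mechanism hQ n (hu.pow_const 2))

lemma add_mul_sq_le {m y θ : ℝ≥0∞} (hm : m ≠ ⊤) (hy : y ≠ ⊤) (hθ : θ ≠ ⊤) :
    (m + θ * y) ^ 2 ≤ (1 + θ ^ 2) * (m ^ 2 + y ^ 2) := by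
  lift m to NNReal using hm
  lift y to NNReal using hy
  lift θ to NNReal using hθ
  norm_cast
  rw [← NNReal.coe_le_coe]
  push_cast
  nlinarith [sq_nonneg ((θ : ℝ) * m - y)]

/-- The sum of the two truncated differences is `|w - m|`, so this expands a square, with every term
on the side where it is nonnegative. -/
lemma tsub_add_tsub_sq_le {m w : ℝ≥0∞} (hm : m ≠ ⊤) :
    ((w - m) + (m - w)) ^ 2 + 2 * m * w ≤ w ^ 2 + m ^ 2 := by
  rcases eq_or_ne w ⊤ with rfl | hw
  · simp
  lift m to NNReal using hm
  lift w to NNReal using hw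
  norm_cast
  rcases le_total w m with h | h
  · rw [tsub_eq_zero_of_le h, zero_add, ← NNReal.coe_le_coe]
    push_cast [NNReal.coe_sub h]
    nlinarith
  · rw [tsub_eq_zero_of_le h, add_zero, ← NNReal.coe_le_coe]
    push_cast [NNReal.coe_sub h]
    nlinarith

/-- Two laws with uniformly close densities: the second moment of the density ratio. -/
lemma sqDominated_of_close {α : Type*} [MeasurableSpace α] {P P' : Measure α}
    [IsProbabilityMeasure P] [IsProbabilityMeasure P'] {θ : ℝ≥0∞} (hθ : θ ≠ ⊤)
    (h1 : ∀ u : α → ℝ≥0∞, Measurable u → ∫⁻ x, u x ∂P ≤ ∫⁻ x, u x ∂P' + θ * ∫⁻ x, u x ∂P')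
    (h2 : ∀ u : α → ℝ≥0∞, Measurable u → ∫⁻ x, u x ∂P' ≤ ∫⁻ x, u x ∂P + θ * ∫⁻ x, u x ∂P') :
    SqDominated (1 + θ ^ 2) P P' := by
  intro u hu
  rcases eq_or_ne (∫⁻ x, u x ^ 2 ∂P') ⊤ with hinf | hfin
  · rw [hinf, ENNReal.mul_top (by simp)]
    exact le_top
  set m := ∫⁻ x, u x ∂P'
  have hm : m ≠ ⊤ := by
    intro hm
    have := sq_lintegral_le (μ := P') hu
    rw [show (∫⁻ x, u x ∂P') = ⊤ from hm] at this
    exact hfin (top_le_iff.1 (by simpa using this))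
  have hPu : ∫⁻ x, u x ∂P ≠ ⊤ :=
    ((h1 u hu).trans_lt (by
      exact ENNReal.add_lt_top.2 ⟨hm.lt_top, ENNReal.mul_lt_top hθ.lt_top hm.lt_top⟩)).ne
  have hum : Measurable fun x => u x - m := hu.sub_const m
  have hmu : Measurable fun x => m - u x := measurable_const.sub hu
  have hadd : ∀ x, u x + (m - u x) = m + (u x - m) := fun x => by
    rw [add_tsub_eq_max, add_tsub_eq_max, max_comm]
  have hint : ∀ ν : Measure α, IsProbabilityMeasure ν →
      ∫⁻ x, u x ∂ν + ∫⁻ x, (m - u x) ∂ν = m + ∫⁻ x, (u x - m) ∂ν := by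
    intro ν hν
    rw [← lintegral_add_left hu]
    simp only [hadd]
    rw [lintegral_add_left measurable_const, lintegral_const, measure_univ, mul_one]
  set v := ∫⁻ x, (u x - m) ∂P'
  have hv : ∫⁻ x, (m - u x) ∂P' = v := (ENNReal.add_right_inj hm).1 (hint P' inferInstance)
  have hvle : v ≤ m := by
    rw [← hv]
    calc ∫⁻ x, (m - u x) ∂P' ≤ ∫⁻ _, m ∂P' := lintegral_mono fun x => tsub_le_self
      _ = m := by simp
  have hvt : v ≠ ⊤ := (hvle.trans_lt hm.lt_top).ne
  have hwle : ∫⁻ x, (m - u x) ∂P ≤ m := by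
    calc ∫⁻ x, (m - u x) ∂P ≤ ∫⁻ _, m ∂P := lintegral_mono fun x => tsub_le_self
      _ = m := by simp
  have hwt : ∫⁻ x, (m - u x) ∂P ≠ ⊤ := (hwle.trans_lt hm.lt_top).ne
  -- Centring is essential: closeness is applied to `(u - m)⁺` and `(m - u)⁺`, which have the same
  -- `P'`-mean `v`. The deviation from `m` is then at most `θ` times the mean absolute deviation
  -- `2v`, and `θ` enters the final bound only squared. Using closeness on `u` itself would leave a
  -- term linear in `θ`.
  have hkey : ∫⁻ x, u x ∂P ≤ m + θ * (2 * v) := by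
    have e1 := hint P inferInstance
    have e2 := h1 _ hum
    have e3 := h2 _ hmu
    rw [hv] at e3
    have e4 : ∫⁻ x, u x ∂P + ∫⁻ x, (m - u x) ∂P ≤
        (m + θ * (2 * v)) + ∫⁻ x, (m - u x) ∂P := by
      calc _ = m + ∫⁻ x, (u x - m) ∂P := e1
        _ ≤ m + (v + θ * v) := by gcongr
        _ ≤ m + ((∫⁻ x, (m - u x) ∂P + θ * v) + θ * v) := by gcongr
        _ = _ := by ring
    exact (ENNReal.add_le_add_iff_right hwt).1 e4
  have hV : (2 * v) ^ 2 ≤ ∫⁻ x, ((u x - m) + (m - u x)) ^ 2 ∂P' := by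
    have := sq_lintegral_le (μ := P') (hum.add hmu)
    simp only [Pi.add_apply] at this
    rwa [lintegral_add_left hum, hv, ← two_mul] at this
  have hvar : m ^ 2 + ∫⁻ x, ((u x - m) + (m - u x)) ^ 2 ∂P' ≤ ∫⁻ x, u x ^ 2 ∂P' := by
    have hmm : m * m ≠ ⊤ := ENNReal.mul_ne_top hm hm
    have e1 : ∀ x, ((u x - m) + (m - u x)) ^ 2 + 2 * m * u x ≤ u x ^ 2 + m ^ 2 := fun x =>
      tsub_add_tsub_sq_le hm
    have hsm : Measurable fun x => ((u x - m) + (m - u x)) ^ 2 := (hum.add hmu).pow_const 2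
    have e2 := lintegral_mono (μ := P') e1
    rw [lintegral_add_left hsm, lintegral_add_left (hu.pow_const 2),
      lintegral_const_mul _ hu, lintegral_const, measure_univ, mul_one] at e2
    have e3 : (m ^ 2 + ∫⁻ x, ((u x - m) + (m - u x)) ^ 2 ∂P') + m ^ 2 ≤
        ∫⁻ x, u x ^ 2 ∂P' + m ^ 2 := by
      refine le_trans (le_of_eq ?_) e2
      change _ = _ + 2 * m * m
      ring
    exact (ENNReal.add_le_add_iff_right (by rw [sq]; exact hmm)).1 e3
  calc (∫⁻ x, u x ∂P) ^ 2 ≤ (m + θ * (2 * v)) ^ 2 := pow_le_pow_left' hkey 2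
    _ ≤ (1 + θ ^ 2) * (m ^ 2 + (2 * v) ^ 2) :=
        add_mul_sq_le hm (ENNReal.mul_ne_top (by simp) hvt) hθ
    _ ≤ _ := by
        gcongr
        exact le_trans (by gcongr) hvar

lemma IsDensity.lintegral_ofReal {f : ℝ → ℝ} (hf : IsDensity f) :
    ∫⁻ x, ENNReal.ofReal (f x) = 1 := by
  rw [← ofReal_integral_eq_lintegral_ofReal hf.integrable (Eventually.of_forall hf.nonneg),
    hf.integral_eq, ENNReal.ofReal_one]

lemma lintegral_viewLaw_eq {𝒵 : Type u} [MeasurableSpace 𝒵] (Q : Mechanism 𝒵) (n : ℕ)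
    {f : ℝ → ℝ} (hf : Measurable f) (z : Fin n → 𝒵) {u : 𝒵 → ℝ≥0∞} (hu : Measurable u) :
    ∫⁻ z', u z' ∂viewLaw Q n f z = ∫⁻ x, ENNReal.ofReal (f x) * ∫⁻ z', u z' ∂Q n (x, z) := by
  rw [lintegral_viewLaw _ _ _ _ hu, lintegral_densityMeasure hf]
  exact hu.lintegral_kernel.comp (by fun_prop : Measurable fun x : ℝ => (x, z))

/-- Both sides equal `1 - ∫ min F G`. -/
lemma lintegral_tsub_comm {F G : ℝ → ℝ≥0∞} (hF : Measurable F) (hG : Measurable G)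
    (hF1 : ∫⁻ x, F x = 1) (hG1 : ∫⁻ x, G x = 1) : ∫⁻ x, (F x - G x) = ∫⁻ x, (G x - F x) := by
  have hFG : Measurable fun x => F x - G x := hF.sub hG
  have hGF : Measurable fun x => G x - F x := hG.sub hF
  have h1 : (∫⁻ x, (F x - G x)) + ∫⁻ x, min (F x) (G x) = 1 := by
    rw [← lintegral_add_left hFG, ← hF1]
    simp only [tsub_add_min]
  have h2 : (∫⁻ x, (G x - F x)) + ∫⁻ x, min (F x) (G x) = 1 := by
    rw [← lintegral_add_left hGF, ← hG1]
    simp only [min_comm (F _), tsub_add_min]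
  have hfin : ∫⁻ x, min (F x) (G x) ≠ ⊤ := by
    refine (lt_of_le_of_lt (lintegral_mono fun x => min_le_left _ _) ?_).ne
    rw [hF1]; exact ENNReal.one_lt_top
  exact (ENNReal.add_left_inj hfin).1 (h1.trans h2.symm)

/-- Averages of a function of bounded oscillation ratio against close densities are close. -/
lemma lintegral_mul_le_of_ratio {F G q : ℝ → ℝ≥0∞} (hF : Measurable F) (hG : Measurable G)
    (hF1 : ∫⁻ x, F x = 1) (hG1 : ∫⁻ x, G x = 1) (hq : Measurable q) {ε a b : ℝ≥0∞} (hε : ε ≠ ⊤)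
    (ha : ∫⁻ x, (F x - G x) ≤ a) (hratio : ∀ x x', q x ≤ (1 + ε) * q x')
    (hb : ⨅ x, q x ≤ b) :
    ∫⁻ x, F x * q x ≤ (∫⁻ x, G x * q x) + ε * a * b := by
  have hF' : ∀ x, F x * q x = (F x - G x) * q x + min (F x) (G x) * q x := fun x => by
    rw [← add_mul, tsub_add_min]
  have hG' : ∀ x, G x * q x = (G x - F x) * q x + min (F x) (G x) * q x := fun x => by
    rw [← add_mul, min_comm, tsub_add_min]
  have hFG : Measurable fun x => F x - G x := hF.sub hG
  have hGF : Measurable fun x => G x - F x := hG.sub hF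
  have hFGq : Measurable fun x => (F x - G x) * q x := hFG.mul hq
  have hGFq : Measurable fun x => (G x - F x) * q x := hGF.mul hq
  have hsym := lintegral_tsub_comm hF hG hF1 hG1
  set q₀ := ⨅ x, q x with hq₀
  have hup : ∀ x, q x ≤ (1 + ε) * q₀ := by
    intro x
    rw [hq₀, ENNReal.mul_iInf_of_ne (by simp) (by simp [hε])]
    exact le_iInf fun x' => hratio x x'
  -- On the excess of `F` over `G` the function `q` is at most `(1 + ε) inf q`, and on the excess of
  -- `G` over `F` it is at least `inf q`. The two excesses have equal mass, so only the `ε` part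
  -- remains.
  calc ∫⁻ x, F x * q x = (∫⁻ x, (F x - G x) * q x) + ∫⁻ x, min (F x) (G x) * q x := by
        simp only [hF']
        exact lintegral_add_left hFGq _
    _ ≤ (∫⁻ x, (F x - G x) * ((1 + ε) * q₀)) + ∫⁻ x, min (F x) (G x) * q x := by
        gcongr with x
        exact hup x
    _ = ((∫⁻ x, (G x - F x) * q₀) + ∫⁻ x, min (F x) (G x) * q x) +
          ε * (∫⁻ x, (F x - G x)) * q₀ := by
        rw [lintegral_mul_const _ hFG, lintegral_mul_const _ hGF, ← hsym]
        ring
    _ ≤ ((∫⁻ x, (G x - F x) * q x) + ∫⁻ x, min (F x) (G x) * q x) + ε * a * b := by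
        gcongr with x
        exact iInf_le _ x
    _ = _ := by
        rw [← lintegral_add_left hGFq]
        simp only [← hG']

lemma iInf_le_lintegral_mul {G q : ℝ → ℝ≥0∞} (hG : Measurable G) (hG1 : ∫⁻ x, G x = 1) :
    ⨅ x, q x ≤ ∫⁻ x, G x * q x := by
  calc ⨅ x, q x = ∫⁻ x, G x * ⨅ x, q x := by rw [lintegral_mul_const _ hG, hG1, one_mul]
    _ ≤ _ := lintegral_mono fun x => by gcongr; exact iInf_le _ x

lemma lintegral_ofReal_tsub_le {f g : ℝ → ℝ} (hf : IsDensity f) (hg : IsDensity g) {τ : ℝ}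
    (hτ : ∫ x, |f x - g x| ≤ τ) :
    ∫⁻ x, (ENNReal.ofReal (f x) - ENNReal.ofReal (g x)) ≤ ENNReal.ofReal τ := by
  have hi : Integrable fun x => |f x - g x| := (hf.integrable.sub hg.integrable).abs
  refine le_trans ?_ (ENNReal.ofReal_le_ofReal hτ)
  rw [ofReal_integral_eq_lintegral_ofReal hi (Eventually.of_forall fun _ => abs_nonneg _)]
  refine lintegral_mono fun x => ?_
  rw [← ENNReal.ofReal_sub _ (hg.nonneg x)]
  exact ENNReal.ofReal_le_ofReal (le_abs_self _)

/-- Local differential privacy contracts: the information in a private view. -/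
lemma sqDominated_viewLaw_of_private {𝒵 : Type u} [MeasurableSpace 𝒵] {Q : Mechanism 𝒵} {α : ℝ}
    (hα : 0 ≤ α) (hQ : LocallyPrivate α Q) {f g : ℝ → ℝ} (hf : IsDensity f) (hg : IsDensity g)
    {τ : ℝ} (hτ : ∫ x, |f x - g x| ≤ τ) (n : ℕ) (z : Fin n → 𝒵) :
    SqDominated (1 + ENNReal.ofReal ((Real.exp α - 1) * τ) ^ 2) (viewLaw Q n f z)
      (viewLaw Q n g z) := by
  have := isProbabilityMeasure_viewLaw hQ.1 n hf z
  have := isProbabilityMeasure_viewLaw hQ.1 n hg z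
  have hε0 : 0 ≤ Real.exp α - 1 := by have := Real.one_le_exp hα; linarith
  set ε := ENNReal.ofReal (Real.exp α - 1)
  have hexp : ENNReal.ofReal (Real.exp α) = 1 + ε := by
    rw [← ENNReal.ofReal_one, ← ENNReal.ofReal_add zero_le_one hε0, add_sub_cancel]
  have hFm : Measurable fun x => ENNReal.ofReal (f x) := hf.measurable.ennreal_ofReal
  have hGm : Measurable fun x => ENNReal.ofReal (g x) := hg.measurable.ennreal_ofReal
  have hqm : ∀ u : 𝒵 → ℝ≥0∞, Measurable u →
      Measurable fun x : ℝ => ∫⁻ z', u z' ∂Q n (x, z) := fun u hu =>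
    hu.lintegral_kernel.comp (by fun_prop : Measurable fun x : ℝ => (x, z))
  have hratio : ∀ u : 𝒵 → ℝ≥0∞, ∀ x x' : ℝ,
      ∫⁻ z', u z' ∂Q n (x, z) ≤ (1 + ε) * ∫⁻ z', u z' ∂Q n (x', z) := by
    intro u x x'
    have hle : Q n (x, z) ≤ (1 + ε) • Q n (x', z) := by
      rw [← hexp]
      exact Measure.le_iff.2 fun A hA => hQ.2 n x x' z A hA
    calc _ ≤ ∫⁻ z', u z' ∂((1 + ε) • Q n (x', z)) := lintegral_mono' hle le_rfl
      _ = _ := lintegral_smul_measure _ _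
  rw [ENNReal.ofReal_mul hε0]
  have hτ' := lintegral_ofReal_tsub_le hf hg hτ
  have hτ'' := hτ'
  rw [lintegral_tsub_comm hFm hGm hf.lintegral_ofReal hg.lintegral_ofReal] at hτ''
  refine sqDominated_of_close (ENNReal.mul_ne_top ENNReal.ofReal_ne_top ENNReal.ofReal_ne_top)
    (fun u hu => ?_) (fun u hu => ?_)
  · rw [lintegral_viewLaw_eq _ _ hf.measurable _ hu, lintegral_viewLaw_eq _ _ hg.measurable _ hu]
    exact lintegral_mul_le_of_ratio hFm hGm hf.lintegral_ofReal hg.lintegral_ofReal (hqm u hu)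
      ENNReal.ofReal_ne_top hτ' (hratio u) (iInf_le_lintegral_mul hGm hg.lintegral_ofReal)
  · rw [lintegral_viewLaw_eq _ _ hf.measurable _ hu, lintegral_viewLaw_eq _ _ hg.measurable _ hu]
    exact lintegral_mul_le_of_ratio hGm hFm hg.lintegral_ofReal hf.lintegral_ofReal (hqm u hu)
      ENNReal.ofReal_ne_top hτ'' (hratio u) (iInf_le_lintegral_mul hGm hg.lintegral_ofReal)

/-- The information in a view is at most that in the datum. -/
lemma sqDominated_viewLaw {𝒵 : Type u} [MeasurableSpace 𝒵] {Q : Mechanism 𝒵}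
    (hQ : ∀ i, IsMarkovKernel (Q i)) {f g : ℝ → ℝ} (hf : IsDensity f) (hg : IsDensity g)
    {c χ : ℝ} (hc : 0 < c) (hfg : ∀ x, f x ≠ g x → c ≤ g x)
    (hi : Integrable fun x => (f x - g x) ^ 2) (hχ : ∫ x, (f x - g x) ^ 2 ≤ χ) (n : ℕ)
    (z : Fin n → 𝒵) :
    SqDominated (ENNReal.ofReal (1 + χ / c)) (viewLaw Q n f z) (viewLaw Q n g z) := by
  intro u hu
  have hmark := hQ n
  rw [lintegral_viewLaw_eq _ _ hf.measurable _ hu,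
    lintegral_viewLaw_eq _ _ hg.measurable _ (hu.pow_const 2)]
  set q : ℝ → ℝ≥0∞ := fun x => ∫⁻ z', u z' ∂Q n (x, z)
  have hqm : Measurable q := hu.lintegral_kernel.comp (by fun_prop : Measurable fun x : ℝ => (x, z))
  -- Preparation for Cauchy-Schwarz with weight `√g`. Where `g x = 0` the hypothesis forces `f x =
  -- 0`, so the default value `f x / √0 = 0` is the right one.
  have hsplit : ∀ x, ENNReal.ofReal (f x) * q x =
      ENNReal.ofReal (√(g x)) * q x * ENNReal.ofReal (f x / √(g x)) := by
    intro x
    rw [mul_right_comm, ← ENNReal.ofReal_mul (Real.sqrt_nonneg _)]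
    congr 2
    by_cases h : f x = g x
    · rw [h, mul_div_assoc', mul_comm, mul_div_assoc]
      by_cases hg0 : g x = 0
      · rw [hg0]; simp
      · have : 0 < g x := lt_of_le_of_ne (hg.nonneg x) (Ne.symm hg0)
        rw [div_self (Real.sqrt_pos.2 this).ne', mul_one]
    · have : 0 < g x := hc.trans_le (hfg x h)
      rw [mul_div_cancel₀ _ (Real.sqrt_pos.2 this).ne']
  -- This rests on `f²/g = 2f - g + (f - g)²/g`, whose first two terms integrate to `1`; in the last
  -- one `g ≥ c` wherever `f ≠ g`.
  have hratio : ∫⁻ x, ENNReal.ofReal (f x / √(g x)) ^ 2 ≤ ENNReal.ofReal (1 + χ / c) := by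
    have hle : ∀ x, ENNReal.ofReal (f x / √(g x)) ^ 2 ≤
        ENNReal.ofReal (2 * f x - g x + (f x - g x) ^ 2 / c) := by
      intro x
      rw [← ENNReal.ofReal_pow (div_nonneg (hf.nonneg x) (Real.sqrt_nonneg _)), div_pow,
        Real.sq_sqrt (hg.nonneg x)]
      refine ENNReal.ofReal_le_ofReal ?_
      by_cases h : f x = g x
      · rw [h]
        by_cases hg0 : g x = 0
        · rw [hg0]; simp
        · rw [sq, mul_div_assoc, div_self hg0]; simp; linarith
      · have hgc := hfg x h
        have hg0 : 0 < g x := hc.trans_le hgc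
        have h1 : f x ^ 2 / g x = 2 * f x - g x + (f x - g x) ^ 2 / g x := by
          field_simp; ring
        rw [h1]
        gcongr
    have hsub : Integrable fun x => 2 * f x - g x := (hf.integrable.const_mul 2).sub hg.integrable
    have hint : Integrable fun x => 2 * f x - g x + (f x - g x) ^ 2 / c :=
      hsub.add (hi.div_const c)
    refine (lintegral_mono hle).trans ?_
    rw [← ofReal_integral_eq_lintegral_ofReal hint]
    · refine ENNReal.ofReal_le_ofReal ?_
      rw [integral_add hsub (hi.div_const c),
        integral_sub (hf.integrable.const_mul 2) hg.integrable, integral_const_mul,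
        hf.integral_eq, hg.integral_eq, integral_div]
      have := div_le_div_of_nonneg_right hχ hc.le
      linarith
    · refine Eventually.of_forall fun x => ?_
      simp only [Pi.zero_apply]
      by_cases h : f x = g x
      · rw [h]; have := hg.nonneg x; simp; linarith
      · have hgc := hfg x h
        have h1 : 2 * f x - g x + (f x - g x) ^ 2 / g x = f x ^ 2 / g x := by
          have hg0 : 0 < g x := hc.trans_le hgc
          field_simp; ring
        have h2 : (f x - g x) ^ 2 / g x ≤ (f x - g x) ^ 2 / c := by gcongr
        have h3 : 0 ≤ f x ^ 2 / g x := div_nonneg (sq_nonneg _) (hg.nonneg x)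
        linarith
  have hgs : Measurable fun x => ENNReal.ofReal (√(g x)) :=
    (hg.measurable.sqrt).ennreal_ofReal
  calc (∫⁻ x, ENNReal.ofReal (f x) * q x) ^ 2
      = (∫⁻ x, ENNReal.ofReal (√(g x)) * q x * ENNReal.ofReal (f x / √(g x))) ^ 2 := by
        simp only [hsplit]
    _ ≤ (∫⁻ x, (ENNReal.ofReal (√(g x)) * q x) ^ 2) *
          ∫⁻ x, ENNReal.ofReal (f x / √(g x)) ^ 2 :=
        sq_lintegral_mul_le (hgs.mul hqm) (hf.measurable.div hg.measurable.sqrt).ennreal_ofReal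
    _ ≤ (∫⁻ x, ENNReal.ofReal (g x) * ∫⁻ z', u z' ^ 2 ∂Q n (x, z)) *
          ENNReal.ofReal (1 + χ / c) := by
        gcongr with x
        rw [mul_pow, ← ENNReal.ofReal_pow (Real.sqrt_nonneg _), Real.sq_sqrt (hg.nonneg x)]
        gcongr
        exact sq_lintegral_le hu
    _ = _ := mul_comm _ _

/-- `D` bounds the information about `f` versus `g` contained in `n` private views. -/
def InfoBound {𝒵 : Type u} [MeasurableSpace 𝒵] (Q : Mechanism 𝒵) (n : ℕ) (f g : ℝ → ℝ)
    (D : ℝ) : Prop :=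
  ∀ A : Set (Fin n → 𝒵), MeasurableSet A →
    privateLaw Q n f A ^ 2 ≤ ENNReal.ofReal (Real.exp D) * privateLaw Q n g A

lemma ofReal_one_add_pow_le_exp {a : ℝ} (ha : 0 ≤ a) (n : ℕ) :
    ENNReal.ofReal (1 + a) ^ n ≤ ENNReal.ofReal (Real.exp (n * a)) := by
  rw [← ENNReal.ofReal_pow (by linarith), Real.exp_nat_mul]
  refine ENNReal.ofReal_le_ofReal (pow_le_pow_left₀ (by linarith) ?_ n)
  rw [add_comm]
  exact Real.add_one_le_exp a

lemma infoBound_of_private {𝒵 : Type u} [MeasurableSpace 𝒵] {Q : Mechanism 𝒵} {α : ℝ}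
    (hα : 0 ≤ α) (hQ : LocallyPrivate α Q) {f g : ℝ → ℝ} (hf : IsDensity f) (hg : IsDensity g)
    {τ : ℝ} (hτ : ∫ x, |f x - g x| ≤ τ) (n : ℕ) :
    InfoBound Q n f g (n * (Real.exp α - 1) ^ 2 * τ ^ 2) := by
  intro A hA
  have h := (sqDominated_privateLaw hQ.1 hf hg
    (fun n z => sqDominated_viewLaw_of_private hα hQ hf hg hτ n z) n).measure_sq_le hA
  refine h.trans ?_
  have hτ0 : 0 ≤ τ := (integral_nonneg fun _ => abs_nonneg _).trans hτ
  have hε0 : 0 ≤ Real.exp α - 1 := by have := Real.one_le_exp hα; linarith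
  gcongr
  rw [← ENNReal.ofReal_pow (by positivity), ← ENNReal.ofReal_one,
    ← ENNReal.ofReal_add zero_le_one (by positivity)]
  refine (ofReal_one_add_pow_le_exp (by positivity) n).trans (le_of_eq ?_)
  rw [mul_pow, mul_assoc]

lemma infoBound_of_sq {𝒵 : Type u} [MeasurableSpace 𝒵] {Q : Mechanism 𝒵}
    (hQ : ∀ i, IsMarkovKernel (Q i)) {f g : ℝ → ℝ} (hf : IsDensity f) (hg : IsDensity g)
    {c χ : ℝ} (hc : 0 < c) (hfg : ∀ x, f x ≠ g x → c ≤ g x)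
    (hi : Integrable fun x => (f x - g x) ^ 2) (hχ : ∫ x, (f x - g x) ^ 2 ≤ χ) (n : ℕ) :
    InfoBound Q n f g (n * (χ / c)) := by
  intro A hA
  have h := (sqDominated_privateLaw hQ hf hg
    (fun n z => sqDominated_viewLaw hQ hf hg hc hfg hi hχ n z) n).measure_sq_le hA
  refine h.trans ?_
  have hχ0 : 0 ≤ χ := (integral_nonneg fun _ => sq_nonneg _).trans hχ
  gcongr
  exact ofReal_one_add_pow_le_exp (by positivity) n

/-! ### Local perturbations of a density inside the Besov class. -/

lemma waveletCoeff_add {N : ℕ} {w f g : ℝ → ℝ} (hw : HasRadialMajorant N w)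
    (hwm : AEStronglyMeasurable w volume) (hf : Integrable f) (hg : Integrable g) (j k : ℤ) :
    waveletCoeff w (f + g) j k = waveletCoeff w f j k + waveletCoeff w g j k := by
  obtain ⟨C, -, hC, -⟩ := hw.exists_bound
  have hb : ∀ x, |dilate w j k x| ≤ (2 : ℝ) ^ ((j : ℝ) / 2) * C := fun x => by
    rw [dilate, abs_mul, abs_of_pos (by positivity : (0 : ℝ) < 2 ^ ((j : ℝ) / 2))]
    exact mul_le_mul_of_nonneg_left (hC _) (by positivity)
  have hm := aestronglyMeasurable_dilate hwm j k
  simp only [waveletCoeff, Pi.add_apply, add_mul]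
  exact integral_add (integrable_mul_of_bounded hf hm hb) (integrable_mul_of_bounded hg hm hb)

lemma waveletCoeff_const_mul (w f : ℝ → ℝ) (c : ℝ) (j k : ℤ) :
    waveletCoeff w (fun x => c * f x) j k = c * waveletCoeff w f j k := by
  simp only [waveletCoeff, mul_assoc, integral_const_mul]

lemma besovJ_add_le {N : ℕ} {φ ψ : ℝ → ℝ} (hφ : IsFatherWavelet N φ) (hψ : IsMotherWavelet N φ ψ)
    {s : ℝ} {p q : ℝ≥0∞} (hp : 1 ≤ p) (hq : 1 ≤ q) {f g : ℝ → ℝ} (hf : Integrable f)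
    (hg : Integrable g) :
    besovJ φ ψ s p q (f + g) ≤ besovJ φ ψ s p q f + besovJ φ ψ s p q g := by
  have key : ∀ w : ℝ → ℝ, HasRadialMajorant N w → AEStronglyMeasurable w volume → ∀ j : ℤ,
      eLpNorm (fun k : ℤ => waveletCoeff w (f + g) j k) p Measure.count ≤
        eLpNorm (fun k : ℤ => waveletCoeff w f j k) p Measure.count +
          eLpNorm (fun k : ℤ => waveletCoeff w g j k) p Measure.count := by
    intro w hw hwm j
    simp only [waveletCoeff_add hw hwm hf hg]
    exact eLpNorm_add_le Measurable.of_discrete.aestronglyMeasurable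
      Measurable.of_discrete.aestronglyMeasurable hp
  have h1 := key φ hφ.decay hφ.mra.1.1.1 0
  have h2 := fun j : ℕ => key ψ hψ.decay hψ.orthonormal.1.1 j
  unfold besovJ
  rw [add_add_add_comm]
  refine add_le_add h1 ?_
  refine le_trans ?_ (eLpNorm_add_le Measurable.of_discrete.aestronglyMeasurable
      Measurable.of_discrete.aestronglyMeasurable hq)
  refine eLpNorm_mono_enorm fun j => ?_
  simp only [enorm_eq_self, Pi.add_apply, ← mul_add]
  gcongr
  exact h2 j

lemma besovJ_const_mul_le (φ ψ : ℝ → ℝ) (s : ℝ) (p q : ℝ≥0∞) {c : ℝ} (hc : 0 ≤ c) (f : ℝ → ℝ) :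
    besovJ φ ψ s p q (fun x => c * f x) ≤ ENNReal.ofReal c * besovJ φ ψ s p q f := by
  have key : ∀ (w : ℝ → ℝ) (j : ℤ),
      eLpNorm (fun k : ℤ => waveletCoeff w (fun x => c * f x) j k) p Measure.count ≤
        ENNReal.ofReal c * eLpNorm (fun k : ℤ => waveletCoeff w f j k) p Measure.count := by
    intro w j
    simp only [waveletCoeff_const_mul]
    have := eLpNorm_const_smul_le (f := fun k : ℤ => waveletCoeff w f j k) (c := c) (p := p)
      (μ := Measure.count)
    rwa [Real.enorm_of_nonneg hc] at this
  unfold besovJ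
  rw [mul_add]
  refine add_le_add (key φ 0) ?_
  refine eLpNorm_le_nnreal_smul_eLpNorm_of_ae_le_mul' (c := c.toNNReal)
    (Eventually.of_forall fun j => ?_) q
  simp only [enorm_eq_self]
  calc _ ≤ ENNReal.ofReal ((2 : ℝ) ^ ((j : ℝ) * (s + 1 / 2 - 1 / p.toReal))) *
        (ENNReal.ofReal c * eLpNorm (fun k : ℤ => waveletCoeff ψ f j k) p Measure.count) := by
        gcongr
        exact key ψ j
    _ = _ := by rw [mul_left_comm]; rfl

/-- A finite sum of integer translates. -/
def bumpSum (g : ℝ → ℝ) (S : Finset ℕ) (y : ℝ) : ℝ := ∑ k ∈ S, g (y - k)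

lemma bumpSum_eq_of_mem {g : ℝ → ℝ} (hg : ∀ y, g y ≠ 0 → y ∈ Ioo (0 : ℝ) 1) (S : Finset ℕ) {k : ℕ}
    {y : ℝ} (hy : y - k ∈ Ioo (0 : ℝ) 1) : bumpSum g S y = if k ∈ S then g (y - k) else 0 := by
  have h0 : ∀ l : ℕ, l ≠ k → g (y - l) = 0 := by
    intro l hl
    by_contra hne
    have h := hg _ hne
    have h1 : (l : ℝ) < k + 1 := by linarith [h.1, hy.2]
    have h2 : (k : ℝ) < l + 1 := by linarith [h.2, hy.1]
    norm_cast at h1 h2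
    omega
  unfold bumpSum
  split_ifs with hk
  · exact Finset.sum_eq_single_of_mem k hk fun l _ hl => h0 l hl
  · exact Finset.sum_eq_zero fun l hl => h0 l fun h => hk (h ▸ hl)

lemma bumpSum_eq_zero_or {g : ℝ → ℝ} (hg : ∀ y, g y ≠ 0 → y ∈ Ioo (0 : ℝ) 1) (S : Finset ℕ)
    (y : ℝ) : bumpSum g S y = 0 ∨ ∃ k ∈ S, y - k ∈ Ioo (0 : ℝ) 1 ∧ bumpSum g S y = g (y - k) := by
  by_cases h : ∃ k ∈ S, g (y - k) ≠ 0
  · obtain ⟨k, hk, hne⟩ := h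
    refine Or.inr ⟨k, hk, hg _ hne, ?_⟩
    rw [bumpSum_eq_of_mem hg S (hg _ hne), if_pos hk]
  · push Not at h
    exact Or.inl (Finset.sum_eq_zero h)

lemma abs_bumpSum_le {g : ℝ → ℝ} (hg : ∀ y, g y ≠ 0 → y ∈ Ioo (0 : ℝ) 1) {B : ℝ} (hB0 : 0 ≤ B)
    (hB : ∀ y, |g y| ≤ B) (S : Finset ℕ) (y : ℝ) : |bumpSum g S y| ≤ B := by
  rcases bumpSum_eq_zero_or hg S y with h | ⟨k, -, -, h⟩
  · rwa [h, abs_zero]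
  · rw [h]; exact hB _

/-- A smooth function supported in the open unit interval, of vanishing integral. -/
structure IsBump (g : ℝ → ℝ) : Prop where
  contDiff : ContDiff ℝ ∞ g
  tsupport : tsupport g ⊆ Ioo 0 1
  abs_le : ∀ x, |g x| ≤ 1
  integral_eq : ∫ x, g x = 0
  ne_zero : ∃ x, g x ≠ 0

lemma IsBump.compact {g : ℝ → ℝ} (hg : IsBump g) : HasCompactSupport g :=
  HasCompactSupport.of_support_subset_isCompact isCompact_Icc
    ((subset_tsupport g).trans (hg.tsupport.trans Ioo_subset_Icc_self))

lemma IsBump.mem_of_ne {g : ℝ → ℝ} (hg : IsBump g) {y : ℝ} (hy : g y ≠ 0) : y ∈ Ioo (0 : ℝ) 1 :=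
  hg.tsupport (subset_tsupport g hy)

lemma IsBump.integrable {g : ℝ → ℝ} (hg : IsBump g) : Integrable g :=
  hg.contDiff.continuous.integrable_of_hasCompactSupport hg.compact

lemma tsupport_iteratedDeriv_subset (f : ℝ → ℝ) (i : ℕ) : tsupport (iteratedDeriv i f) ⊆ tsupport f := by
  induction i with
  | zero => simp
  | succ i ih => rw [iteratedDeriv_succ]; exact tsupport_deriv_subset.trans ih

lemma exists_smoothBounds (d : ℕ) {h : ℝ → ℝ} (hh : ContDiff ℝ ∞ h) (hc : HasCompactSupport h) :
    ∃ G₁ G, SmoothBounds d h G₁ G := by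
  have hb : ∀ i, ∃ C, ∀ x, |iteratedDeriv i h x| ≤ C := fun i =>
    (hh.continuous_iteratedDeriv i (by exact_mod_cast le_top)).bounded_above_of_compact_support
      (hasCompactSupport_iteratedDeriv hc i)
  choose C hC using hb
  have hC0 : ∀ i, 0 ≤ C i := fun i => (abs_nonneg _).trans (hC i 0)
  refine ⟨∑ i ∈ Finset.range (d + 1), ∫ x, |iteratedDeriv i h x|,
    ∑ i ∈ Finset.range (d + 1), C i, hh, hc, fun i hi x => (hC i x).trans ?_, fun i hi => ?_⟩
  · exact Finset.single_le_sum (fun i _ => hC0 i) (Finset.mem_range.2 (by omega))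
  · exact Finset.single_le_sum (f := fun i => ∫ x, |iteratedDeriv i h x|)
      (fun i _ => integral_nonneg fun _ => abs_nonneg _) (Finset.mem_range.2 (by omega))

lemma contDiff_bumpSum {g : ℝ → ℝ} (hg : ContDiff ℝ ∞ g) (S : Finset ℕ) :
    ContDiff ℝ ∞ (bumpSum g S) :=
  ContDiff.sum fun _ _ => hg.comp (contDiff_id.sub contDiff_const)

lemma iteratedDeriv_bumpSum {g : ℝ → ℝ} (hg : ContDiff ℝ ∞ g) (S : Finset ℕ) (i : ℕ) :
    iteratedDeriv i (bumpSum g S) = bumpSum (iteratedDeriv i g) S := by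
  ext x
  unfold bumpSum
  rw [iteratedDeriv_fun_sum fun _ _ => ?_]
  · simp only [iteratedDeriv_comp_sub_const]
  · exact ((hg.comp (contDiff_id.sub contDiff_const)).of_le (by exact_mod_cast le_top)).contDiffAt

lemma integral_abs_bumpSum_le {g : ℝ → ℝ} (hg : Integrable g) (S : Finset ℕ) :
    ∫ x, |bumpSum g S x| ≤ S.card * ∫ x, |g x| := by
  have hi : ∀ k : ℕ, Integrable fun x => |g (x - k)| := fun k => (hg.comp_sub_right _).abs
  calc ∫ x, |bumpSum g S x| ≤ ∫ x, ∑ k ∈ S, |g (x - k)| := by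
        refine integral_mono_of_nonneg (Eventually.of_forall fun _ => abs_nonneg _)
          (integrable_finsetSum _ fun k _ => hi k)
          (Eventually.of_forall fun x => Finset.abs_sum_le_sum_abs _ _)
    _ = _ := by
        rw [integral_finsetSum _ fun k _ => hi k]
        simp only [integral_sub_right_eq_self (fun x => |g x|)]
        simp

/-- The translates have disjoint supports, so the sup norms stay as for one bump and only the `L¹`
norms grow with the cardinality. After interpolation the Besov functional carries `S.card ^ (1 /
p)`. -/
lemma SmoothBounds.bumpSum {g : ℝ → ℝ} (hg : IsBump g) {d : ℕ} {G₁ G : ℝ}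
    (H : SmoothBounds d g G₁ G) (S : Finset ℕ) : SmoothBounds d (bumpSum g S) (S.card * G₁) G where
  contDiff := contDiff_bumpSum hg.contDiff S
  compact := by
    unfold _root_.bumpSum
    have : (fun y : ℝ => ∑ k ∈ S, g (y - k)) = ∑ k ∈ S, fun y : ℝ => g (y - k) := by ext; simp
    rw [this]
    refine HasCompactSupport.finset_sum fun k _ => ?_
    exact hg.compact.comp_homeomorph (Homeomorph.subRight (k : ℝ))
  sup_le i hi x := by
    rw [iteratedDeriv_bumpSum hg.contDiff]
    exact abs_bumpSum_le (fun y hy => hg.tsupport (tsupport_iteratedDeriv_subset g i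
      (subset_tsupport _ hy))) H.sup_nonneg (H.sup_le i hi) S x
  integral_le i hi := by
    rw [iteratedDeriv_bumpSum hg.contDiff]
    refine (integral_abs_bumpSum_le ?_ S).trans ?_
    · exact (hg.contDiff.continuous_iteratedDeriv i
        (by exact_mod_cast le_top)).integrable_of_hasCompactSupport
        (hasCompactSupport_iteratedDeriv hg.compact i)
    · gcongr
      exact H.integral_le i hi

/-- The difference of two disjoint copies of one bump, centred at `1/4` and `3/4`. -/
lemma exists_isBump : ∃ g : ℝ → ℝ, IsBump g := by
  let b : ContDiffBump (0 : ℝ) := ⟨1 / 2, 3 / 4, by norm_num, by norm_num⟩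
  have hb0 : ∀ y : ℝ, 3 / 4 ≤ |y| → b y = 0 := fun y hy => by
    by_contra h
    have : y ∈ Function.support b := h
    rw [b.support_eq, Metric.mem_ball, dist_zero_right, Real.norm_eq_abs] at this
    exact absurd this (not_lt.2 hy)
  have hbi : Integrable b := b.continuous.integrable_of_hasCompactSupport b.hasCompactSupport
  have hg0 : ∀ x : ℝ, x ∉ Icc (1 / 16 : ℝ) (15 / 16) → b (4 * x - 1) - b (4 * x - 3) = 0 := by
    intro x hx
    rw [mem_Icc, not_and_or] at hx
    rw [hb0, hb0, sub_zero]
    · rcases hx with h | h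
      · rw [abs_of_neg] <;> linarith
      · rw [abs_of_pos] <;> linarith
    · rcases hx with h | h
      · rw [abs_of_neg] <;> linarith
      · rw [abs_of_pos] <;> linarith
  refine ⟨fun x => b (4 * x - 1) - b (4 * x - 3), ?_, ?_, fun x => ?_, ?_, 1 / 4, ?_⟩
  · exact (b.contDiff.comp (by fun_prop)).sub (b.contDiff.comp (by fun_prop))
  · refine (closure_minimal (fun x hx => ?_) isClosed_Icc).trans
      (Icc_subset_Ioo (by norm_num : (0 : ℝ) < 1 / 16) (by norm_num : (15 / 16 : ℝ) < 1))
    by_contra h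
    exact hx (hg0 x h)
  · have h1 := b.nonneg (x := 4 * x - 1)
    have h2 := b.nonneg (x := 4 * x - 3)
    have h3 := b.le_one (x := 4 * x - 1)
    have h4 := b.le_one (x := 4 * x - 3)
    rw [abs_le]; constructor <;> linarith
  · rw [integral_sub (integrable_comp_mul_sub hbi (by norm_num) 1)
      (integrable_comp_mul_sub hbi (by norm_num) 3), integral_comp_mul_sub _ (by norm_num),
      integral_comp_mul_sub _ (by norm_num), sub_self]
  · have h1 : b (4 * (1 / 4) - 1) = 1 := b.one_of_mem_closedBall (by simp [b])
    have h2 : b (4 * (1 / 4) - 3) = 0 := hb0 _ (by norm_num)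
    simp only [h1, h2]; norm_num

/-- A density with `2 ^ J`-scale perturbations indexed by `S` added to it. -/
def perturbed (f₀ g : ℝ → ℝ) (J : ℕ) (a : ℝ) (S : Finset ℕ) (x : ℝ) : ℝ :=
  f₀ x + a * bumpSum g S (2 ^ J * x)

lemma IsBump.integrable_bumpSum {g : ℝ → ℝ} (hg : IsBump g) (J : ℕ) (S : Finset ℕ) :
    Integrable fun x => bumpSum g S (2 ^ J * x) := by
  unfold bumpSum
  exact integrable_finsetSum _ fun k _ => integrable_comp_mul_sub hg.integrable (by positivity) _

lemma IsBump.integral_bumpSum {g : ℝ → ℝ} (hg : IsBump g) (J : ℕ) (S : Finset ℕ) :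
    ∫ x, bumpSum g S (2 ^ J * x) = 0 := by
  unfold bumpSum
  rw [integral_finsetSum _ fun k _ => integrable_comp_mul_sub hg.integrable (by positivity) _]
  refine Finset.sum_eq_zero fun k _ => ?_
  rw [integral_comp_mul_sub _ (by positivity), hg.integral_eq, mul_zero]

lemma mem_Ioo_of_bumpSum_ne_zero {g : ℝ → ℝ} (hg : IsBump g) {J : ℕ} {S : Finset ℕ} {T : ℝ}
    (hS : ∀ k ∈ S, (k : ℝ) + 1 ≤ 2 ^ J * T) {x : ℝ} (hx : bumpSum g S (2 ^ J * x) ≠ 0) :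
    x ∈ Ioo 0 T := by
  rcases bumpSum_eq_zero_or (fun y => hg.mem_of_ne) S (2 ^ J * x) with h | ⟨k, hk, hm, -⟩
  · exact absurd h hx
  · have h2 : (0 : ℝ) < 2 ^ J := by positivity
    have hk0 : (0 : ℝ) ≤ k := Nat.cast_nonneg k
    constructor
    · by_contra! h
      nlinarith [hm.1]
    · by_contra! h
      nlinarith [hm.2, hS k hk]

/-- A smooth density supported in `[-T, T]`, of finite Besov norm and bounded below in the middle. -/
lemma exists_smooth_density {N : ℕ} {φ ψ : ℝ → ℝ} (hφ : IsFatherWavelet N φ)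
    (hψ : IsMotherWavelet N φ ψ) {s : ℝ} (hs : 0 < s) (hsN : s < (N : ℝ) + 1) {p q : ℝ≥0∞}
    (hp : 1 ≤ p) (hq : 1 ≤ q) {T : ℝ} (hT : 0 < T) :
    ∃ (g : ℝ → ℝ) (c B : ℝ), IsDensity g ∧ Function.support g ⊆ Icc (-T) T ∧ 0 < c ∧
      (∀ x ∈ Icc 0 (T / 2), c ≤ g x) ∧ 0 ≤ B ∧ besovJ φ ψ s p q g ≤ ENNReal.ofReal B := by
  obtain ⟨C, hC0, d, hC⟩ := exists_besovJ_comp_mul_le hφ hψ hs hsN hp hq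
  let b : ContDiffBump (0 : ℝ) := ⟨T / 2, T, by positivity, by linarith⟩
  have hbc : HasCompactSupport (b.normed volume) := b.hasCompactSupport_normed
  obtain ⟨G₁, G, hG⟩ := exists_smoothBounds d (b.contDiff_normed (μ := volume)) hbc
  have hbp : 0 < ∫ x, b x := b.integral_pos
  refine ⟨b.normed volume, 1 / ∫ x, b x, _, ⟨b.continuous_normed.measurable, b.nonneg_normed,
    b.integrable_normed, b.integral_normed⟩, ?_, by positivity, fun x hx => ?_, ?_,
    by simpa using hC _ _ _ hG 0⟩
  · rw [b.support_normed_eq, Real.ball_eq_Ioo]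
    simpa [b] using Ioo_subset_Icc_self
  · rw [b.normed_def, b.one_of_mem_closedBall]
    rw [Metric.mem_closedBall, dist_zero_right, Real.norm_eq_abs, abs_of_nonneg hx.1]
    exact hx.2
  · have h1 := hG.sup_nonneg
    have h2 := hG.integral_nonneg
    positivity

/-- The class contains local perturbations of a density that is bounded below. -/
theorem exists_perturbed_mem {N : ℕ} {φ ψ : ℝ → ℝ} (hφ : IsFatherWavelet N φ)
    (hψ : IsMotherWavelet N φ ψ) {s : ℝ} (hs : 0 < s) (hsN : s < (N : ℝ) + 1) {p q : ℝ≥0∞}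
    (hp : 1 ≤ p) (hq : 1 ≤ q) (hsp : 1 / p.toReal ≤ s) {L T : ℝ} (hL : 0 < L) (hT : 0 < T)
    (hLT : ∃ L' : ℝ, L' < L ∧ (besovDensities φ ψ s p q L' T).Nonempty) {g : ℝ → ℝ}
    (hg : IsBump g) :
    ∃ (f₀ : ℝ → ℝ) (c a₀ : ℝ), 0 < c ∧ c ≤ 1 ∧ 0 < a₀ ∧ a₀ ≤ c ∧ (∀ x ∈ Icc 0 (T / 2), 2 * c ≤ f₀ x) ∧
      ∀ (J : ℕ) (S : Finset ℕ) (a : ℝ), 0 ≤ a →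
        a * (S.card : ℝ) ^ (1 / p.toReal) * (2 : ℝ) ^ ((J : ℝ) * (s - 1 / p.toReal)) ≤ a₀ →
        (∀ k ∈ S, (k : ℝ) + 1 ≤ 2 ^ J * (T / 2)) →
        perturbed f₀ g J a S ∈ besovDensities φ ψ s p q L T := by
  obtain ⟨L', hL', f₁, hf₁m, hf₁0, hf₁i, hf₁1, hf₁s, hf₁J⟩ := hLT
  obtain ⟨g₀, c₁, B, hg₀, hg₀s, hc₁, hg₀c, hB, hg₀J⟩ := exists_smooth_density hφ hψ hs hsN hp hq hT
  obtain ⟨C, hC0, d, hC⟩ := exists_besovJ_comp_mul_le hφ hψ hs hsN hp hq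
  obtain ⟨G₁, G, hG⟩ := exists_smoothBounds d hg.contDiff hg.compact
  set M := max L' 0 with hM
  have hML : M < L := max_lt hL' hL
  have hM0 : 0 ≤ M := le_max_right _ _
  -- Mixing in a weight `t` of a smooth density gives a positive lower bound on `[0, T/2]` and
  -- spends at most half of the slack `L - M`; the perturbation may spend the other half.
  set t := min (1 / 2) ((L - M) / 2 / (B + 1)) with ht
  have ht0 : 0 < t := lt_min (by norm_num) (div_pos (by linarith) (by linarith))
  have ht1 : t ≤ 1 / 2 := min_le_left _ _
  have htB : t * B ≤ (L - M) / 2 := by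
    have h1 : t ≤ (L - M) / 2 / (B + 1) := min_le_right _ _
    rw [le_div_iff₀ (by linarith)] at h1
    linarith
  set f₀ : ℝ → ℝ := (fun x => (1 - t) * f₁ x) + fun x => t * g₀ x with hf₀
  have hi₁ : Integrable fun x => (1 - t) * f₁ x := hf₁i.const_mul _
  have hi₂ : Integrable fun x => t * g₀ x := hg₀.integrable.const_mul _
  have hf₀J : besovJ φ ψ s p q f₀ ≤ ENNReal.ofReal (M + (L - M) / 2) := by
    calc besovJ φ ψ s p q f₀ ≤ ENNReal.ofReal (1 - t) * ENNReal.ofReal M +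
          ENNReal.ofReal t * ENNReal.ofReal B := by
          refine (besovJ_add_le hφ hψ hp hq hi₁ hi₂).trans (add_le_add ?_ ?_)
          · refine (besovJ_const_mul_le φ ψ s p q (by linarith) f₁).trans ?_
            gcongr
            exact hf₁J.trans (ENNReal.ofReal_le_ofReal (le_max_left _ _))
          · refine (besovJ_const_mul_le φ ψ s p q ht0.le g₀).trans ?_
            gcongr
      _ = ENNReal.ofReal ((1 - t) * M + t * B) := by
          rw [← ENNReal.ofReal_mul (by linarith), ← ENNReal.ofReal_mul ht0.le,
            ← ENNReal.ofReal_add (mul_nonneg (by linarith) hM0) (by positivity)]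
      _ ≤ _ := ENNReal.ofReal_le_ofReal (by nlinarith)
  have hi₀ : Integrable f₀ := hi₁.add hi₂
  have hf₀1 : ∫ x, f₀ x = 1 := by
    rw [hf₀, integral_add' hi₁ hi₂, integral_const_mul, integral_const_mul, hf₁1, hg₀.integral_eq]
    ring
  set c := min (t * c₁ / 2) 1 with hc
  have hc0 : 0 < c := by positivity
  have hc2 : c ≤ t * c₁ / 2 := min_le_left _ _
  have hf₀c : ∀ x ∈ Icc 0 (T / 2), 2 * c ≤ f₀ x := by
    intro x hx
    have h1 := hg₀c x hx
    have h2 : 0 ≤ (1 - t) * f₁ x := mul_nonneg (by linarith) (hf₁0 x)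
    have h3 : t * c₁ ≤ t * g₀ x := by gcongr
    simp only [hf₀, Pi.add_apply]
    linarith
  have hf₀0 : ∀ x, 0 ≤ f₀ x := fun x =>
    add_nonneg (mul_nonneg (by linarith) (hf₁0 x)) (mul_nonneg ht0.le (hg₀.nonneg x))
  set W := C * (G ^ (1 - 1 / p.toReal) * G₁ ^ (1 / p.toReal)) with hW
  have hG0 := hG.sup_nonneg
  have hG₁0 := hG.integral_nonneg
  have hW0 : 0 ≤ W := by positivity
  refine ⟨f₀, c, min c ((L - M) / 2 / (W + 1)), hc0, min_le_right _ _,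
    lt_min hc0 (div_pos (by linarith) (by linarith)), min_le_left _ _, hf₀c, ?_⟩
  intro J S a ha haS hS
  have haW : a * (S.card : ℝ) ^ (1 / p.toReal) * (2 : ℝ) ^ ((J : ℝ) * (s - 1 / p.toReal)) * W ≤
      (L - M) / 2 := by
    have h1 := haS.trans (min_le_right _ _)
    rw [le_div_iff₀ (by linarith)] at h1
    have h2 : 0 ≤ a * (S.card : ℝ) ^ (1 / p.toReal) * (2 : ℝ) ^ ((J : ℝ) * (s - 1 / p.toReal)) := by
      positivity
    linarith
  have hin : ∀ x, bumpSum g S (2 ^ J * x) ≠ 0 → x ∈ Ioo 0 (T / 2) := fun x hx =>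
    mem_Ioo_of_bumpSum_ne_zero hg hS hx
  have hip := hg.integrable_bumpSum J S
  -- Here `s ≥ 1/p` is needed: both remaining factors in the constraint are at least `1`, so the
  -- amplitude itself is at most `c` and positivity is preserved.
  have hac : S.Nonempty → a ≤ c := by
    intro hne
    refine le_trans ?_ (haS.trans (min_le_left _ _))
    rw [mul_assoc]
    refine le_mul_of_one_le_right ha (one_le_mul_of_one_le_of_one_le ?_ ?_)
    · refine Real.one_le_rpow ?_ (by positivity)
      exact_mod_cast hne.card_pos
    · exact Real.one_le_rpow one_le_two (mul_nonneg (Nat.cast_nonneg _) (by linarith))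
  have hcont : Continuous fun x => bumpSum g S (2 ^ J * x) :=
    (contDiff_bumpSum hg.contDiff S).continuous.comp (by fun_prop)
  have hf₀m : Measurable f₀ := (hf₁m.const_mul _).add (hg₀.measurable.const_mul _)
  refine ⟨hf₀m.add (hcont.measurable.const_mul a), fun x => ?_, hi₀.add (hip.const_mul a), ?_, ?_,
    ?_⟩
  · unfold perturbed
    by_cases hx : bumpSum g S (2 ^ J * x) = 0
    · rw [hx, mul_zero, add_zero]; exact hf₀0 x
    · have hne : S.Nonempty := by
        rw [Finset.nonempty_iff_ne_empty]
        rintro rfl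
        exact hx (by simp [bumpSum])
      have h1 := hf₀c x (Ioo_subset_Icc_self (hin x hx))
      have h2 := abs_bumpSum_le (fun y => hg.mem_of_ne) zero_le_one hg.abs_le S (2 ^ J * x)
      have h3 := hac hne
      have h4 := (abs_le.1 h2).1
      nlinarith
  · have : ∫ x, perturbed f₀ g J a S x = (∫ x, f₀ x) + ∫ x, a * bumpSum g S (2 ^ J * x) :=
      integral_add hi₀ (hip.const_mul a)
    rw [this, hf₀1, integral_const_mul, hg.integral_bumpSum, mul_zero, add_zero]
  · intro x hx
    by_contra hxT
    have h1 : f₁ x = 0 := by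
      by_contra h; exact hxT (hf₁s h)
    have h2 : g₀ x = 0 := by
      by_contra h; exact hxT (hg₀s h)
    have h3 : bumpSum g S (2 ^ J * x) = 0 := by
      by_contra h
      have := hin x h
      exact hxT ⟨by linarith [this.1], by linarith [this.2]⟩
    exact hx (by simp [perturbed, hf₀, h1, h2, h3])
  · have hpert : perturbed f₀ g J a S = f₀ + fun x => a * bumpSum g S (2 ^ J * x) := rfl
    rw [hpert]
    calc besovJ φ ψ s p q (f₀ + fun x => a * bumpSum g S (2 ^ J * x))
        ≤ ENNReal.ofReal (M + (L - M) / 2) + ENNReal.ofReal a * ENNReal.ofReal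
          (C * (G ^ (1 - 1 / p.toReal) * (S.card * G₁) ^ (1 / p.toReal)) *
            (2 : ℝ) ^ ((J : ℝ) * (s - 1 / p.toReal))) := by
          refine (besovJ_add_le hφ hψ hp hq hi₀ (hip.const_mul a)).trans (add_le_add hf₀J ?_)
          refine (besovJ_const_mul_le φ ψ s p q ha _).trans ?_
          gcongr
          exact hC _ _ _ (hG.bumpSum hg S) J
      _ ≤ ENNReal.ofReal (M + (L - M) / 2) + ENNReal.ofReal ((L - M) / 2) := by
          rw [← ENNReal.ofReal_mul ha]
          gcongr
          refine le_of_eq_of_le ?_ haW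
          rw [Real.mul_rpow (Nat.cast_nonneg _) hG₁0, hW]
          ring
      _ = ENNReal.ofReal L := by
          rw [← ENNReal.ofReal_add (by linarith) (by linarith)]
          congr 1; ring

/-! ### From estimation to testing: hypercube and single-cell bounds. -/

/-- Averaging over the vertices of a hypercube. -/
lemma mul_le_two_mul_of_cube {K : ℕ} {R η : ℝ≥0∞} (loss : Finset ℕ → ℕ → ℝ≥0∞)
    (hR : ∀ S ⊆ Finset.range K, ∑ k ∈ Finset.range K, loss S k ≤ R)
    (hη : ∀ k < K, ∀ S ⊆ Finset.range K, k ∉ S → η ≤ loss S k + loss (insert k S) k) :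
    K * η ≤ 2 * R := by
  rcases Nat.eq_zero_or_pos K with rfl | hK
  · simp
  have h1 : ∑ S ∈ (Finset.range K).powerset, ∑ k ∈ Finset.range K, loss S k ≤ 2 ^ K * R := by
    calc _ ≤ ∑ S ∈ (Finset.range K).powerset, R :=
          Finset.sum_le_sum fun S hS => hR S (Finset.mem_powerset.1 hS)
      _ = _ := by simp
  -- For fixed `k` the vertices split into `2 ^ (K - 1)` pairs `S`, `insert k S`, each contributing
  -- at least `η`.
  have h2 : ∀ k ∈ Finset.range K, 2 ^ (K - 1) * η ≤ ∑ S ∈ (Finset.range K).powerset, loss S k := by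
    intro k hk
    conv_rhs => rw [← Finset.insert_erase hk]
    rw [Finset.sum_powerset_insert (Finset.notMem_erase k _), ← Finset.sum_add_distrib]
    calc 2 ^ (K - 1) * η = ∑ S ∈ ((Finset.range K).erase k).powerset, η := by
          simp [Finset.card_erase_of_mem hk]
      _ ≤ _ := by
          refine Finset.sum_le_sum fun S hS => ?_
          have hS' := Finset.mem_powerset.1 hS
          exact hη k (Finset.mem_range.1 hk) S (hS'.trans (Finset.erase_subset _ _))
            fun h => Finset.notMem_erase k _ (hS' h)
  rw [Finset.sum_comm] at h1
  have h3 : 2 ^ (K - 1) * (K * η) ≤ 2 ^ (K - 1) * (2 * R) := by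
    calc 2 ^ (K - 1) * (K * η) = ∑ k ∈ Finset.range K, 2 ^ (K - 1) * η := by simp; ring
      _ ≤ _ := Finset.sum_le_sum h2
      _ ≤ 2 ^ K * R := h1
      _ = _ := by
          rw [← mul_assoc, ← pow_succ, Nat.sub_add_cancel hK]
  exact (ENNReal.mul_le_mul_iff_right (by simp) (by finiteness)).1 h3

/-- With `x = P A` and `x² ≤ 2 P' A`, the sum is at least `1 - x + x²/2 = (1 + (1 - x)²)/2`. -/
lemma half_le_measure_compl_add {α : Type*} [MeasurableSpace α] {P P' : Measure α}
    [IsProbabilityMeasure P] [IsProbabilityMeasure P'] {A : Set α} (hA : MeasurableSet A)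
    {Λ : ℝ≥0∞} (hΛ : Λ ≤ 2) (h : P A ^ 2 ≤ Λ * P' A) : 2⁻¹ ≤ P Aᶜ + P' A := by
  have h1 : P A ^ 2 ≤ 2 * P' A := h.trans (by gcongr)
  rw [prob_compl_eq_one_sub hA]
  have hx : P A ≤ 1 := prob_le_one
  have hy : P' A ≤ 1 := prob_le_one
  generalize P A = x at *
  generalize P' A = y at *
  lift x to NNReal using (lt_of_le_of_lt hx ENNReal.one_lt_top).ne
  lift y to NNReal using (lt_of_le_of_lt hy ENNReal.one_lt_top).ne
  have hx' : x ≤ 1 := by exact_mod_cast hx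
  have h1' : x ^ 2 ≤ 2 * y := by exact_mod_cast h1
  have h2 : (2 : ℝ≥0∞)⁻¹ = ((2⁻¹ : NNReal) : ℝ≥0∞) := by simp
  rw [h2]
  norm_cast
  rw [← NNReal.coe_le_coe] at h1' ⊢
  push_cast [NNReal.coe_sub hx'] at h1' ⊢
  nlinarith [sq_nonneg ((x : ℝ) - 1)]

/-- The dyadic cell `(k / 2 ^ J, (k + 1) / 2 ^ J)`. -/
def dyadicCell (J k : ℕ) : Set ℝ := {x | 2 ^ J * x - k ∈ Ioo (0 : ℝ) 1}

lemma measurableSet_dyadicCell (J k : ℕ) : MeasurableSet (dyadicCell J k) :=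
  measurableSet_Ioo.preimage (by fun_prop : Measurable fun x : ℝ => 2 ^ J * x - (k : ℝ))

lemma disjoint_dyadicCell {J k l : ℕ} (h : k ≠ l) : Disjoint (dyadicCell J k) (dyadicCell J l) := by
  rw [Set.disjoint_left]
  intro x hx hy
  have h1 : (l : ℝ) < k + 1 := by linarith [hx.2, hy.1]
  have h2 : (k : ℝ) < l + 1 := by linarith [hx.1, hy.2]
  norm_cast at h1 h2
  omega

/-- The loss on a dyadic cell. -/
def cellLoss (r : ℝ) (J k : ℕ) (u f : ℝ → ℝ) : ℝ≥0∞ :=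
  ∫⁻ x in dyadicCell J k, ENNReal.ofReal (|u x - f x| ^ r)

lemma sum_cellLoss_le (r : ℝ) (J : ℕ) (F : Finset ℕ) (u f : ℝ → ℝ) :
    ∑ k ∈ F, cellLoss r J k u f ≤ ∫⁻ x, ENNReal.ofReal (|u x - f x| ^ r) := by
  unfold cellLoss
  rw [← lintegral_biUnion_finset (fun k _ l _ h => disjoint_dyadicCell h)
    (fun k _ => measurableSet_dyadicCell J k)]
  exact setLIntegral_le_lintegral _ _

lemma measurable_cellLoss {𝒵 : Type u} [MeasurableSpace 𝒵] {n : ℕ} (r : ℝ) (J k : ℕ)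
    {est : (Fin n → 𝒵) → ℝ → ℝ} (hest : Measurable (Function.uncurry est)) {f : ℝ → ℝ}
    (hf : Measurable f) : Measurable fun z => cellLoss r J k (est z) f := by
  refine Measurable.lintegral_prod_right'
    (f := fun y : (Fin n → 𝒵) × ℝ => ENNReal.ofReal (|Function.uncurry est y - f y.2| ^ r)) ?_
  exact ((hest.sub (hf.comp measurable_snd)).abs.pow_const r).ennreal_ofReal

lemma sum_lintegral_cellLoss_le {𝒵 : Type u} [MeasurableSpace 𝒵] (Q : Mechanism 𝒵) {n : ℕ} (r : ℝ)
    (J : ℕ) (F : Finset ℕ) {est : (Fin n → 𝒵) → ℝ → ℝ} (hest : Measurable (Function.uncurry est))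
    {f : ℝ → ℝ} (hf : Measurable f) :
    ∑ k ∈ F, ∫⁻ z, cellLoss r J k (est z) f ∂privateLaw Q n f ≤ privateRisk r Q n est f := by
  rw [← lintegral_finsetSum _ fun k _ => measurable_cellLoss r J k hest hf]
  exact lintegral_mono fun z => sum_cellLoss_le r J F (est z) f

/-- The triangle inequality for `r`th powers, by convexity of `t ^ r`. -/
lemma two_rpow_mul_abs_add_rpow_le {r : ℝ} (hr : 1 ≤ r) (u v : ℝ) :
    (2 : ℝ) ^ (1 - r) * |u - v| ^ r ≤ |u| ^ r + |v| ^ r := by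
  have h1 : |u - v| ^ r ≤ (|u| + |v|) ^ r :=
    Real.rpow_le_rpow (abs_nonneg _) (abs_sub _ _) (by linarith)
  have h2 : (|u| + |v|) ^ r ≤ 2 ^ (r - 1) * (|u| ^ r + |v| ^ r) := by
    exact_mod_cast NNReal.rpow_add_le_mul_rpow_add_rpow (Real.nnabs u) (Real.nnabs v) hr
  calc (2 : ℝ) ^ (1 - r) * |u - v| ^ r
      ≤ 2 ^ (1 - r) * (2 ^ (r - 1) * (|u| ^ r + |v| ^ r)) := by gcongr; exact h1.trans h2
    _ = _ := by
        rw [← mul_assoc, ← Real.rpow_add two_pos]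
        simp

lemma perturbed_insert (f₀ g : ℝ → ℝ) (J : ℕ) (a : ℝ) {S : Finset ℕ} {k : ℕ} (hk : k ∉ S) (x : ℝ) :
    perturbed f₀ g J a (insert k S) x = perturbed f₀ g J a S x + a * g (2 ^ J * x - k) := by
  simp only [perturbed, bumpSum, Finset.sum_insert hk]
  ring

lemma IsBump.integrable_rpow {g : ℝ → ℝ} (hg : IsBump g) {r : ℝ} (hr : 1 ≤ r) :
    Integrable fun x => |g x| ^ r := by
  refine Continuous.integrable_of_hasCompactSupport
    (hg.contDiff.continuous.abs.rpow_const fun x => Or.inr (by linarith)) ?_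
  exact hg.compact.comp_left (g := fun y : ℝ => |y| ^ r)
    (by simp [Real.zero_rpow (by linarith : r ≠ 0)])

lemma IsBump.integral_rpow_pos {g : ℝ → ℝ} (hg : IsBump g) {r : ℝ} (hr : 1 ≤ r) :
    0 < ∫ x, |g x| ^ r := by
  obtain ⟨x₀, hx₀⟩ := hg.ne_zero
  refine Continuous.integral_pos_of_hasCompactSupport_nonneg_nonzero
    (hg.contDiff.continuous.abs.rpow_const fun x => Or.inr (by linarith)) ?_
    (fun x => by positivity) (x := x₀) ?_
  · exact hg.compact.comp_left (g := fun y : ℝ => |y| ^ r)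
      (by simp [Real.zero_rpow (by linarith : r ≠ 0)])
  · have := abs_pos.2 hx₀
    positivity

/-- Two perturbations that differ in one cell cannot both be close to the same function there. -/
lemma le_cellLoss_add {g : ℝ → ℝ} (hg : IsBump g) {r : ℝ} (hr : 1 ≤ r) (f₀ : ℝ → ℝ)
    (J : ℕ) {a : ℝ} (ha : 0 ≤ a) {S : Finset ℕ} {k : ℕ} (hk : k ∉ S) {u : ℝ → ℝ} (hu : Measurable u)
    (hf : Measurable (perturbed f₀ g J a S)) :
    ENNReal.ofReal (2 ^ (1 - r) * (a ^ r * ((2 ^ J)⁻¹ * ∫ x, |g x| ^ r))) ≤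
      cellLoss r J k u (perturbed f₀ g J a S) +
        cellLoss r J k u (perturbed f₀ g J a (insert k S)) := by
  set b : ℝ → ℝ := fun x => 2 ^ (1 - r) * (a ^ r * |g (2 ^ J * x - k)| ^ r) with hb
  have hb0 : ∀ x, 0 ≤ b x := fun x => by positivity
  have hbi : Integrable b :=
    ((integrable_comp_mul_sub (hg.integrable_rpow hr) (by positivity) _).const_mul _).const_mul _
  have hbI : ∫ x, b x = 2 ^ (1 - r) * (a ^ r * ((2 ^ J)⁻¹ * ∫ x, |g x| ^ r)) := by
    rw [integral_const_mul, integral_const_mul,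
      integral_comp_mul_sub (fun x => |g x| ^ r) (by positivity)]
  have hcell : ∫⁻ x, ENNReal.ofReal (b x) = ∫⁻ x in dyadicCell J k, ENNReal.ofReal (b x) := by
    rw [← lintegral_indicator (measurableSet_dyadicCell J k)]
    congr 1
    ext x
    by_cases hx : x ∈ dyadicCell J k
    · rw [indicator_of_mem hx]
    · rw [indicator_of_notMem hx]
      have : g (2 ^ J * x - k) = 0 := by
        by_contra h
        exact hx (hg.mem_of_ne h)
      simp [hb, this, Real.zero_rpow (by linarith : r ≠ 0)]
  rw [← hbI, ofReal_integral_eq_lintegral_ofReal hbi (Eventually.of_forall hb0), hcell]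
  unfold cellLoss
  have hm : Measurable fun x => ENNReal.ofReal (|u x - perturbed f₀ g J a S x| ^ r) :=
    ((hu.sub hf).abs.pow_const r).ennreal_ofReal
  rw [← lintegral_add_left hm]
  refine lintegral_mono fun x => ?_
  rw [← ENNReal.ofReal_add (by positivity) (by positivity)]
  refine ENNReal.ofReal_le_ofReal ?_
  refine le_trans (le_of_eq ?_) (two_rpow_mul_abs_add_rpow_le hr _ _)
  rw [perturbed_insert _ _ _ _ hk, hb]
  simp only
  rw [← Real.mul_rpow ha (abs_nonneg _), ← abs_of_nonneg ha, ← abs_mul, abs_of_nonneg ha]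
  congr 3
  ring

lemma InfoBound.mono {𝒵 : Type u} [MeasurableSpace 𝒵] {Q : Mechanism 𝒵} {n : ℕ} {f g : ℝ → ℝ}
    {D D' : ℝ} (h : InfoBound Q n f g D) (hD : D ≤ D') : InfoBound Q n f g D' := fun A hA =>
  (h A hA).trans (by gcongr)

/-- Lower bound on the maximal risk over a hypercube of perturbations. -/
theorem le_risk_of_cube {𝒵 : Type u} [MeasurableSpace 𝒵] {Q : Mechanism 𝒵}
    (hQ : ∀ i, IsMarkovKernel (Q i)) {n : ℕ} {est : (Fin n → 𝒵) → ℝ → ℝ}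
    (hest : Measurable (Function.uncurry est)) {r : ℝ} (hr : 1 ≤ r) {f₀ g : ℝ → ℝ} (hg : IsBump g)
    {J K : ℕ} {a : ℝ} (ha : 0 ≤ a) {R : ℝ≥0∞} {D : ℝ} (hD : Real.exp D ≤ 2)
    (hden : ∀ S ⊆ Finset.range K, IsDensity (perturbed f₀ g J a S))
    (hR : ∀ S ⊆ Finset.range K, privateRisk r Q n est (perturbed f₀ g J a S) ≤ R)
    (hinfo : ∀ k < K, ∀ S ⊆ Finset.range K, k ∉ S →
      InfoBound Q n (perturbed f₀ g J a S) (perturbed f₀ g J a (insert k S)) D) :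
    ENNReal.ofReal (K * (2 ^ (1 - r) * (a ^ r * ((2 ^ J)⁻¹ * ∫ x, |g x| ^ r))) / 8) ≤ R := by
  set β := 2 ^ (1 - r) * (a ^ r * ((2 ^ J)⁻¹ * ∫ x, |g x| ^ r)) with hβ
  have hγ := hg.integral_rpow_pos hr
  have hβ0 : 0 ≤ β := by positivity
  have key := mul_le_two_mul_of_cube (K := K) (R := R) (η := ENNReal.ofReal (β / 2) * 2⁻¹)
    (fun S k => ∫⁻ z, cellLoss r J k (est z) (perturbed f₀ g J a S)
      ∂privateLaw Q n (perturbed f₀ g J a S))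
    (fun S hS => (sum_lintegral_cellLoss_le Q r J _ hest (hden S hS).measurable).trans (hR S hS)) ?_
  · have h2 : (K : ℝ≥0∞) * (ENNReal.ofReal (β / 2) * 2⁻¹) = 2 * ENNReal.ofReal (K * β / 8) := by
      have h3 : (2 : ℝ≥0∞) = ENNReal.ofReal 2 := by simp
      have h4 : (K : ℝ≥0∞) = ENNReal.ofReal K := by simp
      rw [h3, ← ENNReal.ofReal_inv_of_pos two_pos, h4, ← ENNReal.ofReal_mul (by positivity),
        ← ENNReal.ofReal_mul (by positivity), ← ENNReal.ofReal_mul (by positivity)]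
      congr 1
      ring
    rw [h2] at key
    exact (ENNReal.mul_le_mul_iff_right (by simp) (by simp)).1 key
  · intro k hk S hS hkS
    have hS' : insert k S ⊆ Finset.range K := Finset.insert_subset (Finset.mem_range.2 hk) hS
    have hf := hden S hS
    have hf' := hden _ hS'
    have := isProbabilityMeasure_privateLaw hQ n hf
    have := isProbabilityMeasure_privateLaw hQ n hf'
    have hm := measurable_cellLoss r J k hest hf.measurable
    have hm' := measurable_cellLoss r J k hest hf'.measurable
    have htri : ∀ z, ENNReal.ofReal β ≤ cellLoss r J k (est z) (perturbed f₀ g J a S) +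
        cellLoss r J k (est z) (perturbed f₀ g J a (insert k S)) := fun z =>
      le_cellLoss_add hg hr f₀ J ha hkS (hest.comp (measurable_const.prodMk measurable_id))
        hf.measurable
    -- The test accepts `S` when the estimator has loss below `β / 2` on cell `k`; then its loss
    -- against `insert k S` is at least `β / 2`. Since the two errors sum to at least `1/2`, a pair
    -- contributes `β / 4`, and the cube average then gives `K β / 8`.
    set A : Set (Fin n → 𝒵) := {z | cellLoss r J k (est z) (perturbed f₀ g J a S) <
      ENNReal.ofReal (β / 2)} with hA
    have hAm : MeasurableSet A := measurableSet_lt hm measurable_const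
    have htp := half_le_measure_compl_add hAm
      (by simpa using ENNReal.ofReal_le_ofReal hD) (hinfo k hk S hS hkS A hAm)
    calc ENNReal.ofReal (β / 2) * 2⁻¹ ≤ ENNReal.ofReal (β / 2) *
          (privateLaw Q n (perturbed f₀ g J a S) Aᶜ +
            privateLaw Q n (perturbed f₀ g J a (insert k S)) A) := by gcongr
      _ ≤ _ := by
        rw [mul_add]
        refine add_le_add ?_ ?_
        · refine le_trans ?_ (mul_meas_ge_le_lintegral hm (ENNReal.ofReal (β / 2)))
          gcongr
          intro z hz
          simpa [hA] using hz
        · refine le_trans ?_ (mul_meas_ge_le_lintegral hm' (ENNReal.ofReal (β / 2)))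
          gcongr
          intro z hz
          by_contra hlt
          have h1 := ENNReal.add_lt_add hz (not_le.1 hlt)
          rw [← ENNReal.ofReal_add (by positivity) (by positivity), add_halves] at h1
          exact absurd (htri z) (not_le.2 h1)

/-- Lower bound on the maximal risk over perturbations in a single cell. -/
theorem le_risk_of_single {𝒵 : Type u} [MeasurableSpace 𝒵] {Q : Mechanism 𝒵}
    (hQ : ∀ i, IsMarkovKernel (Q i)) {n : ℕ} {est : (Fin n → 𝒵) → ℝ → ℝ}
    (hest : Measurable (Function.uncurry est)) {r : ℝ} (hr : 1 ≤ r) {f₀ g : ℝ → ℝ} (hg : IsBump g)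
    {J K : ℕ} {a : ℝ} (ha : 0 ≤ a) {R : ℝ≥0∞} {D : ℝ} (hK : 0 < K) (hD : Real.exp D ≤ 2 * K)
    (hden₀ : IsDensity (perturbed f₀ g J a ∅))
    (hden : ∀ k < K, IsDensity (perturbed f₀ g J a {k}))
    (hR₀ : privateRisk r Q n est (perturbed f₀ g J a ∅) ≤ R)
    (hR : ∀ k < K, privateRisk r Q n est (perturbed f₀ g J a {k}) ≤ R)
    (hinfo : ∀ k < K, InfoBound Q n (perturbed f₀ g J a {k}) (perturbed f₀ g J a ∅) D) :
    ENNReal.ofReal (2 ^ (1 - r) * (a ^ r * ((2 ^ J)⁻¹ * ∫ x, |g x| ^ r)) / 8) ≤ R := by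
  set β := 2 ^ (1 - r) * (a ^ r * ((2 ^ J)⁻¹ * ∫ x, |g x| ^ r)) with hβ
  by_contra! hlt
  have hβ0 : 0 < β := by
    have := (zero_le (a := R)).trans_lt hlt
    rw [ENNReal.ofReal_pos] at this
    linarith
  set δ := ENNReal.ofReal (β / 2) with hδ
  have hRreal : ∀ x : ℝ≥0∞, δ * x ≤ R → x.toReal ≤ 1 / 4 := by
    intro x hx
    have h1 := ENNReal.toReal_mono ENNReal.ofReal_ne_top (hx.trans hlt.le)
    rw [ENNReal.toReal_mul, hδ, ENNReal.toReal_ofReal (by positivity),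
      ENNReal.toReal_ofReal (by positivity)] at h1
    by_contra! h2
    nlinarith
  have hm : ∀ k < K, Measurable fun z => cellLoss r J k (est z) (perturbed f₀ g J a {k}) :=
    fun k hk => measurable_cellLoss r J k hest (hden k hk).measurable
  have hm₀ : ∀ k, Measurable fun z => cellLoss r J k (est z) (perturbed f₀ g J a ∅) :=
    fun k => measurable_cellLoss r J k hest hden₀.measurable
  set A : ℕ → Set (Fin n → 𝒵) := fun k =>
    {z | cellLoss r J k (est z) (perturbed f₀ g J a {k}) < δ} with hA
  have hAm : ∀ k < K, MeasurableSet (A k) := fun k hk => measurableSet_lt (hm k hk) measurable_const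
  have hP₀ := isProbabilityMeasure_privateLaw hQ n hden₀
  have htri : ∀ k < K, ∀ z ∈ A k, δ ≤ cellLoss r J k (est z) (perturbed f₀ g J a ∅) := by
    intro k hk z hz
    have h1 := le_cellLoss_add hg hr f₀ J ha (Finset.notMem_empty k)
      (hest.comp (measurable_const.prodMk measurable_id) : Measurable (est z)) hden₀.measurable
    by_contra hle
    have h2 := ENNReal.add_lt_add (not_le.1 hle) hz
    rw [← ENNReal.ofReal_add (by positivity) (by positivity), add_halves] at h2
    exact absurd h1 (not_le.2 h2)
  -- On `A k` the estimator is far from the unperturbed density in cell `k`. The cells are disjoint,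
  -- so these losses add up within one risk, and the total null probability of the `A k` is at most
  -- `1/4`.
  have hsum : ∑ k ∈ Finset.range K, (privateLaw Q n (perturbed f₀ g J a ∅) (A k)).toReal ≤ 1 / 4 := by
    rw [← ENNReal.toReal_sum fun k _ => measure_ne_top _ _]
    refine hRreal _ (le_trans ?_ ((sum_lintegral_cellLoss_le Q r J (Finset.range K) hest
      hden₀.measurable).trans hR₀))
    rw [Finset.mul_sum]
    refine Finset.sum_le_sum fun k hk => le_trans ?_ (mul_meas_ge_le_lintegral (hm₀ k) δ)
    gcongr
    exact fun z hz => htri k (Finset.mem_range.1 hk) z hz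
  -- Under its own perturbation `A k` has probability at least `3/4`, and `9/16 = (3/4)²`. Summing
  -- over `k` gives `9K/16 ≤ 2K/4`, a contradiction. That `exp D` may be as large as `2K` is the
  -- origin of the logarithms.
  have hone : ∀ k ∈ Finset.range K, (9 / 16 : ℝ) ≤
      2 * K * (privateLaw Q n (perturbed f₀ g J a ∅) (A k)).toReal := by
    intro k hk
    rw [Finset.mem_range] at hk
    have hP := isProbabilityMeasure_privateLaw hQ n (hden k hk)
    have h1 : (privateLaw Q n (perturbed f₀ g J a {k}) (A k)ᶜ).toReal ≤ 1 / 4 := by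
      refine hRreal _ (le_trans ?_ ((sum_lintegral_cellLoss_le Q r J {k} hest
        (hden k hk).measurable).trans (hR k hk)))
      rw [Finset.sum_singleton]
      refine le_trans ?_ (mul_meas_ge_le_lintegral (hm k hk) δ)
      gcongr
      exact fun z hz => by simpa [hA] using hz
    have h2 := measureReal_compl (μ := privateLaw Q n (perturbed f₀ g J a {k})) (hAm k hk)
    rw [probReal_univ] at h2
    have h3 := ENNReal.toReal_mono (by finiteness) (hinfo k hk (A k) (hAm k hk))
    rw [ENNReal.toReal_pow, ENNReal.toReal_mul, ENNReal.toReal_ofReal (Real.exp_pos _).le] at h3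
    have h4 : (3 / 4 : ℝ) ≤ (privateLaw Q n (perturbed f₀ g J a {k}) (A k)).toReal := by
      simp only [Measure.real] at h2
      linarith
    calc (9 / 16 : ℝ) ≤ (privateLaw Q n (perturbed f₀ g J a {k}) (A k)).toReal ^ 2 := by nlinarith
      _ ≤ _ := h3
      _ ≤ _ := by gcongr
  have htot := Finset.sum_le_sum hone
  rw [← Finset.mul_sum] at htot
  simp only [Finset.sum_const, Finset.card_range, nsmul_eq_mul] at htot
  have hK' : (0 : ℝ) < K := by exact_mod_cast hK
  nlinarith

lemma integral_le_one_of_le_one {h : ℝ → ℝ} (h0 : ∀ x, 0 ≤ h x) (h1 : ∀ x, h x ≤ 1)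
    (hs : ∀ x, x ∉ Ioo (0 : ℝ) 1 → h x = 0) : ∫ x, h x ≤ 1 := by
  rw [← setIntegral_eq_integral_of_forall_compl_eq_zero (s := Ioo (0 : ℝ) 1) hs]
  refine (Real.le_norm_self _).trans ?_
  have := norm_setIntegral_le_of_norm_le_const (μ := volume) (s := Ioo (0 : ℝ) 1) (f := h) (C := 1)
    (by simp) fun x _ => by rw [Real.norm_of_nonneg (h0 x)]; exact h1 x
  simpa using this

lemma IsBump.integral_abs_le_one {g : ℝ → ℝ} (hg : IsBump g) : ∫ x, |g x| ≤ 1 :=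
  integral_le_one_of_le_one (fun _ => abs_nonneg _) hg.abs_le fun x hx => by
    by_contra h
    exact hx (hg.mem_of_ne fun h0 => h (by rw [h0, abs_zero]))

lemma IsBump.integral_sq_le_one {g : ℝ → ℝ} (hg : IsBump g) : ∫ x, |g x| ^ 2 ≤ 1 :=
  integral_le_one_of_le_one (fun _ => by positivity)
    (fun x => pow_le_one₀ (abs_nonneg _) (hg.abs_le x)) fun x hx => by
      by_contra h
      exact hx (hg.mem_of_ne fun h0 => h (by rw [h0]; simp))

/-! ### Choice of scale and amplitude, and the rates. -/

/-- The information about a perturbation of amplitude `a` and scale `2 ^ J` in `n` private views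
is of order `y * a ^ 2 * 2 ^ (-J * ι)`. -/
def InfoScale {𝒵 : Type u} [MeasurableSpace 𝒵] (g : ℝ → ℝ) (Q : Mechanism 𝒵) (n : ℕ)
    (y ι : ℝ) : Prop :=
  ∀ f f' : ℝ → ℝ, IsDensity f → IsDensity f' → ∀ (J k : ℕ) (a c : ℝ), 0 ≤ a → 0 < c → c ≤ 1 →
    (∀ x, |f x - f' x| = a * |g (2 ^ J * x - k)|) → (∀ x, f x ≠ f' x → c ≤ f' x) →
    InfoBound Q n f f' (y * a ^ 2 * ((2 : ℝ) ^ ((J : ℝ) * ι))⁻¹ / c)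

/-- Without privacy the information is governed by the squared `L²` norm of one bump, which is at
most `a² 2^(-J)`: hence `ι = 1`. -/
lemma infoScale_one {𝒵 : Type u} [MeasurableSpace 𝒵] {g : ℝ → ℝ} (hg : IsBump g) {Q : Mechanism 𝒵}
    (hQ : ∀ i, IsMarkovKernel (Q i)) (n : ℕ) : InfoScale g Q n n 1 := by
  intro f f' hf hf' J k a c ha hc _ hdiff hlow
  have hi2 : Integrable fun x => |g x| ^ 2 := by
    simpa using hg.integrable_rpow one_le_two
  have hsq : (fun x => (f x - f' x) ^ 2) = fun x => a ^ 2 * |g (2 ^ J * x - k)| ^ 2 := by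
    ext x; rw [← sq_abs, hdiff, mul_pow]
  refine (infoBound_of_sq hQ hf hf' hc hlow (χ := a ^ 2 * (2 ^ J)⁻¹) ?_ ?_ n).mono (le_of_eq ?_)
  · rw [hsq]
    exact (integrable_comp_mul_sub hi2 (by positivity) _).const_mul _
  · rw [hsq, integral_const_mul, integral_comp_mul_sub (fun x => |g x| ^ 2) (by positivity)]
    gcongr
    exact mul_le_of_le_one_right (by positivity) hg.integral_sq_le_one
  · rw [mul_one, Real.rpow_natCast]; ring

/-- Privacy brings in the squared `L¹` norm, at most `a² 2^(-2J)`: hence `ι = 2`. The division by `c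
≤ 1` only weakens the bound and makes its form common to both cases. -/
lemma infoScale_two {𝒵 : Type u} [MeasurableSpace 𝒵] {g : ℝ → ℝ} (hg : IsBump g) {Q : Mechanism 𝒵}
    {α : ℝ} (hα : 0 ≤ α) (hQ : LocallyPrivate α Q) (n : ℕ) :
    InfoScale g Q n (n * (Real.exp α - 1) ^ 2) 2 := by
  intro f f' hf hf' J k a c ha hc hc1 hdiff _
  refine (infoBound_of_private hα hQ hf hf' (τ := a * (2 ^ J)⁻¹) ?_ n).mono ?_
  · simp only [hdiff]
    rw [integral_const_mul, integral_comp_mul_sub (fun x => |g x|) (by positivity)]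
    gcongr
    exact mul_le_of_le_one_right (by positivity) hg.integral_abs_le_one
  · rw [le_div_iff₀ hc]
    refine (mul_le_of_le_one_right (by positivity) hc1).trans (le_of_eq ?_)
    rw [Real.rpow_mul two_pos.le, Real.rpow_natCast, Real.rpow_two, mul_pow, inv_pow]
    ring

/-- A class of densities containing the local perturbations of a density. -/
structure IsPerturbationFamily (F : Set (ℝ → ℝ)) (f₀ g : ℝ → ℝ) (s ρ c a₀ T : ℝ) : Prop where
  bump : IsBump g
  c_pos : 0 < c
  c_le : c ≤ 1
  a₀_pos : 0 < a₀
  a₀_le : a₀ ≤ c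
  T_pos : 0 < T
  base : ∀ x ∈ Icc 0 T, 2 * c ≤ f₀ x
  isDensity : ∀ f ∈ F, IsDensity f
  mem : ∀ (J : ℕ) (S : Finset ℕ) (a : ℝ), 0 ≤ a →
    a * (S.card : ℝ) ^ ρ * (2 : ℝ) ^ ((J : ℝ) * (s - ρ)) ≤ a₀ →
    (∀ k ∈ S, (k : ℝ) + 1 ≤ 2 ^ J * T) → perturbed f₀ g J a S ∈ F

section Family

variable {F : Set (ℝ → ℝ)} {f₀ g : ℝ → ℝ} {s ρ c a₀ T : ℝ}

/-- On the support of the added bump `f₀ ≥ 2c` and the perturbation is at least `-a ≥ -c`, so both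
densities are at least `c` there. Both orders are needed: the hypercube compares `S` with `insert k
S`, the single-cell argument `{k}` with `∅`. -/
lemma IsPerturbationFamily.infoBound (H : IsPerturbationFamily F f₀ g s ρ c a₀ T)
    {𝒵 : Type u} [MeasurableSpace 𝒵] {Q : Mechanism 𝒵} {n : ℕ} {y ι : ℝ}
    (hI : InfoScale g Q n y ι) {J : ℕ} {S : Finset ℕ} {a : ℝ} (ha : 0 ≤ a) (hac : a ≤ c) {k : ℕ}
    (hk : k ∉ S) (hkT : (k : ℝ) + 1 ≤ 2 ^ J * T) (h : perturbed f₀ g J a S ∈ F)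
    (h' : perturbed f₀ g J a (insert k S) ∈ F) :
    InfoBound Q n (perturbed f₀ g J a S) (perturbed f₀ g J a (insert k S))
        (y * a ^ 2 * ((2 : ℝ) ^ ((J : ℝ) * ι))⁻¹ / c) ∧
      InfoBound Q n (perturbed f₀ g J a (insert k S)) (perturbed f₀ g J a S)
        (y * a ^ 2 * ((2 : ℝ) ^ ((J : ℝ) * ι))⁻¹ / c) := by
  have hdiff : ∀ x, perturbed f₀ g J a (insert k S) x - perturbed f₀ g J a S x =
      a * g (2 ^ J * x - k) := fun x => by
    rw [perturbed_insert _ _ _ _ hk]; ring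
  have hlow : ∀ x, g (2 ^ J * x - k) ≠ 0 → ∀ S', c ≤ perturbed f₀ g J a S' x := by
    intro x hx S'
    have hm := H.bump.mem_of_ne hx
    have h2 : (0 : ℝ) < 2 ^ J := by positivity
    have hk0 : (0 : ℝ) ≤ k := Nat.cast_nonneg k
    have hxT : x ∈ Icc 0 T := by
      constructor
      · by_contra! h; nlinarith [hm.1]
      · by_contra! h; nlinarith [hm.2]
    have h1 := H.base x hxT
    have h3 := (abs_le.1 (abs_bumpSum_le (fun y => H.bump.mem_of_ne) zero_le_one H.bump.abs_le S'
      (2 ^ J * x))).1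
    unfold perturbed
    nlinarith
  constructor
  · refine hI _ _ (H.isDensity _ h) (H.isDensity _ h') J k a c ha H.c_pos H.c_le (fun x => ?_)
      fun x hx => hlow x ?_ _
    · rw [abs_sub_comm, hdiff, abs_mul, abs_of_nonneg ha]
    · intro h0
      have := hdiff x
      rw [h0, mul_zero, sub_eq_zero] at this
      exact hx this.symm
  · refine hI _ _ (H.isDensity _ h') (H.isDensity _ h) J k a c ha H.c_pos H.c_le (fun x => ?_)
      fun x hx => hlow x ?_ _
    · rw [hdiff, abs_mul, abs_of_nonneg ha]
    · intro h0
      have := hdiff x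
      rw [h0, mul_zero, sub_eq_zero] at this
      exact hx this

/-- `J` is the least natural number with `x ≤ 2^(Jκ)`; rounding up costs at most a factor `2` in
`2^J`. -/
lemma exists_dyadic_scale {x κ : ℝ} (hx : 1 ≤ x) (hκ : 0 < κ) :
    ∃ J : ℕ, x ≤ (2 : ℝ) ^ ((J : ℝ) * κ) ∧ x ^ (1 / κ) ≤ 2 ^ J ∧ (2 : ℝ) ^ J ≤ 2 * x ^ (1 / κ) := by
  have hx0 : 0 < x := by linarith
  set w := Real.logb 2 x / κ with hw
  have hw0 : 0 ≤ w := div_nonneg (Real.logb_nonneg one_lt_two hx) hκ.le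
  have hxw : x ^ (1 / κ) = (2 : ℝ) ^ w := by
    rw [hw, div_eq_mul_one_div (Real.logb 2 x), Real.rpow_mul two_pos.le, Real.rpow_logb two_pos (by norm_num) hx0]
  have hxw' : x = (2 : ℝ) ^ (w * κ) := by
    rw [hw, div_mul_cancel₀ _ hκ.ne', Real.rpow_logb two_pos (by norm_num) hx0]
  refine ⟨⌈w⌉₊, ?_, ?_, ?_⟩
  · conv_lhs => rw [hxw']
    exact Real.rpow_le_rpow_of_exponent_le one_le_two (by gcongr; exact Nat.le_ceil w)
  · rw [hxw, ← Real.rpow_natCast]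
    exact Real.rpow_le_rpow_of_exponent_le one_le_two (Nat.le_ceil w)
  · rw [hxw, ← Real.rpow_natCast, ← Real.rpow_one_add' two_pos.le (by linarith)]
    exact Real.rpow_le_rpow_of_exponent_le one_le_two (by linarith [Nat.ceil_lt_add_one hw0])

end Family

lemma half_le_natFloor {t : ℝ} (ht : 1 ≤ t) : t / 2 ≤ ⌊t⌋₊ := by
  have h1 := Nat.lt_floor_add_one t
  have h2 : (1 : ℝ) ≤ ⌊t⌋₊ := by exact_mod_cast Nat.le_floor (by simpa using ht)
  linarith

lemma amplitude_rpow {a₁ : ℝ} (ha₁ : 0 ≤ a₁) (J : ℕ) (σ r : ℝ) :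
    (a₁ * ((2 : ℝ) ^ ((J : ℝ) * σ))⁻¹) ^ r = a₁ ^ r * ((2 : ℝ) ^ J) ^ (-(r * σ)) := by
  rw [Real.mul_rpow ha₁ (by positivity), ← Real.rpow_neg two_pos.le, ← Real.rpow_mul two_pos.le,
    ← Real.rpow_natCast, ← Real.rpow_mul two_pos.le]
  congr 2
  ring

lemma rpow_neg_dyadic_ge {x κ θ : ℝ} (hx : 0 < x) (hθ : 0 ≤ θ) {J : ℕ}
    (hJ : (2 : ℝ) ^ J ≤ 2 * x ^ (1 / κ)) :
    (2 : ℝ) ^ (-θ) * x ^ (-(θ / κ)) ≤ ((2 : ℝ) ^ J) ^ (-θ) := by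
  calc (2 : ℝ) ^ (-θ) * x ^ (-(θ / κ)) = (2 * x ^ (1 / κ)) ^ (-θ) := by
        rw [Real.mul_rpow two_pos.le (by positivity), ← Real.rpow_mul hx.le]
        congr 2
        ring
    _ ≤ _ := Real.rpow_le_rpow_of_nonpos (by positivity) hJ (by linarith)

/-- The balance that fixes the rates: amplitude `a₁ 2^(-Jσ)` carries information at most `y a₁²
2^(-Jκ) / c`. Taking `x = y` keeps it bounded, and `x = y / log y` makes it a small multiple of `log
y`. -/
lemma info_amplitude_le {y x κ σ ι a₁ c : ℝ} (hκ : κ = 2 * σ + ι) (hx : 0 < x) (hy : 0 ≤ y)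
    (ha₁ : 0 ≤ a₁) (hac : a₁ ≤ c) (hc : 0 < c) {J : ℕ} (hJ : x ≤ (2 : ℝ) ^ ((J : ℝ) * κ)) :
    y * (a₁ * ((2 : ℝ) ^ ((J : ℝ) * σ))⁻¹) ^ 2 * ((2 : ℝ) ^ ((J : ℝ) * ι))⁻¹ / c ≤ y / x * a₁ := by
  have h1 : (2 : ℝ) ^ ((J : ℝ) * κ) =
      (2 : ℝ) ^ ((J : ℝ) * σ) * (2 : ℝ) ^ ((J : ℝ) * σ) * (2 : ℝ) ^ ((J : ℝ) * ι) := by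
    rw [← Real.rpow_add two_pos, ← Real.rpow_add two_pos, hκ]
    congr 1
    ring
  rw [h1] at hJ
  set A := (2 : ℝ) ^ ((J : ℝ) * σ)
  set B := (2 : ℝ) ^ ((J : ℝ) * ι)
  have hA : 0 < A := by positivity
  have hB : 0 < B := by positivity
  rw [div_le_iff₀ hc]
  calc y * (a₁ * A⁻¹) ^ 2 * B⁻¹ = y * (a₁ * a₁) * (A * A * B)⁻¹ := by
        rw [mul_inv, mul_inv]; ring
    _ ≤ y * (a₁ * c) * x⁻¹ := by gcongr
    _ = y / x * a₁ * c := by ring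

section Family

variable {F : Set (ℝ → ℝ)} {f₀ g : ℝ → ℝ} {s ρ c a₀ T : ℝ}

lemma eventually_exists_nat {P : ℝ → Prop} (h : ∀ᶠ y in atTop, P y) :
    ∃ n₀ : ℕ, ∀ y : ℝ, (n₀ : ℝ) ≤ y → P y := by
  obtain ⟨a, ha⟩ := eventually_atTop.1 h
  exact ⟨⌈a⌉₊, fun y hy => ha y ((Nat.le_ceil a).trans hy)⟩

/-- The lower bound from perturbations in all cells. -/
theorem IsPerturbationFamily.dense_rate (H : IsPerturbationFamily F f₀ g s ρ c a₀ T) (hs : 0 < s)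
    (hρ : 0 ≤ ρ) (hρ1 : ρ ≤ 1) {r : ℝ} (hr : 1 ≤ r) {ι : ℝ} (hι : 0 < ι) :
    ∃ C : ℝ, 0 < C ∧ ∃ n₀ : ℕ, ∀ (𝒵 : Type u) [MeasurableSpace 𝒵] (Q : Mechanism 𝒵),
      (∀ i, IsMarkovKernel (Q i)) → ∀ (n : ℕ) (est : (Fin n → 𝒵) → ℝ → ℝ),
      Measurable (Function.uncurry est) → ∀ y : ℝ, (n₀ : ℝ) ≤ y → InfoScale g Q n y ι →
      ∀ R : ℝ≥0∞, (∀ f ∈ F, privateRisk r Q n est f ≤ R) →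
        ENNReal.ofReal (C * y ^ (-(r * s / (2 * s + ι)))) ≤ R := by
  set κ := 2 * s + ι with hκ
  have hκ0 : 0 < κ := by positivity
  have hc := H.c_pos
  have ha₀ := H.a₀_pos
  have hT := H.T_pos
  -- About `2^J T` bumps give a factor `T ^ ρ` in the Besov constraint, and `T ^ ρ ≤ T₁` as `0 ≤ ρ ≤
  -- 1`. The bound `a₁ ≤ c / 2 ≤ 1/2 < log 2` below keeps `exp D ≤ 2`.
  set T₁ := max T 1
  have hT₁ : 1 ≤ T₁ := le_max_right _ _
  have hT₁0 : 0 < T₁ := by linarith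
  set a₁ := min (a₀ / T₁) (c / 2) with ha₁
  have ha₁0 : 0 < a₁ := by positivity
  have ha₁c : a₁ ≤ c / 2 := min_le_right _ _
  have ha₁T : a₁ * T₁ ≤ a₀ := by
    have : a₁ ≤ a₀ / T₁ := min_le_left _ _
    rwa [le_div_iff₀ hT₁0] at this
  set γ := ∫ x, |g x| ^ r
  have hγ : 0 < γ := H.bump.integral_rpow_pos hr
  have hev : ∀ᶠ y : ℝ in atTop, 1 ≤ y ∧ 1 / T ≤ y ^ (1 / κ) :=
    (eventually_ge_atTop 1).and ((tendsto_rpow_atTop (by positivity)).eventually_ge_atTop _)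
  obtain ⟨n₀, hn₀⟩ := eventually_exists_nat hev
  refine ⟨T * 2 ^ (1 - r) * γ / 16 * a₁ ^ r * 2 ^ (-(r * s)), by positivity, n₀, ?_⟩
  intro 𝒵 _ Q hQ n est hest y hy hI R hR
  obtain ⟨hy1, hyT⟩ := hn₀ y hy
  have hy0 : 0 < y := by linarith
  obtain ⟨J, hJ1, hJ2, hJ3⟩ := exists_dyadic_scale hy1 hκ0
  set a := a₁ * ((2 : ℝ) ^ ((J : ℝ) * s))⁻¹ with ha
  have ha0 : 0 ≤ a := by positivity
  have haa₁ : a ≤ a₁ := by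
    refine mul_le_of_le_one_right ha₁0.le (inv_le_one_of_one_le₀ ?_)
    exact Real.one_le_rpow one_le_two (by positivity)
  have h2J : (0 : ℝ) < 2 ^ J := by positivity
  have hJT : 1 ≤ 2 ^ J * T := by
    have := hyT.trans hJ2
    rwa [div_le_iff₀ hT] at this
  set K := ⌊(2 : ℝ) ^ J * T⌋₊ with hK
  have hKT : (K : ℝ) ≤ 2 ^ J * T := Nat.floor_le (by positivity)
  have hKl : 2 ^ J * T / 2 ≤ K := half_le_natFloor hJT
  have hcell : ∀ k < K, (k : ℝ) + 1 ≤ 2 ^ J * T := fun k hk => by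
    have : (k : ℝ) + 1 ≤ K := by exact_mod_cast hk
    linarith
  have hmem : ∀ S ⊆ Finset.range K, perturbed f₀ g J a S ∈ F := by
    intro S hS
    refine H.mem J S a ha0 ?_ fun k hk => hcell k (Finset.mem_range.1 (hS hk))
    have hcard : (S.card : ℝ) ≤ 2 ^ J * T := by
      refine le_trans ?_ hKT
      exact_mod_cast (Finset.card_le_card hS).trans_eq (Finset.card_range K)
    calc a * (S.card : ℝ) ^ ρ * (2 : ℝ) ^ ((J : ℝ) * (s - ρ))
        ≤ a * (2 ^ J * T) ^ ρ * (2 : ℝ) ^ ((J : ℝ) * (s - ρ)) := by gcongr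
      _ = a₁ * T ^ ρ := by
          rw [Real.mul_rpow h2J.le hT.le, ← Real.rpow_natCast, ← Real.rpow_mul two_pos.le, mul_sub,
            Real.rpow_sub two_pos, ha]
          field_simp
      _ ≤ a₁ * T₁ := by
          gcongr
          calc T ^ ρ ≤ T₁ ^ ρ := Real.rpow_le_rpow hT.le (le_max_left _ _) hρ
            _ ≤ T₁ ^ (1 : ℝ) := Real.rpow_le_rpow_of_exponent_le hT₁ hρ1
            _ = T₁ := Real.rpow_one _
      _ ≤ a₀ := ha₁T
  have hD := info_amplitude_le (c := c) hκ hy0 hy0.le ha₁0.le (by linarith) hc hJ1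
  rw [div_self hy0.ne', one_mul] at hD
  have hrisk := le_risk_of_cube hQ hest hr H.bump (J := J) (K := K) ha0 (R := R)
    (D := y * a ^ 2 * ((2 : ℝ) ^ ((J : ℝ) * ι))⁻¹ / c) ?_
    (fun S hS => H.isDensity _ (hmem S hS)) (fun S hS => hR _ (hmem S hS))
    (fun k hk S hS hkS => (H.infoBound hI ha0 (by linarith) hkS (hcell k hk) (hmem S hS)
      (hmem _ (Finset.insert_subset (Finset.mem_range.2 hk) hS))).1)
  · refine le_trans (ENNReal.ofReal_le_ofReal ?_) hrisk
    rw [ha, amplitude_rpow ha₁0.le]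
    have hpow := rpow_neg_dyadic_ge hy0 (by positivity : 0 ≤ r * s) hJ3
    calc T * 2 ^ (1 - r) * γ / 16 * a₁ ^ r * 2 ^ (-(r * s)) * y ^ (-(r * s / κ))
        = T * 2 ^ (1 - r) * γ / 16 * a₁ ^ r * (2 ^ (-(r * s)) * y ^ (-(r * s / κ))) := by ring
      _ ≤ T * 2 ^ (1 - r) * γ / 16 * a₁ ^ r * ((2 : ℝ) ^ J) ^ (-(r * s)) := by gcongr
      _ = (2 ^ J * T / 2) * (2 ^ (1 - r) * (a₁ ^ r * ((2 : ℝ) ^ J) ^ (-(r * s)) *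
            ((2 ^ J)⁻¹ * γ))) / 8 := by field_simp; ring
      _ ≤ _ := by gcongr
  · calc Real.exp _ ≤ Real.exp (Real.log 2) := by
          refine Real.exp_le_exp.2 ?_
          have := Real.log_two_gt_d9
          have := H.c_le
          linarith
      _ = 2 := Real.exp_log two_pos

/-- The lower bound from perturbations in a single cell. -/
theorem IsPerturbationFamily.sparse_rate (H : IsPerturbationFamily F f₀ g s ρ c a₀ T)
    (hρ : 0 ≤ ρ) (hρs : ρ ≤ s) {r : ℝ} (hr : 1 ≤ r) {ι : ℝ} (hι : 0 < ι) :
    ∃ C : ℝ, 0 < C ∧ ∃ n₀ : ℕ, ∀ (𝒵 : Type u) [MeasurableSpace 𝒵] (Q : Mechanism 𝒵),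
      (∀ i, IsMarkovKernel (Q i)) → ∀ (n : ℕ) (est : (Fin n → 𝒵) → ℝ → ℝ),
      Measurable (Function.uncurry est) → ∀ y : ℝ, (n₀ : ℝ) ≤ y → InfoScale g Q n y ι →
      ∀ R : ℝ≥0∞, (∀ f ∈ F, privateRisk r Q n est f ≤ R) →
        ENNReal.ofReal (C * (y / Real.log y) ^ (-(r * (s - ρ + 1 / r) / (2 * (s - ρ) + ι)))) ≤ R := by
  set σ := s - ρ with hσ
  have hσ0 : 0 ≤ σ := by linarith
  set κ := 2 * σ + ι with hκ
  have hκ0 : 0 < κ := by positivity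
  have hc := H.c_pos
  have ha₀ := H.a₀_pos
  have hT := H.T_pos
  -- The information is at most `a₁ log y`, so `a₁ ≤ 1/(4κ)` bounds its exponential by `z =
  -- y^(1/(4κ))`. The number of cells is at least of order `z²`, as `2^J ≥ (y / log y)^(1/κ) ≥
  -- y^(1/(2κ))`, so `z ≤ 2K` once `z T ≥ 1`.
  set a₁ := min a₀ (c / (4 * κ)) with ha₁
  have ha₁0 : 0 < a₁ := by positivity
  have ha₁c : a₁ ≤ c := (min_le_left _ _).trans H.a₀_le
  have ha₁κ : a₁ ≤ 1 / (4 * κ) := (min_le_right _ _).trans (by gcongr; exact H.c_le)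
  set γ := ∫ x, |g x| ^ r
  have hγ : 0 < γ := H.bump.integral_rpow_pos hr
  have hr0 : 0 < r := by linarith
  have hθ : r * (σ + 1 / r) = r * σ + 1 := by field_simp
  have hev : ∀ᶠ y : ℝ in atTop, 1 < y ∧ Real.log y ≤ y ^ (1 / 2 : ℝ) ∧
      max 1 (1 / T) ≤ y ^ (1 / (4 * κ)) := by
    refine (eventually_gt_atTop 1).and (Eventually.and ?_
      ((tendsto_rpow_atTop (by positivity)).eventually_ge_atTop _))
    have h := (isLittleO_log_rpow_atTop (by norm_num : (0 : ℝ) < 1 / 2)).bound one_pos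
    filter_upwards [h, eventually_gt_atTop 0] with y hy hy0
    rw [one_mul, Real.norm_of_nonneg (by positivity : (0 : ℝ) ≤ y ^ (1 / 2 : ℝ))] at hy
    exact (Real.le_norm_self _).trans hy
  obtain ⟨n₀, hn₀⟩ := eventually_exists_nat hev
  refine ⟨2 ^ (1 - r) * γ / 8 * a₁ ^ r * 2 ^ (-(r * σ + 1)), by positivity, n₀, ?_⟩
  intro 𝒵 _ Q hQ n est hest y hy hI R hR
  obtain ⟨hy1, hlog, hyz⟩ := hn₀ y hy
  have hy0 : 0 < y := by linarith
  have hlog0 : 0 < Real.log y := Real.log_pos hy1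
  set x := y / Real.log y with hx
  have hx0 : 0 < x := by positivity
  have hxy : y ^ (1 / 2 : ℝ) ≤ x := by
    rw [hx, le_div_iff₀ hlog0]
    calc y ^ (1 / 2 : ℝ) * Real.log y ≤ y ^ (1 / 2 : ℝ) * y ^ (1 / 2 : ℝ) := by gcongr
      _ = y := by rw [← Real.rpow_add hy0]; norm_num
  have hx1 : 1 ≤ x := (Real.one_le_rpow hy1.le (by norm_num)).trans hxy
  obtain ⟨J, hJ1, hJ2, hJ3⟩ := exists_dyadic_scale hx1 hκ0
  have h2J : (0 : ℝ) < 2 ^ J := by positivity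
  set z := y ^ (1 / (4 * κ)) with hz
  have hz1 : 1 ≤ z := (le_max_left _ _).trans hyz
  have hzT : 1 ≤ z * T := by
    have := (le_max_right _ _).trans hyz
    rwa [div_le_iff₀ hT] at this
  have hzJ : z ≤ 2 ^ J * T := by
    have h1 : z * z ≤ 2 ^ J := by
      calc z * z = (y ^ (1 / 2 : ℝ)) ^ (1 / κ) := by
            rw [hz, ← Real.rpow_add hy0, ← Real.rpow_mul hy0.le]
            congr 1
            field_simp
            norm_num
        _ ≤ x ^ (1 / κ) := by gcongr
        _ ≤ _ := hJ2
    calc z ≤ z * (z * T) := le_mul_of_one_le_right (by linarith) hzT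
      _ = z * z * T := by ring
      _ ≤ _ := by gcongr
  set a := a₁ * ((2 : ℝ) ^ ((J : ℝ) * σ))⁻¹ with ha
  have ha0 : 0 ≤ a := by positivity
  have haa₁ : a ≤ a₁ := by
    refine mul_le_of_le_one_right ha₁0.le (inv_le_one_of_one_le₀ ?_)
    exact Real.one_le_rpow one_le_two (by positivity)
  set K := ⌊(2 : ℝ) ^ J * T⌋₊ with hK
  have hKT : (K : ℝ) ≤ 2 ^ J * T := Nat.floor_le (by positivity)
  have hKl : 2 ^ J * T / 2 ≤ K := half_le_natFloor (hz1.trans hzJ)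
  have hK0 : 0 < K := Nat.floor_pos.2 (hz1.trans hzJ)
  have hcell : ∀ k < K, (k : ℝ) + 1 ≤ 2 ^ J * T := fun k hk => by
    have : (k : ℝ) + 1 ≤ K := by exact_mod_cast hk
    linarith
  have hmem : ∀ S ⊆ Finset.range K, S.card ≤ 1 → perturbed f₀ g J a S ∈ F := by
    intro S hS hcard
    refine H.mem J S a ha0 ?_ fun k hk => hcell k (Finset.mem_range.1 (hS hk))
    calc a * (S.card : ℝ) ^ ρ * (2 : ℝ) ^ ((J : ℝ) * (s - ρ))
        ≤ a * 1 * (2 : ℝ) ^ ((J : ℝ) * (s - ρ)) := by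
          gcongr
          exact Real.rpow_le_one (Nat.cast_nonneg _) (by exact_mod_cast hcard) hρ
      _ = a₁ := by rw [ha, ← hσ]; field_simp
      _ ≤ a₀ := min_le_left _ _
  have hmem₀ := hmem ∅ (Finset.empty_subset _) (by simp)
  have hmem₁ : ∀ k < K, perturbed f₀ g J a {k} ∈ F := fun k hk =>
    hmem {k} (by simpa using hk) (by simp)
  have hD := info_amplitude_le (c := c) hκ hx0 hy0.le ha₁0.le ha₁c hc hJ1
  have hyx : y / x = Real.log y := by rw [hx]; field_simp
  rw [hyx] at hD
  have hrisk := le_risk_of_single hQ hest hr H.bump (J := J) (K := K) ha0 (R := R)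
    (D := y * a ^ 2 * ((2 : ℝ) ^ ((J : ℝ) * ι))⁻¹ / c) hK0 ?_
    (H.isDensity _ hmem₀) (fun k hk => H.isDensity _ (hmem₁ k hk)) (hR _ hmem₀)
    (fun k hk => hR _ (hmem₁ k hk))
    (fun k hk => (H.infoBound hI ha0 (haa₁.trans ha₁c) (Finset.notMem_empty k) (hcell k hk) hmem₀
      (hmem₁ k hk)).2)
  · refine le_trans (ENNReal.ofReal_le_ofReal ?_) hrisk
    rw [ha, amplitude_rpow ha₁0.le, hθ]
    have hpow := rpow_neg_dyadic_ge hx0 (by positivity : 0 ≤ r * σ + 1) hJ3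
    calc 2 ^ (1 - r) * γ / 8 * a₁ ^ r * 2 ^ (-(r * σ + 1)) * x ^ (-((r * σ + 1) / κ))
        = 2 ^ (1 - r) * γ / 8 * a₁ ^ r * (2 ^ (-(r * σ + 1)) * x ^ (-((r * σ + 1) / κ))) := by ring
      _ ≤ 2 ^ (1 - r) * γ / 8 * a₁ ^ r * ((2 : ℝ) ^ J) ^ (-(r * σ + 1)) := by gcongr
      _ = _ := by
          rw [neg_add, Real.rpow_add h2J, Real.rpow_neg_one]
          ring
  · calc Real.exp _ ≤ Real.exp (Real.log y * (1 / (4 * κ))) :=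
          Real.exp_le_exp.2 (hD.trans (by gcongr))
      _ = z := by rw [hz, Real.rpow_def_of_pos hy0]
      _ ≤ 2 * K := by linarith

end Family

/-! ### Assembly of the four bounds. -/

lemma le_privateMinimaxRisk {𝒵 : Type u} [MeasurableSpace 𝒵] {r α : ℝ} {n : ℕ} {F : Set (ℝ → ℝ)}
    {x : ℝ≥0∞} (h : ∀ Q : Mechanism 𝒵, LocallyPrivate α Q → ∀ est : (Fin n → 𝒵) → ℝ → ℝ,
      Measurable (Function.uncurry est) → ∀ R : ℝ≥0∞, (∀ f ∈ F, privateRisk r Q n est f ≤ R) →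
        x ≤ R) : x ≤ privateMinimaxRisk 𝒵 r α n F :=
  le_iInf fun Q => le_iInf fun hQ => le_iInf fun est => le_iInf fun hest =>
    h Q hQ est hest _ fun f hf => le_iSup₂ (f := fun f _ => privateRisk r Q n est f) f hf

lemma ofReal_mul_max_le {C C₁ C₂ A B : ℝ} {R : ℝ≥0∞} (hC₁ : C ≤ C₁) (hC₂ : C ≤ C₂) (hA : 0 ≤ A)
    (hB : 0 ≤ B) (h₁ : ENNReal.ofReal (C₁ * A) ≤ R) (h₂ : ENNReal.ofReal (C₂ * B) ≤ R) :
    ENNReal.ofReal (C * max A B) ≤ R := by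
  rcases max_choice A B with h | h <;> rw [h]
  · exact (ENNReal.ofReal_le_ofReal (by gcongr)).trans h₁
  · exact (ENNReal.ofReal_le_ofReal (by gcongr)).trans h₂

theorem exists_isPerturbationFamily {N : ℕ} {φ ψ : ℝ → ℝ} (hφ : IsFatherWavelet N φ)
    (hψ : IsMotherWavelet N φ ψ) {s : ℝ} (hs : 0 < s) (hsN : s < (N : ℝ) + 1) {p q : ℝ≥0∞}
    (hp : 1 ≤ p) (hq : 1 ≤ q) (hsp : 1 / p.toReal ≤ s) {L T : ℝ} (hL : 0 < L) (hT : 0 < T)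
    (hLT : ∃ L' : ℝ, L' < L ∧ (besovDensities φ ψ s p q L' T).Nonempty) :
    ∃ (f₀ g : ℝ → ℝ) (c a₀ : ℝ), IsPerturbationFamily (besovDensities φ ψ s p q L T) f₀ g s
      (1 / p.toReal) c a₀ (T / 2) := by
  obtain ⟨g, hg⟩ := exists_isBump
  obtain ⟨f₀, c, a₀, hc, hc1, ha₀, hac, hbase, hmem⟩ :=
    exists_perturbed_mem hφ hψ hs hsN hp hq hsp hL hT hLT hg
  exact ⟨f₀, g, c, a₀, hg, hc, hc1, ha₀, hac, by linarith, hbase,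
    fun f hf => ⟨hf.1, hf.2.1, hf.2.2.1, hf.2.2.2.1⟩, hmem⟩

end

theorem mainTheorem3
    (N : ℕ) (φ ψ : ℝ → ℝ) (hφ : IsFatherWavelet N φ) (hψ : IsMotherWavelet N φ ψ)
    (s : ℝ) (hs : 0 < s) (hsN : s < (N : ℝ) + 1)
    (p q : ℝ≥0∞) (hp : 1 ≤ p) (hq : 1 ≤ q) (hsp : 1 / p.toReal ≤ s)
    (r : ℝ) (hr : 1 ≤ r) (L T : ℝ) (hL : 0 < L) (hT : 0 < T)
    (hLT : ∃ L' : ℝ, L' < L ∧ (besovDensities φ ψ s p q L' T).Nonempty) :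
    ∃ C : ℝ, 0 < C ∧ ∃ n₀ : ℕ, ∀ (𝒵 : Type u) [MeasurableSpace 𝒵] (α : ℝ), 0 < α →
      ∀ n : ℕ, n₀ ≤ n → ∀ m : ℝ, m = (n : ℝ) * (Real.exp α - 1) ^ 2 → (n₀ : ℝ) ≤ m →
        (ENNReal.ofReal (r / (s + 1)) < p →
          ENNReal.ofReal (C * max
              ((n : ℝ) ^ (-(r * s / (2 * s + 1))))
              (m ^ (-(r * s / (2 * s + 2)))))
            ≤ privateMinimaxRisk 𝒵 r α n (besovDensities φ ψ s p q L T)) ∧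
        (ENNReal.ofReal (r / (2 * s + 1)) < p → p ≤ ENNReal.ofReal (r / (s + 1)) →
          ENNReal.ofReal (C * max
              ((n : ℝ) ^ (-(r * s / (2 * s + 1))))
              ((m / Real.log m) ^
                (-(r * (s - 1 / p.toReal + 1 / r) / (2 * (s - 1 / p.toReal) + 2)))))
            ≤ privateMinimaxRisk 𝒵 r α n (besovDensities φ ψ s p q L T)) ∧
        (p ≤ ENNReal.ofReal (r / (2 * s + 1)) →
          ENNReal.ofReal (C * max
              (((n : ℝ) / Real.log n) ^
                (-(r * (s - 1 / p.toReal + 1 / r) / (2 * (s - 1 / p.toReal) + 1))))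
              ((m / Real.log m) ^
                (-(r * (s - 1 / p.toReal + 1 / r) / (2 * (s - 1 / p.toReal) + 2)))))
            ≤ privateMinimaxRisk 𝒵 r α n (besovDensities φ ψ s p q L T)) := by

  obtain ⟨f₀, g, c, a₀, H⟩ := exists_isPerturbationFamily hφ hψ hs hsN hp hq hsp hL hT hLT
  have hρ : 0 ≤ 1 / p.toReal := by positivity
  have hρ1 := one_div_toReal_le_one hp
  obtain ⟨C₁, hC₁, n₁, h₁⟩ := H.dense_rate.{u} hs hρ hρ1 hr one_pos
  obtain ⟨C₂, hC₂, n₂, h₂⟩ := H.dense_rate.{u} hs hρ hρ1 hr two_pos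
  obtain ⟨C₃, hC₃, n₃, h₃⟩ := H.sparse_rate.{u} hρ hsp hr one_pos
  obtain ⟨C₄, hC₄, n₄, h₄⟩ := H.sparse_rate.{u} hρ hsp hr two_pos
  -- The `+ 1` ensures `n ≥ 1` and `m ≥ 1`, so that the logarithms, and with them the bases `n / log
  -- n` and `m / log m`, are nonnegative.
  refine ⟨min (min C₁ C₂) (min C₃ C₄), by positivity, max (max n₁ n₂) (max n₃ n₄) + 1, ?_⟩
  intro 𝒵 _ α hα n hn m hm hmn
  have hle₁ : min (min C₁ C₂) (min C₃ C₄) ≤ C₁ := (min_le_left _ _).trans (min_le_left _ _)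
  have hle₂ : min (min C₁ C₂) (min C₃ C₄) ≤ C₂ := (min_le_left _ _).trans (min_le_right _ _)
  have hle₃ : min (min C₁ C₂) (min C₃ C₄) ≤ C₃ := (min_le_right _ _).trans (min_le_left _ _)
  have hle₄ : min (min C₁ C₂) (min C₃ C₄) ≤ C₄ := (min_le_right _ _).trans (min_le_right _ _)
  have hcast : ∀ {k : ℕ} {y : ℝ}, k ≤ max (max n₁ n₂) (max n₃ n₄) →
      ((max (max n₁ n₂) (max n₃ n₄) + 1 : ℕ) : ℝ) ≤ y → (k : ℝ) ≤ y ∧ 1 ≤ y := by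
    intro k y hk hy
    have h1 : (k : ℝ) ≤ (max (max n₁ n₂) (max n₃ n₄) : ℕ) := by exact_mod_cast hk
    have h2 : (0 : ℝ) ≤ k := Nat.cast_nonneg k
    rw [Nat.cast_add, Nat.cast_one] at hy
    constructor <;> linarith
  have hn' : ((max (max n₁ n₂) (max n₃ n₄) + 1 : ℕ) : ℝ) ≤ n := by exact_mod_cast hn
  have hm1 : 1 ≤ m := (hcast (Nat.zero_le _) hmn).2
  have hn1 : (1 : ℝ) ≤ n := (hcast (Nat.zero_le _) hn').2
  have hlm : 0 ≤ m / Real.log m := div_nonneg (by linarith) (Real.log_nonneg hm1)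
  have hln : 0 ≤ (n : ℝ) / Real.log n := div_nonneg (by linarith) (Real.log_nonneg hn1)
  have hI₂ : ∀ Q : Mechanism 𝒵, LocallyPrivate α Q → InfoScale g Q n m 2 := fun Q hQ =>
    hm ▸ infoScale_two H.bump hα.le hQ n
  have b₁ := le_privateMinimaxRisk (x := ENNReal.ofReal (C₁ * (n : ℝ) ^ (-(r * s / (2 * s + 1)))))
    fun Q (hQ : LocallyPrivate α Q) est hest => h₁ 𝒵 Q hQ.1 n est hest n
      (hcast (by simp) hn').1 (infoScale_one H.bump hQ.1 n)
  have b₂ := le_privateMinimaxRisk (x := ENNReal.ofReal (C₂ * m ^ (-(r * s / (2 * s + 2)))))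
    fun Q (hQ : LocallyPrivate α Q) est hest => h₂ 𝒵 Q hQ.1 n est hest m
      (hcast (by simp) hmn).1 (hI₂ Q hQ)
  have b₃ := le_privateMinimaxRisk (x := ENNReal.ofReal (C₃ * ((n : ℝ) / Real.log n) ^
      (-(r * (s - 1 / p.toReal + 1 / r) / (2 * (s - 1 / p.toReal) + 1)))))
    fun Q (hQ : LocallyPrivate α Q) est hest => h₃ 𝒵 Q hQ.1 n est hest n
      (hcast (by simp) hn').1 (infoScale_one H.bump hQ.1 n)
  have b₄ := le_privateMinimaxRisk (x := ENNReal.ofReal (C₄ * (m / Real.log m) ^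
      (-(r * (s - 1 / p.toReal + 1 / r) / (2 * (s - 1 / p.toReal) + 2)))))
    fun Q (hQ : LocallyPrivate α Q) est hest => h₄ 𝒵 Q hQ.1 n est hest m
      (hcast (by simp) hmn).1 (hI₂ Q hQ)
  -- The regimes pair dense with dense, dense in `n` with sparse in `m`, and sparse with sparse.
  exact ⟨fun _ => ofReal_mul_max_le hle₁ hle₂ (by positivity) (by positivity) b₁ b₂,
    fun _ _ => ofReal_mul_max_le hle₁ hle₄ (by positivity) (by positivity) b₁ b₄,
    fun _ => ofReal_mul_max_le hle₃ hle₄ (by positivity) (by positivity) b₃ b₄⟩
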